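/- **Setting.** Let $A=A_0\oplus A_1$ be a supercommutative $\mathbb Z/2$-graded $\mathbb Q$-algebra (superfields; $A_0$ bosonic, $A_1$ fermionic) with an odd superderivation $D_\theta$ and commuting even derivations $\partial/\partial t_k$ ($k\ge 1$) that commute with $D_\theta$, where $t_1=x$ and $D_\theta^2=\partial_x=\partial/\partial t_1$. Super-pseudo-differential operators are the formal series $P=\sum_{j\le N}a_j\mathcal D^j$, $a_j\in A$, multiplied by $\mathcal D\,b=(D_\theta b)+(-1)^{|b|}b\,\mathcal D$ and its consequence for $\mathcal D^{-1}$. Put $P_+=\sum_{j\ge0}a_j\mathcal D^j$, $\mathrm{Res}\,P=a_{-1}$, and let $P^*$ be the adjoint with $\mathcal D^*=-\mathcal D$, $(PQ)^*=(-1)^{|P||Q|}Q^*P^*$. **The hierarchy.** Let $m\ge1$ be odd. A solution of $\mathsf{SKP}_{1/2,m/2}$ (bosonic flows) is a triple $(L,\Phi,\Psi)$ with $$L=\mathcal D+f_0+\sum_{j=0}^{m-1}\Phi_{(m-1-j)/2}\,\mathcal D^{-1}\,\Psi_{j/2},\qquad f_0\in A_1,$$ where all $\Phi_{j/2},\Psi_{j/2}$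 are homogeneous, $\Phi_{j/2}$ and $\Psi_{(m-1-j)/2}$ have equal parity, and for all $k\ge1$ $$\tfrac{\partial L}{\partial t_k}=[L^{2k}_+,L],\qquad \tfrac{\partial\Phi_{j/2}}{\partial t_k}=L^{2k}_+(\Phi_{j/2}),\qquad \tfrac{\partial\Psi_{j/2}}{\partial t_k}=-(L^{2k})^*_+(\Psi_{j/2}).$$ A super-tau function of $L$ is an invertible $\tau\in A_0$ with $\mathrm{Res}\,L^{2k}=\frac{\partial}{\partial t_k}D_\theta\ln\tau$ for all $k\ge1$, where $D_\theta\ln\tau:=\tau^{-1}D_\theta\tau$. For a superfield $f$ put $L(f)=L_+(f)+\sum_j\Phi_{(m-1-j)/2}\,D_\theta^{-1}(\Psi_{j/2}f)$. Here $D_\theta^{-1}(\psi f)$ denotes any $S\in A$ of parity $|\psi|+|f|+1$ with $D_\theta S=\psi f$ and $\partial S/\partial t_k=\mathrm{Res}\,(\mathcal D^{-1}\psi L^{2k}_+f\mathcal D^{-1})$ for all $k\ge 1$; its additive constant may be chosen freely, and the theorem below holds for every choice. **Darboux–Bäcklund (DB) orbit.** Let $(L^{(0)},\Phi^{(0)},\Psi^{(0)})$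 be a solution of $\mathsf{SKP}_{1/2,m/2}$ in which $\Phi_{j/2}$ and $\Psi_{j/2}$ have parity $j \bmod 2$, and let $\tau^{(0)}$ be a super-tau function of $L^{(0)}$. The $N$-th DB step ($N=0,1,2,\dots$) uses $\chi=\Phi^{(N)}_{a/2}$ with $a=N\bmod m$, which is required to be invertible, and $\mathcal T=\chi\mathcal D\chi^{-1}$: omitting the superscript $(N)$ and writing $\widetilde{\ }$ for $(N+1)$, $$\widetilde L=\mathcal TL\mathcal T^{-1},\quad \widetilde\Phi_{a/2}=\mathcal T(L(\Phi_{a/2})),\quad \widetilde\Psi_{(m-1-a)/2}=\chi^{-1},\quad \widetilde\Phi_{i/2}=\mathcal T(\Phi_{i/2})\ (i\ne a),$$ $$\widetilde\Psi_{j/2}=(-1)^{|\Psi_{j/2}|}\chi^{-1}D_\theta^{-1}(\chi\Psi_{j/2})\ (j\ne m-1-a),\qquad \widetilde\tau=\chi\,\tau^{-1},$$ where in each step the same values $D_\theta^{-1}(\Psi_{j/2}\chi)=D_\theta^{-1}(\chi\Psi_{j/2})$ are used throughout. Suppose that $M$ steps have been carried out. Put $\varphi_{(ml+j)/2}=L^l(\Phi_{j/2})$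 for $0\le j\le m-1$, $l\ge0$, $ml+j<\max(M,m)$, with $L=L^{(0)}$, $\Phi=\Phi^{(0)}$ (assuming that the $D_\theta^{-1}$ needed here exist in $A$), and let $$\mathrm{Ber}_{(k,l)}[\varphi]=\mathrm{Ber}\begin{pmatrix}\mathcal W_{k,k}[\varphi_0,\dots,\varphi_{k-1}]&\mathcal W_{k,l}[\varphi_{1/2},\dots,\varphi_{l-1/2}]\\ \mathcal W_{l,k}[D_\theta\varphi_0,\dots,D_\theta\varphi_{k-1}]&\mathcal W_{l,l}[D_\theta\varphi_{1/2},\dots,D_\theta\varphi_{l-1/2}]\end{pmatrix},$$ where $\mathcal W_{k,l}[f_1,\dots,f_l]=(\partial_x^{\alpha-1}f_\beta)_{\alpha\le k,\ \beta\le l}$ and $\mathrm{Ber}\begin{pmatrix}P&Q\\R&S\end{pmatrix}=\det(P-QS^{-1}R)\,(\det S)^{-1}$. **Theorem.** For every $N\le M$, $(L^{(N)},\Phi^{(N)},\Psi^{(N)})$ is a solution of $\mathsf{SKP}_{1/2,m/2}$ and $\tau^{(N)}$ is a super-tau function of $L^{(N)}$. Moreover the following Berezinians exist (the determinants of their lower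 right blocks are invertible), are invertible, and $$\tau^{(2n+1)}=\mathrm{Ber}_{(n+1,n)}[\varphi_0,\dots,\varphi_n;\varphi_{1/2},\dots,\varphi_{n-1/2}]\,\frac1{\tau^{(0)}}\qquad(2n+1\le M),$$ $$\tau^{(2n)}=\bigl(\mathrm{Ber}_{(n,n)}[\varphi_0,\dots,\varphi_{n-1};\varphi_{1/2},\dots,\varphi_{n-1/2}]\bigr)^{-1}\tau^{(0)}\qquad(2n\le M).$$ -/

import Mathlib

/-! ### Superfields -/

/-- Supercommutativity of a `ZMod 2`-graded algebra: `𝒜 0` consists of the bosonic (Grassmann-even)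
and `𝒜 1` of the fermionic (Grassmann-odd) elements. -/
class SuperCommutative {A : Type*} [Ring A] [Algebra ℚ A] (𝒜 : ZMod 2 → Submodule ℚ A) : Prop where
  even_comm : ∀ {a : A}, a ∈ 𝒜 0 → ∀ b : A, a * b = b * a
  odd_anticomm : ∀ {a b : A}, a ∈ 𝒜 1 → b ∈ 𝒜 1 → a * b = -(b * a)

/-- The parity involution `a₀ + a₁ ↦ a₀ - a₁`, i.e. `a ↦ (-1)^|a| a` on homogeneous elements. -/
def parity {A : Type*} [Ring A] [Algebra ℚ A] (𝒜 : ZMod 2 → Submodule ℚ A) [GradedAlgebra 𝒜] :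
    A →ₗ[ℚ] A :=
  GradedAlgebra.proj 𝒜 0 - GradedAlgebra.proj 𝒜 1

/-- The calculus on an algebra `A` of superfields depending on the even times
`t₁ = x, t₂, t₃, …` and on `θ` (and possibly on further parameters): `D` is the odd
superderivation `D_θ = ∂/∂θ + θ ∂_x`, so that `D_θ² = ∂_x = ∂/∂t₁`, and `dt k` is the even
derivation `∂/∂t_k`. -/
structure SuperCalculus {A : Type*} [Ring A] [Algebra ℚ A] (𝒜 : ZMod 2 → Submodule ℚ A)
    [GradedAlgebra 𝒜] where
  D : A →ₗ[ℚ] A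
  D_mem : ∀ {p : ZMod 2} {a : A}, a ∈ 𝒜 p → D a ∈ 𝒜 (p + 1)
  D_mul : ∀ a b : A, D (a * b) = D a * b + parity 𝒜 a * D b
  dt : ℕ+ → A →ₗ[ℚ] A
  dt_mem : ∀ (k : ℕ+) {p : ZMod 2} {a : A}, a ∈ 𝒜 p → dt k a ∈ 𝒜 p
  dt_mul : ∀ (k : ℕ+) (a b : A), dt k (a * b) = dt k a * b + a * dt k b
  dt_dt : ∀ (k l : ℕ+) (a : A), dt k (dt l a) = dt l (dt k a)
  dt_D : ∀ (k : ℕ+) (a : A), dt k (D a) = D (dt k a)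
  dt_one : ∀ a : A, dt 1 a = D (D a)

/-! ### Super-pseudo-differential operators -/

/-- Coefficient families of formal series `∑_{j ≤ N} a_j 𝒟^j`. -/
def spdoSubgroup (A : Type*) [AddCommGroup A] : AddSubgroup (ℤ → A) where
  carrier := {c | ∃ N : ℤ, ∀ j, N < j → c j = 0}
  zero_mem' := ⟨0, fun _ _ => rfl⟩
  add_mem' := by
    rintro a b ⟨N, hN⟩ ⟨N', hN'⟩
    refine ⟨max N N', fun j hj => ?_⟩
    simp [hN j (lt_of_le_of_lt (le_max_left _ _) hj), hN' j (lt_of_le_of_lt (le_max_right _ _) hj)]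
  neg_mem' := by
    rintro a ⟨N, hN⟩
    exact ⟨N, fun j hj => by simp [hN j hj]⟩

/-- Super-pseudo-differential operators `∑_{j ≤ N} a_j 𝒟^j` with coefficients in `A`. -/
abbrev SPDO (A : Type*) [AddCommGroup A] : Type _ := spdoSubgroup A

/-- The super-binomial coefficients, in terms of which
`𝒟^i b = ∑_{k ≥ 0} superChoose i k · (-1)^{|b|(i-k)} (D_θ^k b) 𝒟^{i-k}` for every integer `i`. -/
def superChoose (i : ℤ) (k : ℕ) : ℤ :=
  if Even i ∧ Odd k then 0 else Ring.choose (i / 2) (k / 2)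

namespace SPDO

/-- The operator `a 𝒟^i`. -/
def mono {A : Type*} [AddCommGroup A] (a : A) (i : ℤ) : SPDO A :=
  ⟨fun j => if j = i then a else 0, i, fun _ hj => if_neg (ne_of_gt hj)⟩

/-- The purely differential part `P₊`. -/
def plus {A : Type*} [AddCommGroup A] (P : SPDO A) : SPDO A :=
  ⟨fun j => if 0 ≤ j then P.1 j else 0, by
    obtain ⟨N, hN⟩ := P.2
    exact ⟨N, fun j hj => by simp [hN j hj]⟩⟩

/-- The super-residuum, the coefficient of `𝒟⁻¹`. -/
def res {A : Type*} [AddCommGroup A] (P : SPDO A) : A := P.1 (-1)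

/-- The operator whose coefficients are the images of those of `P`. -/
def mapCoeff {A : Type*} [Ring A] [Algebra ℚ A] (d : A →ₗ[ℚ] A) (P : SPDO A) : SPDO A :=
  ⟨fun j => d (P.1 j), by
    obtain ⟨N, hN⟩ := P.2
    exact ⟨N, fun j hj => by simp [hN j hj]⟩⟩

end SPDO

namespace SuperCalculus

variable {A : Type*} [Ring A] [Algebra ℚ A] {𝒜 : ZMod 2 → Submodule ℚ A} [GradedAlgebra 𝒜]

/-- `∂_x = D_θ²`. -/
def dx (C : SuperCalculus 𝒜) : A →ₗ[ℚ] A := C.D ∘ₗ C.D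

/-- `b ↦ (-1)^{|b| i} b`. -/
def twist (_C : SuperCalculus 𝒜) (i : ℤ) (b : A) : A := if Even i then b else parity 𝒜 b

/-- The coefficient of `𝒟^n` in the product `(a 𝒟^i)(b 𝒟^j)`. -/
def mulCoeff (C : SuperCalculus 𝒜) (a : A) (i : ℤ) (b : A) (j n : ℤ) : A :=
  if n ≤ i + j then
    superChoose i (i + j - n).toNat •
      (a * (C.D ^ (i + j - n).toNat) (C.twist (i - (i + j - n)) b))
  else 0

/-- The product of super-pseudo-differential operators; the sum has only finitely many nonzero
terms. -/
noncomputable def mul (C : SuperCalculus 𝒜) (P Q : SPDO A) : SPDO A :=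
  ⟨fun n => ∑ᶠ ij : ℤ × ℤ, C.mulCoeff (P.1 ij.1) ij.1 (Q.1 ij.2) ij.2 n, by
    obtain ⟨N, hN⟩ := P.2
    obtain ⟨N', hN'⟩ := Q.2
    refine ⟨N + N', fun n hn => ?_⟩
    refine (finsum_congr fun ij => ?_).trans finsum_zero
    unfold mulCoeff
    split_ifs with h
    · rcases lt_or_ge N ij.1 with h1 | h1
      · simp [hN _ h1]
      · have h2 : N' < ij.2 := by omega
        simp [hN' _ h2, twist]
    · rfl⟩

/-- Powers of a super-pseudo-differential operator. -/
noncomputable def pow (C : SuperCalculus 𝒜) (P : SPDO A) : ℕ → SPDO A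
  | 0 => SPDO.mono 1 0
  | n + 1 => C.mul P (pow C P n)

/-- The value `P₊(f)` of the differential part of `P` on a superfield. -/
noncomputable def applyPlus (C : SuperCalculus 𝒜) (P : SPDO A) (f : A) : A :=
  ∑ᶠ j : ℕ, P.1 j * (C.D ^ j) f

/-- The value `(P*)₊(f) = (P₊)*(f)`, where `(P Q)* = (-1)^{|P||Q|} Q* P*`, `𝒟* = -𝒟` and `a* = a`,
so that `(a 𝒟^j)* = (-1)^{j(j+1)/2} 𝒟^j (-1)^{j|a|} a`. -/
noncomputable def adjApplyPlus (C : SuperCalculus 𝒜) (P : SPDO A) (f : A) : A :=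
  ∑ᶠ j : ℕ, ((-1 : ℤ) ^ (j * (j + 1) / 2)) • (C.D ^ j) (C.twist j (P.1 j) * f)

end SuperCalculus

/-! ### Constrained hierarchies `SKP_{1/2,m/2}` -/

/-- A super-Lax operator together with superfields `Φ_{j/2}`, `Ψ_{j/2}`, `0 ≤ j ≤ m-1`. -/
structure SKPData (A : Type*) [AddCommGroup A] (m : ℕ) where
  L : SPDO A
  Φ : Fin m → A
  Ψ : Fin m → A

namespace SuperCalculus

variable {A : Type*} [Ring A] [Algebra ℚ A] {𝒜 : ZMod 2 → Submodule ℚ A} [GradedAlgebra 𝒜]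

/-- `X` is a solution of the constrained hierarchy `SKP_{1/2,m/2}`:
`L = 𝒟 + f₀ + ∑_j Φ_{(m-1-j)/2} 𝒟⁻¹ Ψ_{j/2}` with fermionic `f₀`, `L` obeys the Lax equations, and
`Φ_{j/2}` (`Ψ_{j/2}`) are (adjoint) super-eigenfunctions of `L`. The Grassmann parity of
`Φ_{j/2}`, and of its partner `Ψ_{(m-1-j)/2}`, is `p j`. -/
structure IsSKP (C : SuperCalculus 𝒜) {m : ℕ} (p : Fin m → ZMod 2) (X : SKPData A m) : Prop where
  Φ_mem : ∀ j, X.Φ j ∈ 𝒜 (p j)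
  Ψ_mem : ∀ j, X.Ψ j ∈ 𝒜 (p j.rev)
  form : ∃ f₀ ∈ 𝒜 1, X.L = SPDO.mono 1 1 + SPDO.mono f₀ 0 +
    ∑ j, C.mul (SPDO.mono (X.Φ j.rev) (-1)) (SPDO.mono (X.Ψ j) 0)
  lax : ∀ k : ℕ+, SPDO.mapCoeff (C.dt k) X.L =
    C.mul (C.pow X.L (2 * k)).plus X.L - C.mul X.L (C.pow X.L (2 * k)).plus
  flow_Φ : ∀ (k : ℕ+) (j), C.dt k (X.Φ j) = C.applyPlus (C.pow X.L (2 * k)) (X.Φ j)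
  flow_Ψ : ∀ (k : ℕ+) (j), C.dt k (X.Ψ j) = -C.adjApplyPlus (C.pow X.L (2 * k)) (X.Ψ j)

/-- `τ` is a super-tau function of `L`: an invertible bosonic superfield with
`Res L^{2k} = ∂/∂t_k D_θ ln τ`. -/
structure IsSuperTau (C : SuperCalculus 𝒜) (L : SPDO A) (τ : A) : Prop where
  even : τ ∈ 𝒜 0
  unit : IsUnit τ
  res_eq : ∀ k : ℕ+, (C.pow L (2 * k)).res = C.dt k (Ring.inverse τ * C.D τ)

/-- `S` is a value of `D_θ⁻¹(ψ f)` for an adjoint super-eigenfunction `ψ` and a super-eigenfunction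
`f` of `L`: a `D_θ`-antiderivative of `ψ f`, of parity `|ψ| + |f| + 1`, depending on the times as
forced by those of `ψ` and `f`, `∂S/∂t_k = Res (𝒟⁻¹ ψ L^{2k}₊ f 𝒟⁻¹)`. It is determined by `ψ`, `f`
up to an additive constant. -/
structure IsPotential (C : SuperCalculus 𝒜) (L : SPDO A) (ψ f S : A) : Prop where
  mem : ∀ p q : ZMod 2, ψ ∈ 𝒜 p → f ∈ 𝒜 q → S ∈ 𝒜 (p + q + 1)
  D_eq : C.D S = ψ * f
  dt_eq : ∀ k : ℕ+, C.dt k S = (C.mul (SPDO.mono 1 (-1))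
    (C.mul (SPDO.mono ψ 0) (C.mul (C.pow L (2 * k)).plus (SPDO.mono f (-1))))).res

/-- `L(f) = L₊(f) + ∑_j Φ_{(m-1-j)/2} D_θ⁻¹(Ψ_{j/2} f)`, where `S j` is the chosen value of
`D_θ⁻¹(Ψ_{j/2} f)`. -/
noncomputable def laxApply (C : SuperCalculus 𝒜) {m : ℕ} (X : SKPData A m) (f : A) (S : Fin m → A) :
    A :=
  C.applyPlus X.L f + ∑ j, X.Φ j.rev * S j

/-! ### Darboux–Bäcklund orbits -/

/-- The operator `T = χ 𝒟 χ⁻¹`. -/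
noncomputable def dbOp (C : SuperCalculus 𝒜) (χ : A) : SPDO A :=
  C.mul (SPDO.mono χ 1) (SPDO.mono (Ring.inverse χ) 0)

/-- The operator `T⁻¹ = χ 𝒟⁻¹ χ⁻¹`. -/
noncomputable def dbOpInv (C : SuperCalculus 𝒜) (χ : A) : SPDO A :=
  C.mul (SPDO.mono χ (-1)) (SPDO.mono (Ring.inverse χ) 0)

/-- The superfield `T(f) = χ D_θ(χ⁻¹ f)`. -/
noncomputable def dbApply (C : SuperCalculus 𝒜) (χ f : A) : A :=
  χ * C.D (Ring.inverse χ * f)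

/-- `Y` is obtained from `X` by the (auto-)DB transformation generated by `χ = Φ_{a/2}`:
`L̃ = T L T⁻¹`, `Φ̃_{a/2} = T(L(Φ_{a/2}))` with partner `Φ_{a/2}⁻¹`, and for the remaining pairs
`Φ̃ = T(Φ)`, `Ψ̃ = (-1)^{|Ψ|} χ⁻¹ D_θ⁻¹(χ Ψ)`. The last sign is written through the parity
involution: `D_θ⁻¹(χ Ψ)` has parity `|Ψ| + 1` for bosonic `χ`. -/
def IsDBStep (C : SuperCalculus 𝒜) {m : ℕ} (a : Fin m) (X Y : SKPData A m) : Prop :=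
  IsUnit (X.Φ a) ∧
  Y.L = C.mul (C.mul (C.dbOp (X.Φ a)) X.L) (C.dbOpInv (X.Φ a)) ∧
  ∃ S : Fin m → A, (∀ j, C.IsPotential X.L (X.Ψ j) (X.Φ a) (S j)) ∧
    Y.Φ a = C.dbApply (X.Φ a) (C.laxApply X (X.Φ a) S) ∧
    (∀ i, i ≠ a → Y.Φ i = C.dbApply (X.Φ a) (X.Φ i)) ∧
    Y.Ψ a.rev = Ring.inverse (X.Φ a) ∧
    ∀ j, j ≠ a.rev → Y.Ψ j = -(Ring.inverse (X.Φ a) * parity 𝒜 (S j))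

/-- The first `M` steps of the DB orbit on which the super-eigenfunctions
`Φ_0, Φ_{1/2}, …, Φ_{(m-1)/2}` are used cyclically. -/
def IsDBOrbit (C : SuperCalculus 𝒜) {m : ℕ} [NeZero m] (M : ℕ) (X : ℕ → SKPData A m) : Prop :=
  ∀ N < M, C.IsDBStep (Fin.ofNat m N) (X N) (X (N + 1))

/-- `φ (m l + j) = L^l(Φ_{j/2})` for all indices below `M`; `φ n` stands for `φ_{n/2}`. -/
def IsSeed (C : SuperCalculus 𝒜) {m : ℕ} (M : ℕ) (X : SKPData A m) (φ : ℕ → A) : Prop :=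
  (∀ j : Fin m, φ j = X.Φ j) ∧
  ∀ i, i + m < M → ∃ S : Fin m → A, (∀ j, C.IsPotential X.L (X.Ψ j) (φ i) (S j)) ∧
    φ (i + m) = C.laxApply X (φ i) S

end SuperCalculus

/-- The superfields `τ^{(N)}` with `τ^{(0)} = τ₀` and `τ^{(N+1)} = χ (τ^{(N)})⁻¹`, where `χ` is the
super-eigenfunction that generates the `N`-th step. -/
noncomputable def tauOrbit {A : Type*} [Ring A] {m : ℕ} [NeZero m] (X : ℕ → SKPData A m) (τ₀ : A) :
    ℕ → A
  | 0 => τ₀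
  | N + 1 => (X N).Φ (Fin.ofNat m N) * Ring.inverse (tauOrbit X τ₀ N)

/-! ### Berezinians -/

/-- The subring of bosonic elements. -/
def evenSubring {A : Type*} [Ring A] [Algebra ℚ A] (𝒜 : ZMod 2 → Submodule ℚ A) [GradedAlgebra 𝒜] :
    Subring A where
  carrier := 𝒜 0
  mul_mem' := fun {a b} ha hb => by
    have h := SetLike.GradedMul.mul_mem (A := 𝒜) ha hb
    rwa [add_zero] at h
  one_mem' := SetLike.GradedOne.one_mem
  add_mem' := (𝒜 0).add_mem
  zero_mem' := (𝒜 0).zero_mem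
  neg_mem' := (𝒜 0).neg_mem

instance evenCommRing {A : Type*} [Ring A] [Algebra ℚ A] (𝒜 : ZMod 2 → Submodule ℚ A)
    [GradedAlgebra 𝒜] [SuperCommutative 𝒜] : CommRing (evenSubring 𝒜) :=
  { (inferInstance : Ring (evenSubring 𝒜)) with
    mul_comm := fun a b => Subtype.ext (SuperCommutative.even_comm a.2 (b : A)) }

/-- The bosonic component of an element; bosonic elements are unchanged. -/
def evenPart {A : Type*} [Ring A] [Algebra ℚ A] (𝒜 : ZMod 2 → Submodule ℚ A) [GradedAlgebra 𝒜]
    (a : A) : evenSubring 𝒜 :=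
  ⟨(DirectSum.decompose 𝒜 a 0 : A), (DirectSum.decompose 𝒜 a 0).2⟩

/-- The determinant of a square matrix with bosonic entries. -/
noncomputable def evenDet {A : Type*} [Ring A] [Algebra ℚ A] (𝒜 : ZMod 2 → Submodule ℚ A)
    [GradedAlgebra 𝒜] [SuperCommutative 𝒜] {k : ℕ} (P : Matrix (Fin k) (Fin k) A) :
    evenSubring 𝒜 :=
  (P.map (evenPart 𝒜)).det

/-- The inverse of a square matrix with bosonic entries (meaningful if `evenDet` is a unit). -/
noncomputable def evenInv {A : Type*} [Ring A] [Algebra ℚ A] (𝒜 : ZMod 2 → Submodule ℚ A)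
    [GradedAlgebra 𝒜] [SuperCommutative 𝒜] {k : ℕ} (P : Matrix (Fin k) (Fin k) A) :
    Matrix (Fin k) (Fin k) A :=
  ((P.map (evenPart 𝒜))⁻¹).map Subtype.val

/-- The Berezinian `det (P - Q S⁻¹ R) (det S)⁻¹` of the supermatrix with blocks `P | Q` above
`R | S`, where `P, S` are bosonic, `Q, R` are fermionic, and `det S` is invertible. -/
noncomputable def ber {A : Type*} [Ring A] [Algebra ℚ A] (𝒜 : ZMod 2 → Submodule ℚ A)
    [GradedAlgebra 𝒜] [SuperCommutative 𝒜] {k l : ℕ} (P : Matrix (Fin k) (Fin k) A)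
    (Q : Matrix (Fin k) (Fin l) A) (R : Matrix (Fin l) (Fin k) A) (S : Matrix (Fin l) (Fin l) A) :
    evenSubring 𝒜 :=
  evenDet 𝒜 (P - Q * evenInv 𝒜 S * R) * Ring.inverse (evenDet 𝒜 S)

namespace SuperCalculus

variable {A : Type*} [Ring A] [Algebra ℚ A] {𝒜 : ZMod 2 → Submodule ℚ A} [GradedAlgebra 𝒜]

/-- The rectangular Wronskian matrix `W_{k,l}[f]` with entries `∂_x^α f_β`. -/
def wronskian (C : SuperCalculus 𝒜) (k : ℕ) {l : ℕ} (f : Fin l → A) : Matrix (Fin k) (Fin l) A :=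
  Matrix.of fun α β => (C.dx ^ (α : ℕ)) (f β)

/-- `det W_{l,l}[D_θ φ_{1/2}, …, D_θ φ_{l-1/2}]`, the denominator of the Berezinian below. -/
noncomputable def lowerDet (C : SuperCalculus 𝒜) [SuperCommutative 𝒜] (l : ℕ) (φ : ℕ → A) :
    evenSubring 𝒜 :=
  evenDet 𝒜 (C.wronskian l fun β : Fin l => C.D (φ (2 * β + 1)))

/-- The Wronskian-type Berezinian `Ber_{(k,l)}[φ_0, …, φ_{k-1}; φ_{1/2}, …, φ_{l-1/2}]`, where `φ n`
stands for `φ_{n/2}`. -/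
noncomputable def berW (C : SuperCalculus 𝒜) [SuperCommutative 𝒜] (k l : ℕ) (φ : ℕ → A) :
    evenSubring 𝒜 :=
  ber 𝒜 (C.wronskian k fun β : Fin k => φ (2 * β))
    (C.wronskian k fun β : Fin l => φ (2 * β + 1))
    (C.wronskian l fun β : Fin k => C.D (φ (2 * β)))
    (C.wronskian l fun β : Fin l => C.D (φ (2 * β + 1)))

end SuperCalculus

/-! A DB step conjugates L by T = χ𝒟χ⁻¹, an operator that kills χ. Because χ is a
super-eigenfunction, the nonlocal tail of T L^{2k}₊ T⁻¹ is exactly -(∂_k T) T⁻¹, so T L^{2k}₊ T⁻¹ +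
(∂_k T) T⁻¹ is the differential part of the conjugated power (`plus_conj`); this carries all flows
over. The constrained form persists (`laxForm_mul_gauge`): T(χ) = 0 removes one summand of L, and
since 𝒟⁻¹χ⁻¹T = χ⁻¹ is a multiplication operator, the new pair absorbs all order-zero terms left
over. The residue of the conjugated power is ∂_k D_θ ln χ minus the old residue (`coeff_conj`),
hence the new tau function χ/τ.

The composition V of the first N operators T is monic and differential of order N
(`exists_dbIter_eq`). It annihilates φ_0, …, φ_{(N-1)/2} and sends φ_{N/2} to the superfield χ that
generates the next step (`dbIter_seed`, `dbIter_seed_self`). The antiderivatives in the orbit and in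
the seed are chosen independently, so along the way such identities hold only modulo combinations of
earlier images with D_θ-constant coefficients; these combinations have vanished by the time a
superfield is used as χ.

The coefficients of V, split by the parity of the exponent, form a row vector whose product with the
Wronskian supermatrix is (0, …, 0, χ). Therefore a new bosonic row and column multiplies the
Berezinian by χ (`ber_succ_left`) and a new fermionic one divides it by χ (`ber_succ_right`).
Comparison with τ^{(N+1)} = χ/τ^{(N)} gives both formulas in one alternating induction.

All operator computations rest on the associativity of the product (`op_mul_assoc`), which is
reduced to monomials and to a signed Pascal rule. -/

set_option linter.unusedSectionVars false

/-! ### The parity involution and homogeneous elements -/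

section Parity

variable {A : Type*} [Ring A] [Algebra ℚ A] {𝒜 : ZMod 2 → Submodule ℚ A} [GradedAlgebra 𝒜]

theorem parity_of_mem_zero {a : A} (ha : a ∈ 𝒜 0) : parity 𝒜 a = a := by
  simp only [parity, LinearMap.sub_apply, GradedAlgebra.proj_apply]
  rw [DirectSum.decompose_of_mem_same 𝒜 ha,
    DirectSum.decompose_of_mem_ne 𝒜 ha (by decide : (0 : ZMod 2) ≠ 1), sub_zero]

theorem parity_of_mem_one {a : A} (ha : a ∈ 𝒜 1) : parity 𝒜 a = -a := by
  simp only [parity, LinearMap.sub_apply, GradedAlgebra.proj_apply]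
  rw [DirectSum.decompose_of_mem_same 𝒜 ha,
    DirectSum.decompose_of_mem_ne 𝒜 ha (by decide : (1 : ZMod 2) ≠ 0), zero_sub]

theorem zmod_two_cases (p : ZMod 2) : p = 0 ∨ p = 1 := by
  revert p; decide

theorem zmod_two_add_self (p : ZMod 2) : p + p = 0 := by
  revert p; decide

theorem exists_even_odd (𝒜 : ZMod 2 → Submodule ℚ A) [GradedAlgebra 𝒜] (a : A) :
    ∃ b ∈ 𝒜 0, ∃ c ∈ 𝒜 1, a = b + c := by
  induction a using DirectSum.Decomposition.inductionOn 𝒜 with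
  | zero => exact ⟨0, zero_mem _, 0, zero_mem _, by simp⟩
  | @homogeneous i m =>
    rcases zmod_two_cases i with rfl | rfl
    · exact ⟨m, m.2, 0, zero_mem _, by simp⟩
    · exact ⟨0, zero_mem _, m, m.2, by simp⟩
  | add x y hx hy =>
    obtain ⟨b, hb, c, hc, rfl⟩ := hx
    obtain ⟨b', hb', c', hc', rfl⟩ := hy
    exact ⟨b + b', add_mem hb hb', c + c', add_mem hc hc', by abel⟩

theorem mul_mem_graded {p q : ZMod 2} {a b : A} (ha : a ∈ 𝒜 p) (hb : b ∈ 𝒜 q) :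
    a * b ∈ 𝒜 (p + q) :=
  SetLike.GradedMul.mul_mem ha hb

theorem mul_mem_graded' {p q r : ZMod 2} {a b : A} (ha : a ∈ 𝒜 p) (hb : b ∈ 𝒜 q)
    (h : p + q = r) : a * b ∈ 𝒜 r :=
  h ▸ mul_mem_graded ha hb

theorem one_mem_graded : (1 : A) ∈ 𝒜 0 := SetLike.GradedOne.one_mem

theorem parity_mem {p : ZMod 2} {a : A} (ha : a ∈ 𝒜 p) : parity 𝒜 a ∈ 𝒜 p := by
  rcases zmod_two_cases p with rfl | rfl
  · rwa [parity_of_mem_zero ha]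
  · rw [parity_of_mem_one ha]; exact neg_mem ha

@[simp] theorem parity_parity (a : A) : parity 𝒜 (parity 𝒜 a) = a := by
  obtain ⟨b, hb, c, hc, rfl⟩ := exists_even_odd 𝒜 a
  simp [parity_of_mem_zero hb, parity_of_mem_one hc]

@[simp] theorem parity_one : parity 𝒜 (1 : A) = 1 := parity_of_mem_zero one_mem_graded

theorem parity_mul (a b : A) : parity 𝒜 (a * b) = parity 𝒜 a * parity 𝒜 b := by
  obtain ⟨a, ha, a', ha', rfl⟩ := exists_even_odd 𝒜 a
  obtain ⟨b, hb, b', hb', rfl⟩ := exists_even_odd 𝒜 b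
  have h1 := parity_of_mem_zero (mul_mem_graded' ha hb (by decide))
  have h2 := parity_of_mem_one (mul_mem_graded' ha hb' (by decide))
  have h3 := parity_of_mem_one (mul_mem_graded' ha' hb (by decide))
  have h4 := parity_of_mem_zero (mul_mem_graded' ha' hb' (by decide))
  simp only [add_mul, mul_add, map_add, h1, h2, h3, h4, parity_of_mem_zero ha,
    parity_of_mem_zero hb, parity_of_mem_one ha', parity_of_mem_one hb']
  noncomm_ring

section

variable [SuperCommutative 𝒜]

theorem odd_mul_self {a : A} (ha : a ∈ 𝒜 1) : a * a = 0 := by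
  have h := SuperCommutative.odd_anticomm ha ha
  have h2 : (2 : ℚ) • (a * a) = 0 := by
    rw [two_smul]; nth_rewrite 1 [h]; simp
  simpa using h2

theorem comm_of_even {a : A} (ha : a ∈ 𝒜 0) (b : A) : a * b = b * a :=
  SuperCommutative.even_comm ha b

theorem mul_odd {a : A} (ha : a ∈ 𝒜 1) (b : A) : a * b = parity 𝒜 b * a := by
  obtain ⟨b, hb, c, hc, rfl⟩ := exists_even_odd 𝒜 b
  rw [map_add, parity_of_mem_zero hb, parity_of_mem_one hc, mul_add, add_mul,
    comm_of_even hb, SuperCommutative.odd_anticomm ha hc, neg_mul]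

/-- An invertible homogeneous element is bosonic. -/
theorem mem_zero_of_isUnit {p : ZMod 2} {a : A} (ha : a ∈ 𝒜 p) (hu : IsUnit a) : a ∈ 𝒜 0 := by
  rcases zmod_two_cases p with rfl | rfl
  · exact ha
  · have h : a = 0 := by
      have := odd_mul_self ha
      exact (hu.mul_right_eq_zero).1 this
    rw [h]; exact zero_mem _

/-- The parity involution is multiplicative and fixes a, so it sends the inverse to an inverse;
uniqueness makes the inverse parity-invariant, and 2 is invertible. -/
theorem inverse_mem_zero {a : A} (ha : a ∈ 𝒜 0) (hu : IsUnit a) : Ring.inverse a ∈ 𝒜 0 := by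
  obtain ⟨b, hb, c, hc, h⟩ := exists_even_odd 𝒜 (Ring.inverse a)
  have h1 : parity 𝒜 (Ring.inverse a) * a = 1 := by
    rw [← parity_of_mem_zero ha, ← parity_mul, parity_of_mem_zero ha, Ring.inverse_mul_cancel a hu,
      parity_one]
  have h2 : parity 𝒜 (Ring.inverse a) = Ring.inverse a := by
    apply hu.mul_left_injective
    simp only [h1, Ring.inverse_mul_cancel a hu]
  rw [h, map_add, parity_of_mem_zero hb, parity_of_mem_one hc] at h2
  have h3 : (2 : ℚ) • c = 0 := by
    rw [two_smul]
    have := add_left_cancel h2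
    nth_rewrite 1 [← this]; simp
  have h4 : c = 0 := by simpa using h3
  rw [h, h4, add_zero]; exact hb

end

end Parity

namespace SuperCalculus

variable {A : Type*} [Ring A] [Algebra ℚ A] {𝒜 : ZMod 2 → Submodule ℚ A} [GradedAlgebra 𝒜]

/-! ### How D_θ and the time derivatives interact with parity. -/

section Calculus

variable (C : SuperCalculus 𝒜)

@[simp] theorem D_one : C.D 1 = 0 := by
  have h := C.D_mul 1 1
  simpa using h

@[simp] theorem dt_unit (k : ℕ+) : C.dt k 1 = 0 := by
  have h := C.dt_mul k 1 1
  simpa using h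

theorem D_parity (a : A) : C.D (parity 𝒜 a) = -parity 𝒜 (C.D a) := by
  obtain ⟨b, hb, c, hc, rfl⟩ := exists_even_odd 𝒜 a
  have h1 : C.D b ∈ 𝒜 1 := C.D_mem hb
  have h2 : C.D c ∈ 𝒜 0 := C.D_mem hc
  simp [parity_of_mem_zero hb, parity_of_mem_one hc, parity_of_mem_zero h2, parity_of_mem_one h1,
    add_comm]

theorem dt_parity (k : ℕ+) (a : A) : C.dt k (parity 𝒜 a) = parity 𝒜 (C.dt k a) := by
  obtain ⟨b, hb, c, hc, rfl⟩ := exists_even_odd 𝒜 a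
  simp [parity_of_mem_zero hb, parity_of_mem_one hc, parity_of_mem_zero (C.dt_mem k hb),
    parity_of_mem_one (C.dt_mem k hc)]

theorem D_pow_parity (n : ℕ) (a : A) :
    (C.D ^ n) (parity 𝒜 a) = (-1 : ℤ) ^ n • parity 𝒜 ((C.D ^ n) a) := by
  induction n generalizing a with
  | zero => simp
  | succ n ih =>
    rw [pow_succ, Module.End.mul_apply, D_parity, map_neg, ih, pow_succ, Module.End.mul_apply]
    simp

theorem dt_D_pow (k : ℕ+) (n : ℕ) (a : A) : C.dt k ((C.D ^ n) a) = (C.D ^ n) (C.dt k a) := by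
  induction n generalizing a with
  | zero => simp
  | succ n ih => rw [pow_succ, Module.End.mul_apply, ih, dt_D, ← Module.End.mul_apply]

theorem D_pow_mem (n : ℕ) {p : ZMod 2} {a : A} (ha : a ∈ 𝒜 p) : (C.D ^ n) a ∈ 𝒜 (p + n) := by
  induction n with
  | zero => simpa using ha
  | succ n ih =>
    rw [pow_succ', Module.End.mul_apply]
    have := C.D_mem ih
    rwa [add_assoc, ← Nat.cast_succ] at this

/-! ### Twists -/

theorem twist_add (i : ℤ) (a b : A) : C.twist i (a + b) = C.twist i a + C.twist i b := by
  unfold twist; split_ifs <;> simp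

@[simp] theorem twist_zero_right (i : ℤ) : C.twist i (0 : A) = 0 := by
  unfold twist; split_ifs <;> simp

@[simp] theorem twist_one_right (i : ℤ) : C.twist i (1 : A) = 1 := by
  unfold twist; split_ifs <;> simp

@[simp] theorem twist_zero (a : A) : C.twist 0 a = a := by
  simp [twist]

@[simp] theorem twist_one (a : A) : C.twist 1 a = parity 𝒜 a := by
  simp [twist]

@[simp] theorem twist_neg_one (a : A) : C.twist (-1) a = parity 𝒜 a := by
  simp [twist]

theorem twist_mul (i : ℤ) (a b : A) : C.twist i (a * b) = C.twist i a * C.twist i b := by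
  unfold twist; split_ifs <;> simp [parity_mul]

theorem twist_succ (i : ℤ) (a : A) : C.twist (i + 1) a = parity 𝒜 (C.twist i a) := by
  unfold twist
  by_cases h : Even i
  · have : ¬ Even (i + 1) := by rw [Int.even_add_one]; simpa using h
    simp [h, this]
  · have : Even (i + 1) := by rw [Int.even_add_one]; exact h
    simp [h, this]

theorem twist_mem (i : ℤ) {p : ZMod 2} {a : A} (ha : a ∈ 𝒜 p) : C.twist i a ∈ 𝒜 p := by
  unfold twist; split_ifs
  · exact ha
  · exact parity_mem ha

theorem dt_twist (k : ℕ+) (i : ℤ) (a : A) : C.dt k (C.twist i a) = C.twist i (C.dt k a) := by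
  unfold twist; split_ifs
  · rfl
  · exact C.dt_parity k a

end Calculus

/-! ### The ring of super-pseudo-differential operators -/

/-- The super-pseudo-differential operators with the multiplication determined by `C`. -/
def Op (_C : SuperCalculus 𝒜) : Type _ := SPDO A

variable {C : SuperCalculus 𝒜}

instance Op.instAddCommGroup : AddCommGroup C.Op := inferInstanceAs (AddCommGroup (SPDO A))

noncomputable instance Op.instMul : Mul C.Op := ⟨C.mul⟩

/-- The coefficient of `𝒟^n`. -/
def coeff (n : ℤ) : C.Op →+ A where
  toFun P := P.1 n
  map_zero' := rfl
  map_add' _ _ := rfl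

variable (C) in
/-- The operator `a 𝒟^i`, additively in `a`. -/
def single (i : ℤ) : A →+ C.Op where
  toFun a := SPDO.mono a i
  map_zero' := Subtype.ext (funext fun j => by simp [SPDO.mono]; rfl)
  map_add' a b := Subtype.ext (funext fun j => by
    change (if j = i then a + b else 0) = (if j = i then a else 0) + (if j = i then b else 0)
    split_ifs <;> simp)

@[ext] theorem Op.ext {P Q : C.Op} (h : ∀ n, coeff n P = coeff n Q) : P = Q :=
  Subtype.ext (funext h)

theorem coeff_single (n i : ℤ) (a : A) : coeff n (C.single i a) = if n = i then a else 0 := rfl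

@[simp] theorem coeff_single_same (i : ℤ) (a : A) : coeff i (C.single i a) = a := by
  simp [coeff_single]

theorem coeff_single_ne {n i : ℤ} (h : n ≠ i) (a : A) : coeff n (C.single i a) = 0 := by
  simp [coeff_single, h]

/-- `P` has order at most `N`. -/
def OrdLE (N : ℤ) (P : C.Op) : Prop := ∀ j, N < j → coeff j P = 0

theorem exists_ordLE (P : C.Op) : ∃ N, OrdLE N P := P.2

theorem OrdLE.mono {N N' : ℤ} {P : C.Op} (h : OrdLE N P) (hN : N ≤ N') : OrdLE N' P :=
  fun j hj => h j (lt_of_le_of_lt hN hj)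

theorem ordLE_single (i : ℤ) (a : A) : OrdLE i (C.single i a) :=
  fun _ hj => coeff_single_ne (ne_of_gt hj) a

theorem OrdLE.add {N : ℤ} {P Q : C.Op} (hP : OrdLE N P) (hQ : OrdLE N Q) : OrdLE N (P + Q) :=
  fun j hj => by rw [map_add, hP j hj, hQ j hj, add_zero]

@[simp] theorem mulCoeff_zero_left (i : ℤ) (b : A) (j n : ℤ) : C.mulCoeff 0 i b j n = 0 := by
  simp [mulCoeff]

@[simp] theorem mulCoeff_zero_right (a : A) (i j n : ℤ) : C.mulCoeff a i 0 j n = 0 := by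
  simp [mulCoeff]

theorem mulCoeff_add_left (a a' : A) (i : ℤ) (b : A) (j n : ℤ) :
    C.mulCoeff (a + a') i b j n = C.mulCoeff a i b j n + C.mulCoeff a' i b j n := by
  unfold mulCoeff; split_ifs
  · rw [add_mul, smul_add]
  · simp

theorem mulCoeff_add_right (a : A) (i : ℤ) (b b' : A) (j n : ℤ) :
    C.mulCoeff a i (b + b') j n = C.mulCoeff a i b j n + C.mulCoeff a i b' j n := by
  unfold mulCoeff; split_ifs
  · rw [twist_add, map_add, mul_add, smul_add]
  · simp

theorem coeff_mul (P Q : C.Op) (n : ℤ) :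
    coeff n (P * Q) = ∑ᶠ ij : ℤ × ℤ, C.mulCoeff (coeff ij.1 P) ij.1 (coeff ij.2 Q) ij.2 n := rfl

/-- Order bounds confine the nonzero terms to a finite box. Enlarging the bounds allows several
products to be compared over the same box, which is how additivity is obtained. -/
theorem coeff_mul_eq_sum {P Q : C.Op} {N N' : ℤ} (hP : OrdLE N P) (hQ : OrdLE N' Q) (n : ℤ) :
    coeff n (P * Q) = ∑ ij ∈ Finset.Icc (n - N') N ×ˢ Finset.Icc (n - N) N',
      C.mulCoeff (coeff ij.1 P) ij.1 (coeff ij.2 Q) ij.2 n := by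
  rw [coeff_mul]
  refine finsum_eq_sum_of_support_subset _ fun ij hij => ?_
  rw [Function.mem_support] at hij
  have h1 : ij.1 ≤ N := by
    by_contra h
    exact hij (by rw [hP _ (not_le.1 h), mulCoeff_zero_left])
  have h2 : ij.2 ≤ N' := by
    by_contra h
    exact hij (by rw [hQ _ (not_le.1 h), mulCoeff_zero_right])
  have h3 : n ≤ ij.1 + ij.2 := by
    by_contra h
    exact hij (by simp [mulCoeff, h])
  simp only [Finset.coe_product, Finset.coe_Icc, Set.mem_prod, Set.mem_Icc]
  omega

theorem OrdLE.mul {P Q : C.Op} {N N' : ℤ} (hP : OrdLE N P) (hQ : OrdLE N' Q) :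
    OrdLE (N + N') (P * Q) := fun n hn => by
  rw [coeff_mul_eq_sum hP hQ, Finset.Icc_eq_empty (by omega), Finset.empty_product,
    Finset.sum_empty]

theorem op_add_mul (P P' Q : C.Op) : (P + P') * Q = P * Q + P' * Q := by
  ext n
  obtain ⟨N, hN⟩ := exists_ordLE P
  obtain ⟨N', hN'⟩ := exists_ordLE P'
  obtain ⟨K, hK⟩ := exists_ordLE Q
  have h1 := hN.mono (le_max_left N N')
  have h2 := hN'.mono (le_max_right N N')
  rw [map_add, coeff_mul_eq_sum h1 hK, coeff_mul_eq_sum h2 hK, coeff_mul_eq_sum (h1.add h2) hK,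
    ← Finset.sum_add_distrib]
  simp only [map_add, mulCoeff_add_left]

theorem op_mul_add (P Q Q' : C.Op) : P * (Q + Q') = P * Q + P * Q' := by
  ext n
  obtain ⟨N, hN⟩ := exists_ordLE Q
  obtain ⟨N', hN'⟩ := exists_ordLE Q'
  obtain ⟨K, hK⟩ := exists_ordLE P
  have h1 := hN.mono (le_max_left N N')
  have h2 := hN'.mono (le_max_right N N')
  rw [map_add, coeff_mul_eq_sum hK h1, coeff_mul_eq_sum hK h2, coeff_mul_eq_sum hK (h1.add h2),
    ← Finset.sum_add_distrib]
  simp only [map_add, mulCoeff_add_right]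

theorem coeff_single_mul (a : A) (i : ℤ) (Q : C.Op) (n : ℤ) :
    coeff n (C.single i a * Q) = ∑ᶠ j : ℤ, C.mulCoeff a i (coeff j Q) j n := by
  obtain ⟨K, hK⟩ := exists_ordLE Q
  have key : ∀ j, C.mulCoeff a i (coeff j Q) j n ≠ 0 → j ∈ Finset.Icc (n - i) K := by
    intro j hj
    have h2 : j ≤ K := by
      by_contra h
      exact hj (by rw [hK _ (not_le.1 h), mulCoeff_zero_right])
    have h3 : n ≤ i + j := by
      by_contra h
      exact hj (by simp [mulCoeff, h])
    rw [Finset.mem_Icc]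
    omega
  rw [coeff_mul, finsum_eq_sum_of_support_subset (s := {i} ×ˢ Finset.Icc (n - i) K),
    Finset.sum_product, Finset.sum_singleton,
    finsum_eq_sum_of_support_subset (s := Finset.Icc (n - i) K)]
  · simp
  · exact fun j hj => key j hj
  · rintro ⟨i', j⟩ hj
    rw [Function.mem_support] at hj
    have h : i' = i := by
      by_contra h
      exact hj (by rw [coeff_single_ne h, mulCoeff_zero_left])
    subst h
    simpa using key j (by simpa using hj)

theorem superChoose_zero (i : ℤ) : superChoose i 0 = 1 := by
  simp [superChoose]

/-- The sign is the price of moving 𝒟 past k + 1 applications of D_θ. Only the case of odd j and odd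
n is Pascal's rule for ordinary binomials; in the other cases a vanishing coefficient or a
cancellation does the work. -/
theorem superChoose_succ_succ (j : ℤ) (n : ℕ) :
    superChoose (j + 1) (n + 1) = superChoose j n + (-1) ^ (n + 1) * superChoose j (n + 1) := by
  unfold superChoose
  rcases Int.even_or_odd' j with ⟨c, rfl | rfl⟩ <;>
    rcases Nat.even_or_odd' n with ⟨d, rfl | rfl⟩
  · have h1 : (2 * c + 1) / 2 = c := by omega
    have h2 : (2 * d + 1) / 2 = d := by omega
    have h3 : ¬ Odd (2 * c) := by simp
    have h4 : ¬ Odd (2 * d) := by simp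
    simp [h1, h2, h3, h4, Nat.odd_add_one]
  · have h1 : (2 * c + 1) / 2 = c := by omega
    have h2 : (2 * d + 1 + 1) / 2 = d + 1 := by omega
    have h3 : ¬ Odd (2 * d + 1 + 1) := by rw [Nat.not_odd_iff_even]; exact ⟨d + 1, by ring⟩
    have h4 : (-1 : ℤ) ^ (2 * d + 1 + 1) = 1 := Even.neg_one_pow ⟨d + 1, by ring⟩
    simp [h1, h2, h3, h4]
  · have h1 : (2 * c + 1) / 2 = c := by omega
    have h2 : (2 * d + 1) / 2 = d := by omega
    have h3 : Even (2 * c + 1 + 1) := ⟨c + 1, by ring⟩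
    have h4 : (-1 : ℤ) ^ (2 * d + 1) = -1 := Odd.neg_one_pow ⟨d, by ring⟩
    have h5 : ¬ Odd (2 * c) := by simp
    have h6 : ¬ Odd (2 * d) := by simp
    simp [h1, h2, h3, h4, h5, h6]
  · have h1 : (2 * c + 1) / 2 = c := by omega
    have h0 : (2 * c + 1 + 1) / 2 = c + 1 := by omega
    have h2 : (2 * d + 1 + 1) / 2 = d + 1 := by omega
    have h5 : (2 * d + 1) / 2 = d := by omega
    have h3 : ¬ Odd (2 * d + 1 + 1) := by rw [Nat.not_odd_iff_even]; exact ⟨d + 1, by ring⟩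
    have h4 : (-1 : ℤ) ^ (2 * d + 1 + 1) = 1 := Even.neg_one_pow ⟨d + 1, by ring⟩
    simp [h1, h2, h3, h4, h5, h0, Ring.choose_succ_succ]

theorem mulCoeff_of_add (a : A) (i : ℤ) (b : A) (j n : ℤ) (k : ℕ) (h : n + k = i + j) :
    C.mulCoeff a i b j n = superChoose i k • (a * (C.D ^ k) (C.twist (i - k) b)) := by
  have h1 : i + j - n = k := by omega
  unfold mulCoeff
  rw [if_pos (by omega), h1, Int.toNat_natCast]

theorem mulCoeff_of_lt (a : A) (i : ℤ) (b : A) (j n : ℤ) (h : i + j < n) :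
    C.mulCoeff a i b j n = 0 := by
  unfold mulCoeff
  rw [if_neg (by omega)]

theorem mulCoeff_one (a : A) (i j n : ℤ) :
    C.mulCoeff a i 1 j n = if n = i + j then a else 0 := by
  rcases lt_or_ge (i + j) n with h | h
  · rw [mulCoeff_of_lt _ _ _ _ _ h, if_neg (by omega)]
  · obtain ⟨k, hk⟩ := Int.le.dest h
    rw [mulCoeff_of_add _ _ _ _ _ k hk]
    cases k with
    | zero => rw [if_pos (by simpa using hk)]; simp [superChoose_zero]
    | succ k =>
      rw [if_neg (by omega), twist_one_right, pow_succ, Module.End.mul_apply, D_one]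
      simp

theorem coeff_const_mul (a : A) (Q : C.Op) (n : ℤ) :
    coeff n (C.single 0 a * Q) = a * coeff n Q := by
  rw [coeff_single_mul, finsum_eq_single _ n]
  · rw [mulCoeff_of_add _ _ _ _ _ 0 (by simp)]; simp [superChoose_zero]
  · intro j hj
    rcases lt_or_ge (0 + j) n with h | h
    · exact mulCoeff_of_lt _ _ _ _ _ h
    · obtain ⟨k, hk⟩ := Int.le.dest h
      rw [mulCoeff_of_add _ _ _ _ _ k hk]
      have h1 : superChoose 0 k = 0 := by
        unfold superChoose
        split_ifs with h2
        · rfl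
        · have h3 : k / 2 ≠ 0 := by
            have : ¬ Odd k := fun h' => h2 ⟨Even.zero, h'⟩
            rw [Nat.not_odd_iff_even] at this
            obtain ⟨c, rfl⟩ := this
            omega
          exact Ring.choose_zero_pos ℤ (Nat.pos_of_ne_zero h3)
      rw [h1, zero_smul]

theorem coeff_D_mul (Q : C.Op) (n : ℤ) :
    coeff n (C.single 1 1 * Q) = C.D (coeff n Q) + parity 𝒜 (coeff (n - 1) Q) := by
  rw [coeff_single_mul, finsum_eq_sum_of_support_subset (s := {n, n - 1}), Finset.sum_pair (by omega)]
  · rw [mulCoeff_of_add _ _ _ _ _ 1 (by push_cast; ring),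
      mulCoeff_of_add _ _ _ _ _ 0 (by push_cast; ring)]
    simp [superChoose]
  · intro j hj
    rw [Function.mem_support] at hj
    simp only [Finset.coe_insert, Finset.coe_singleton, Set.mem_insert_iff, Set.mem_singleton_iff]
    by_contra hne
    apply hj
    rcases lt_or_ge (1 + j) n with h | h
    · exact mulCoeff_of_lt _ _ _ _ _ h
    · obtain ⟨k, hk⟩ := Int.le.dest h
      rw [mulCoeff_of_add _ _ _ _ _ k hk]
      have h1 : superChoose 1 k = 0 := by
        unfold superChoose
        split_ifs with h2
        · rfl
        · exact Ring.choose_zero_pos ℤ (by omega)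
      rw [h1, zero_smul]

theorem coeff_mul_D_zpow (P : C.Op) (j n : ℤ) :
    coeff n (P * C.single j 1) = coeff (n - j) P := by
  rw [coeff_mul, finsum_eq_single _ (n - j, j)]
  · simp [mulCoeff_one]
  · rintro ⟨i, j'⟩ h
    by_cases hj : j' = j
    · subst hj
      have : n ≠ i + j' := fun hn => h (by rw [hn]; simp)
      simp [mulCoeff_one, this]
    · simp [coeff_single_ne hj]

/-- Two additive functionals that vanish on operators of low order and agree on monomials are
equal. -/
theorem functional_ext {F G : C.Op →+ A} (K : ℤ) (hF : ∀ P, OrdLE K P → F P = 0)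
    (hG : ∀ P, OrdLE K P → G P = 0) (h : ∀ i a, F (C.single i a) = G (C.single i a)) (P : C.Op) :
    F P = G P := by
  obtain ⟨N, hN⟩ := exists_ordLE P
  have h1 : OrdLE K (P - ∑ i ∈ Finset.Ioc K N, C.single i (coeff i P)) := by
    intro j hj
    rw [map_sub, map_sum]
    by_cases hjN : j ≤ N
    · rw [Finset.sum_eq_single_of_mem j (Finset.mem_Ioc.2 ⟨hj, hjN⟩)]
      · simp
      · exact fun i _ hi => coeff_single_ne (Ne.symm hi) _
    · rw [Finset.sum_eq_zero, hN j (not_le.1 hjN), sub_zero]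
      intro i hi
      refine coeff_single_ne ?_ _
      rintro rfl
      exact hjN (Finset.mem_Ioc.1 hi).2
  have h2 := hF _ h1
  have h3 := hG _ h1
  rw [map_sub, sub_eq_zero] at h2 h3
  rw [h2, h3, map_sum, map_sum]
  exact Finset.sum_congr rfl fun i _ => h i _

/-- Left multiplication, as an additive map. -/
noncomputable def mulLeftHom (P : C.Op) : C.Op →+ C.Op where
  toFun Q := P * Q
  map_zero' := by
    have h := op_mul_add P 0 0
    simpa using h
  map_add' := op_mul_add P

/-- Right multiplication, as an additive map. -/
noncomputable def mulRightHom (Q : C.Op) : C.Op →+ C.Op where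
  toFun P := P * Q
  map_zero' := by
    have h := op_add_mul 0 0 Q
    simpa using h
  map_add' P P' := op_add_mul P P' Q

/-- A fixed coefficient of either side depends on only finitely many coefficients of R, because
operators of sufficiently low order do not reach it; so `functional_ext` reduces R to a monomial.
The next two lemmas do the same for the other two slots. -/
theorem op_assoc_of_single_right {P Q : C.Op}
    (h : ∀ i a, P * Q * C.single i a = P * (Q * C.single i a)) (R : C.Op) :
    P * Q * R = P * (Q * R) := by
  ext n
  obtain ⟨N, hN⟩ := exists_ordLE P
  obtain ⟨N', hN'⟩ := exists_ordLE Q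
  refine functional_ext (F := (coeff n).comp (mulLeftHom (P * Q)))
    (G := (coeff n).comp ((mulLeftHom P).comp (mulLeftHom Q))) (n - N - N' - 1) ?_ ?_ ?_ R
  · exact fun R hR => (hN.mul hN').mul hR n (by omega)
  · exact fun R hR => hN.mul (hN'.mul hR) n (by omega)
  · exact fun i a => congrArg (coeff n) (h i a)

theorem op_assoc_of_single_mid {P R : C.Op}
    (h : ∀ i a, P * C.single i a * R = P * (C.single i a * R)) (Q : C.Op) :
    P * Q * R = P * (Q * R) := by
  ext n
  obtain ⟨N, hN⟩ := exists_ordLE P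
  obtain ⟨N', hN'⟩ := exists_ordLE R
  refine functional_ext (F := (coeff n).comp ((mulRightHom R).comp (mulLeftHom P)))
    (G := (coeff n).comp ((mulLeftHom P).comp (mulRightHom R))) (n - N - N' - 1) ?_ ?_ ?_ Q
  · exact fun Q hQ => (hN.mul hQ).mul hN' n (by omega)
  · exact fun Q hQ => hN.mul (hQ.mul hN') n (by omega)
  · exact fun i a => congrArg (coeff n) (h i a)

theorem op_assoc_of_single_left {Q R : C.Op}
    (h : ∀ i a, C.single i a * Q * R = C.single i a * (Q * R)) (P : C.Op) :
    P * Q * R = P * (Q * R) := by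
  ext n
  obtain ⟨N, hN⟩ := exists_ordLE Q
  obtain ⟨N', hN'⟩ := exists_ordLE R
  refine functional_ext (F := (coeff n).comp ((mulRightHom R).comp (mulRightHom Q)))
    (G := (coeff n).comp (mulRightHom (Q * R))) (n - N - N' - 1) ?_ ?_ ?_ P
  · exact fun P hP => (hP.mul hN).mul hN' n (by omega)
  · exact fun P hP => hP.mul (hN.mul hN') n (by omega)
  · exact fun i a => congrArg (coeff n) (h i a)

theorem const_mul_single (a : A) (i : ℤ) (b : A) :
    C.single 0 a * C.single i b = C.single i (a * b) := by
  ext n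
  rw [coeff_const_mul, coeff_single, coeff_single]
  split_ifs <;> simp

theorem const_mul_assoc (a : A) (Q R : C.Op) :
    C.single 0 a * Q * R = C.single 0 a * (Q * R) := by
  refine op_assoc_of_single_mid (fun i b => ?_) Q
  ext n
  obtain ⟨K, hK⟩ := exists_ordLE R
  rw [const_mul_single, coeff_const_mul, coeff_single_mul, coeff_single_mul,
    ← AddMonoidHom.coe_mulLeft, AddMonoidHom.map_finsum]
  · refine finsum_congr fun j => ?_
    unfold mulCoeff
    split_ifs
    · rw [AddMonoidHom.coe_mulLeft, mul_assoc, mul_smul_comm]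
    · simp
  · refine (Finset.finite_toSet (Finset.Icc (n - i) K)).subset fun j hj => ?_
    rw [Function.mem_support] at hj
    have h2 : j ≤ K := by
      by_contra h
      exact hj (by rw [hK _ (not_le.1 h), mulCoeff_zero_right])
    have h3 : n ≤ i + j := by
      by_contra h
      exact hj (by simp [mulCoeff, h])
    rw [Finset.coe_Icc, Set.mem_Icc]
    omega

theorem coeff_single_mul_single (a : A) (i : ℤ) (b : A) (j n : ℤ) :
    coeff n (C.single i a * C.single j b) = C.mulCoeff a i b j n := by
  rw [coeff_single_mul, finsum_eq_single _ j]
  · simp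
  · exact fun j' h => by rw [coeff_single_ne h, mulCoeff_zero_right]

theorem D_mul_single (i : ℤ) (a : A) :
    C.single 1 1 * C.single i a = C.single i (C.D a) + C.single (i + 1) (parity 𝒜 a) := by
  ext n
  rw [coeff_D_mul, map_add, coeff_single, coeff_single, coeff_single, coeff_single]
  have : n - 1 = i ↔ n = i + 1 := by omega
  simp only [this]
  split_ifs <;> simp

/-- On monomials the claim is the Leibniz rule for 𝒟 combined with `superChoose_succ_succ`; the
exponent of the middle factor may be negative. -/
theorem D_mul_assoc (Q R : C.Op) :
    C.single 1 1 * Q * R = C.single 1 1 * (Q * R) := by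
  refine op_assoc_of_single_mid (fun i b => op_assoc_of_single_right (fun j c => ?_) R) Q
  ext n
  rw [D_mul_single, op_add_mul, map_add, coeff_D_mul, coeff_single_mul_single,
    coeff_single_mul_single, coeff_single_mul_single, coeff_single_mul_single]
  rcases lt_or_ge (i + j + 1) n with h | h
  · rw [mulCoeff_of_lt _ _ _ _ _ (by omega), mulCoeff_of_lt _ _ _ _ _ (by omega),
      mulCoeff_of_lt _ _ _ _ _ (by omega), mulCoeff_of_lt _ _ _ _ _ (by omega)]
    simp
  · obtain ⟨k, hk⟩ := Int.le.dest h
    cases k with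
    | zero =>
      rw [mulCoeff_of_lt (n := n) _ _ _ _ (by omega), mulCoeff_of_add _ _ _ _ _ 0 (by omega),
        mulCoeff_of_lt (n := n) _ _ _ _ (by omega), mulCoeff_of_add _ _ _ _ _ 0 (by omega)]
      simp [superChoose_zero, parity_mul, twist_succ]
    | succ k =>
      rw [mulCoeff_of_add _ _ _ _ _ k (by omega), mulCoeff_of_add _ _ _ _ _ (k + 1) (by omega),
        mulCoeff_of_add _ _ _ _ _ k (by omega), mulCoeff_of_add _ _ _ _ _ (k + 1) (by omega),
        superChoose_succ_succ]
      have h1 : i + 1 - ((k + 1 : ℕ) : ℤ) = i - k := by push_cast; ring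
      have h2 : C.twist (i - k) c = parity 𝒜 (C.twist (i - ((k + 1 : ℕ) : ℤ)) c) := by
        rw [← twist_succ]; congr 1; push_cast; ring
      rw [h1, map_zsmul, map_zsmul, D_mul, parity_mul]
      -- Passing the involution through k + 1 odd derivations produces exactly the sign in the
      -- Pascal rule.
      have h3 : parity 𝒜 ((C.D ^ (k + 1)) (C.twist (i - ((k + 1 : ℕ) : ℤ)) c)) =
          (-1 : ℤ) ^ (k + 1) • (C.D ^ (k + 1)) (C.twist (i - k) c) := by
        rw [h2, D_pow_parity, smul_smul, ← mul_pow]; simp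
      rw [h3, ← Module.End.mul_apply, ← pow_succ', smul_add, add_smul, mul_smul_comm, smul_smul,
        mul_comm (superChoose i (k + 1))]
      abel

end SuperCalculus

/-! ### Associativity and the ring structure on operators. -/

namespace SuperCalculus

variable {A : Type*} [Ring A] [Algebra ℚ A] {𝒜 : ZMod 2 → Submodule ℚ A} [GradedAlgebra 𝒜]
  {C : SuperCalculus 𝒜}

theorem single_mul_D_zpow (a : A) (i j : ℤ) :
    C.single i a * C.single j 1 = C.single (i + j) a := by
  ext n
  rw [coeff_mul_D_zpow, coeff_single, coeff_single]
  have : n - j = i ↔ n = i + j := by omega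
  simp only [this]

theorem op_one_mul (P : C.Op) : C.single 0 1 * P = P := by
  ext n; rw [coeff_const_mul, one_mul]

theorem op_mul_one (P : C.Op) : P * C.single 0 1 = P := by
  ext n; rw [coeff_mul_D_zpow, sub_zero]

/-- The coefficient of 𝒟^n in 𝒟P is D_θ(p_n) + parity(p_{n-1}). Once p_n vanishes so does p_{n-1},
and the descent starts above the order of P. -/
theorem D_mul_injective {P Q : C.Op} (h : C.single 1 1 * P = C.single 1 1 * Q) : P = Q := by
  obtain ⟨N, hN⟩ := exists_ordLE (P - Q)
  have h0 : ∀ n, C.D (coeff n (P - Q)) + parity 𝒜 (coeff (n - 1) (P - Q)) = 0 := by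
    intro n
    have h1 := congrArg (coeff n) h
    rw [coeff_D_mul, coeff_D_mul] at h1
    rw [map_sub, map_sub, map_sub, map_sub, ← sub_eq_zero.2 h1]
    abel
  have h2 : ∀ k : ℕ, coeff (N + 1 - k) (P - Q) = 0 := by
    intro k
    induction k with
    | zero => exact hN _ (by simp)
    | succ k ih =>
      have h3 := h0 (N + 1 - k)
      rw [ih, map_zero, zero_add] at h3
      have h4 := congrArg (parity 𝒜) h3
      rw [parity_parity, map_zero] at h4
      rw [← h4]; push_cast; rw [← sub_sub]
  ext n
  rw [← sub_eq_zero, ← map_sub]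
  rcases lt_or_ge N n with h3 | h3
  · exact hN n h3
  · have h4 := h2 (N + 1 - n).toNat
    rwa [show N + 1 - ((N + 1 - n).toNat : ℤ) = n by omega] at h4

/-- No binomial identity for negative exponents is needed: multiply both sides by 𝒟, use
associativity for 𝒟, and cancel. -/
theorem D_inv_mul_assoc (Q R : C.Op) :
    C.single (-1) 1 * Q * R = C.single (-1) 1 * (Q * R) := by
  have h (Q : C.Op) : C.single 1 1 * (C.single (-1) 1 * Q) = Q := by
    rw [← D_mul_assoc, single_mul_D_zpow, add_neg_cancel, op_one_mul]
  apply D_mul_injective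
  rw [← D_mul_assoc, h, h]

theorem D_zpow_mul_assoc (i : ℤ) : ∀ Q R : C.Op,
    C.single i 1 * Q * R = C.single i 1 * (Q * R) := by
  induction i using Int.induction_on with
  | zero => intro Q R; rw [op_one_mul, op_one_mul]
  | succ i ih =>
    intro Q R
    rw [add_comm, ← single_mul_D_zpow, D_mul_assoc, D_mul_assoc, ih, D_mul_assoc]
  | pred i ih =>
    intro Q R
    rw [sub_eq_add_neg, add_comm, ← single_mul_D_zpow, D_inv_mul_assoc, D_inv_mul_assoc, ih,
      D_inv_mul_assoc]

theorem op_mul_assoc (P Q R : C.Op) : P * Q * R = P * (Q * R) := by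
  refine op_assoc_of_single_left (fun i a => ?_) P
  have h : C.single i a = C.single 0 a * C.single i 1 := by
    rw [single_mul_D_zpow, zero_add]
  rw [h, const_mul_assoc, const_mul_assoc, D_zpow_mul_assoc, const_mul_assoc]

noncomputable instance Op.instRing : Ring C.Op :=
  { Op.instAddCommGroup, Op.instMul with
    one := C.single 0 1
    left_distrib := op_mul_add
    right_distrib := op_add_mul
    zero_mul := fun Q => (mulRightHom Q).map_zero
    mul_zero := fun Q => (mulLeftHom Q).map_zero
    mul_assoc := op_mul_assoc
    one_mul := op_one_mul
    mul_one := op_mul_one }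

theorem pow_eq (P : C.Op) (n : ℕ) : C.pow P n = P ^ n := by
  induction n with
  | zero => rfl
  | succ n ih => rw [pow_succ', ← ih]; rfl

variable (C) in
/-- Superfields as multiplication operators. -/
noncomputable def const : A →+* C.Op :=
  { C.single 0 with
    map_one' := rfl
    map_mul' := fun a b => (const_mul_single a 0 b).symm }

variable (C) in
/-- The operator `𝒟`. -/
def dop : C.Op := C.single 1 1

variable (C) in
/-- The operator `𝒟⁻¹`. -/
def dinv : C.Op := C.single (-1) 1

theorem const_eq_single (a : A) : C.const a = C.single 0 a := rfl

@[simp] theorem dop_mul_dinv : C.dop * C.dinv = 1 := single_mul_D_zpow _ _ _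

@[simp] theorem dinv_mul_dop : C.dinv * C.dop = 1 := single_mul_D_zpow _ _ _

@[simp] theorem dop_mul_dinv_mul (P : C.Op) : C.dop * (C.dinv * P) = P := by
  rw [← mul_assoc, dop_mul_dinv, one_mul]

@[simp] theorem dinv_mul_dop_mul (P : C.Op) : C.dinv * (C.dop * P) = P := by
  rw [← mul_assoc, dinv_mul_dop, one_mul]

theorem single_one_eq (a : A) : C.single 1 a = C.const a * C.dop := by
  rw [const_eq_single, dop, single_mul_D_zpow]; rfl

theorem single_neg_one_eq (a : A) : C.single (-1) a = C.const a * C.dinv := by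
  rw [const_eq_single, dinv, single_mul_D_zpow]; rfl

theorem dop_mul_const (a : A) :
    C.dop * C.const a = C.const (C.D a) + C.const (parity 𝒜 a) * C.dop := by
  rw [← single_one_eq]; exact D_mul_single 0 a

/-! ### Coefficients of products -/

@[simp] theorem coeff_const_mul' (a : A) (P : C.Op) (n : ℤ) :
    coeff n (C.const a * P) = a * coeff n P :=
  coeff_const_mul a P n

theorem coeff_dop_mul (P : C.Op) (n : ℤ) :
    coeff n (C.dop * P) = C.D (coeff n P) + parity 𝒜 (coeff (n - 1) P) :=
  coeff_D_mul P n

@[simp] theorem coeff_mul_dop (P : C.Op) (n : ℤ) : coeff n (P * C.dop) = coeff (n - 1) P :=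
  coeff_mul_D_zpow P 1 n

@[simp] theorem coeff_mul_dinv (P : C.Op) (n : ℤ) : coeff n (P * C.dinv) = coeff (n + 1) P := by
  rw [dinv, coeff_mul_D_zpow, sub_neg_eq_add]

theorem coeff_const (n : ℤ) (a : A) : coeff n (C.const a) = if n = 0 then a else 0 := rfl

@[simp] theorem coeff_zero_const (a : A) : coeff 0 (C.const a) = a := rfl

/-- The operator is differential. -/
def IsDiff (P : C.Op) : Prop := ∀ j < 0, coeff j P = 0

/-- The operator has negative order. -/
def IsNeg (P : C.Op) : Prop := OrdLE (-1) P

theorem IsDiff.add {P Q : C.Op} (hP : IsDiff P) (hQ : IsDiff Q) : IsDiff (P + Q) :=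
  fun j hj => by rw [map_add, hP j hj, hQ j hj, add_zero]

theorem IsDiff.neg {P : C.Op} (hP : IsDiff P) : IsDiff (-P) :=
  fun j hj => by rw [map_neg, hP j hj, neg_zero]

theorem IsDiff.sub {P Q : C.Op} (hP : IsDiff P) (hQ : IsDiff Q) : IsDiff (P - Q) :=
  fun j hj => by rw [map_sub, hP j hj, hQ j hj, sub_zero]

theorem isDiff_zero : IsDiff (0 : C.Op) := fun _ _ => map_zero _

theorem isDiff_sum {ι : Type*} (s : Finset ι) (F : ι → C.Op) (h : ∀ i ∈ s, IsDiff (F i)) :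
    IsDiff (∑ i ∈ s, F i) := fun j hj => by
  rw [map_sum]; exact Finset.sum_eq_zero fun i hi => h i hi j hj

theorem isDiff_const (a : A) : IsDiff (C.const a) := fun j hj => by
  rw [coeff_const, if_neg (by omega)]

theorem isDiff_dop : IsDiff C.dop := fun _ hj => coeff_single_ne (by omega) _

theorem IsDiff.const_mul (a : A) {P : C.Op} (hP : IsDiff P) : IsDiff (C.const a * P) :=
  fun j hj => by rw [coeff_const_mul', hP j hj, mul_zero]

theorem IsDiff.dop_mul {P : C.Op} (hP : IsDiff P) : IsDiff (C.dop * P) :=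
  fun j hj => by
    rw [coeff_dop_mul, hP j hj, hP _ (by omega)]; simp

theorem IsDiff.dop_pow_mul {P : C.Op} (hP : IsDiff P) (n : ℕ) : IsDiff (C.dop ^ n * P) := by
  induction n with
  | zero => simpa using hP
  | succ n ih => rw [pow_succ', mul_assoc]; exact ih.dop_mul

theorem dop_pow (n : ℕ) : C.dop ^ n = C.single (n : ℤ) 1 := by
  induction n with
  | zero => rfl
  | succ n ih => rw [pow_succ, ih, dop, single_mul_D_zpow]; norm_cast

theorem const_mul_dop_pow (a : A) (n : ℕ) : C.const a * C.dop ^ n = C.single (n : ℤ) a := by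
  rw [dop_pow, const_eq_single, single_mul_D_zpow, zero_add]

theorem IsDiff.eq_sum {P : C.Op} (hP : IsDiff P) {N : ℕ} (hN : OrdLE N P) :
    P = ∑ i ∈ Finset.range (N + 1), C.const (coeff i P) * C.dop ^ i := by
  ext j
  simp only [const_mul_dop_pow]
  rw [map_sum]
  rcases lt_or_ge j 0 with h | h
  · rw [hP j h, Finset.sum_eq_zero]
    intro i _; exact coeff_single_ne (by omega) _
  · lift j to ℕ using h
    by_cases hj : j < N + 1
    · rw [Finset.sum_eq_single_of_mem j (Finset.mem_range.2 hj), coeff_single_same]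
      intro i _ hi; exact coeff_single_ne (by omega) _
    · rw [hN j (by omega), Finset.sum_eq_zero]
      intro i hi
      rw [Finset.mem_range] at hi
      exact coeff_single_ne (by omega) _

theorem exists_ordLE_nat (P : C.Op) : ∃ N : ℕ, OrdLE N P := by
  obtain ⟨N, hN⟩ := exists_ordLE P
  exact ⟨N.toNat, hN.mono (Int.self_le_toNat N)⟩

/-- Sums, left multiplication by superfields and left multiplication by 𝒟 generate all differential
operators from 1, and each acts transparently on coefficients. -/
theorem IsDiff.induction {P : C.Op} (hP : IsDiff P) {p : C.Op → Prop} (hadd : ∀ P Q, IsDiff P → IsDiff Q → p P → p Q → p (P + Q))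
    (hconst : ∀ a P, IsDiff P → p P → p (C.const a * P)) (hD : ∀ P, IsDiff P → p P → p (C.dop * P))
    (h1 : p 1) : p P := by
  have hone : IsDiff (1 : C.Op) := isDiff_const 1
  have hpow : ∀ n : ℕ, IsDiff (C.dop ^ n) := fun n => by simpa using hone.dop_pow_mul n
  have h2 : ∀ n : ℕ, p (C.dop ^ n) := fun n => by
    induction n with
    | zero => simpa using h1
    | succ n ih => rw [pow_succ']; exact hD _ (hpow n) ih
  obtain ⟨N, hN⟩ := exists_ordLE_nat P
  rw [hP.eq_sum hN]
  have : ∀ s : Finset ℕ, p (∑ i ∈ s, C.const (coeff i P) * C.dop ^ i) := by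
    intro s
    induction s using Finset.induction_on with
    | empty =>
      have := hconst 0 1 hone h1
      simpa using this
    | insert i s hi ih =>
      rw [Finset.sum_insert hi]
      exact hadd _ _ ((hpow i).const_mul _) (isDiff_sum _ _ fun j _ => (hpow j).const_mul _)
        (hconst _ _ (hpow i) (h2 i)) ih
  exact this _

theorem IsDiff.mul {P Q : C.Op} (hP : IsDiff P) (hQ : IsDiff Q) : IsDiff (P * Q) := by
  refine hP.induction (p := fun P => IsDiff (P * Q)) (fun P P' _ _ h h' => ?_) (fun a P _ h => ?_)
    (fun P _ h => ?_) ?_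
  · rw [add_mul]; exact h.add h'
  · rw [mul_assoc]; exact h.const_mul a
  · rw [mul_assoc]; exact h.dop_mul
  · rwa [one_mul]

theorem ordLE_const (a : A) : OrdLE 0 (C.const a) := ordLE_single 0 a

theorem isNeg_dinv : IsNeg C.dinv := ordLE_single _ _

theorem IsNeg.const_mul (a : A) {P : C.Op} (hP : IsNeg P) : IsNeg (C.const a * P) := by
  have := (ordLE_const (C := C) a).mul hP
  simpa [IsNeg] using this

theorem IsNeg.mul_const {P : C.Op} (hP : IsNeg P) (a : A) : IsNeg (P * C.const a) := by
  have := OrdLE.mul hP (ordLE_const (C := C) a)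
  simpa [IsNeg] using this

/-- The differential part of an operator. -/
def plus : C.Op →+ C.Op where
  toFun P := SPDO.plus P
  map_zero' := Op.ext fun n => by
    change (if 0 ≤ n then (0 : A) else 0) = 0
    simp
  map_add' P Q := Op.ext fun n => by
    change (if 0 ≤ n then coeff n P + coeff n Q else 0) =
      (if 0 ≤ n then coeff n P else 0) + (if 0 ≤ n then coeff n Q else 0)
    split_ifs <;> simp

theorem coeff_plus (n : ℤ) (P : C.Op) : coeff n (plus P) = if 0 ≤ n then coeff n P else 0 := rfl

theorem isDiff_plus (P : C.Op) : IsDiff (plus P) := fun j hj => by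
  rw [coeff_plus, if_neg (by omega)]

theorem isNeg_sub_plus (P : C.Op) : IsNeg (P - plus P) := fun j hj => by
  rw [map_sub, coeff_plus, if_pos (by omega), sub_self]

theorem IsDiff.plus_eq {P : C.Op} (hP : IsDiff P) : plus P = P := by
  ext n
  rw [coeff_plus]
  split_ifs with h
  · rfl
  · rw [hP n (by omega)]

theorem IsNeg.plus_eq {P : C.Op} (hP : IsNeg P) : plus P = 0 := by
  ext n
  rw [coeff_plus, map_zero]
  split_ifs with h
  · rw [hP n (by omega)]
  · rfl

theorem plus_eq_of_eq_add {P Q R : C.Op} (h : P = Q + R) (hQ : IsDiff Q) (hR : IsNeg R) :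
    plus P = Q := by
  rw [h, map_add, hQ.plus_eq, hR.plus_eq, add_zero]

/-! ### The action of differential operators on superfields -/

/-- The value of the differential part of `P` on `f`. -/
noncomputable def act (P : C.Op) (f : A) : A := coeff 0 (P * C.const f)

theorem act_add (P Q : C.Op) (f : A) : act (P + Q) f = act P f + act Q f := by
  rw [act, add_mul, map_add]; rfl

theorem act_sub (P Q : C.Op) (f : A) : act (P - Q) f = act P f - act Q f := by
  rw [act, sub_mul, map_sub]; rfl

theorem act_sum {ι : Type*} (s : Finset ι) (P : ι → C.Op) (f : A) :
    act (∑ i ∈ s, P i) f = ∑ i ∈ s, act (P i) f := by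
  simp only [act, Finset.sum_mul, map_sum]

theorem act_add_right (P : C.Op) (f g : A) : act P (f + g) = act P f + act P g := by
  rw [act, map_add, mul_add, map_add]; rfl

theorem act_sum_right {ι : Type*} (s : Finset ι) (P : C.Op) (f : ι → A) :
    act P (∑ i ∈ s, f i) = ∑ i ∈ s, act P (f i) := by
  simp only [act, Finset.mul_sum, map_sum]

theorem act_const_mul (a : A) (P : C.Op) (f : A) : act (C.const a * P) f = a * act P f := by
  rw [act, mul_assoc, coeff_const_mul', act]

theorem act_const (a f : A) : act (C.const a) f = a * f := by
  rw [act, coeff_const_mul', coeff_zero_const]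

theorem IsNeg.act_eq {P : C.Op} (hP : IsNeg P) (f : A) : act P f = 0 :=
  hP.mul_const f 0 (by norm_num)

theorem act_dop_mul {P : C.Op} (hP : IsDiff P) (f : A) : act (C.dop * P) f = C.D (act P f) := by
  rw [act, mul_assoc, coeff_dop_mul, (hP.mul (isDiff_const f)) (0 - 1) (by norm_num), map_zero,
    add_zero, act]

theorem act_dop (f : A) : act C.dop f = C.D f := by
  rw [← mul_one C.dop, ← map_one C.const, act_dop_mul (isDiff_const 1), act_const, one_mul]

theorem IsDiff.exists_eq_add_mul_dop {P : C.Op} (hP : IsDiff P) :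
    ∃ E : C.Op, IsDiff E ∧ P = C.const (coeff 0 P) + E * C.dop := by
  refine ⟨(P - C.const (coeff 0 P)) * C.dinv, fun j hj => ?_, ?_⟩
  · rw [coeff_mul_dinv, map_sub, coeff_const]
    split_ifs with h
    · rw [h, sub_self]
    · rw [hP _ (by omega), sub_zero]
  · rw [mul_assoc, dinv_mul_dop, mul_one]; abel

/-- Right division by 𝒟, whose remainder is the value P(f). A further factor 𝒟⁻¹ on the right then
splits P f 𝒟⁻¹ into the differential operator E and the tail P(f)𝒟⁻¹; most computations with T⁻¹ use
this. -/
theorem IsDiff.exists_mul_const {P : C.Op} (hP : IsDiff P) (f : A) :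
    ∃ E : C.Op, IsDiff E ∧ P * C.const f = C.const (act P f) + E * C.dop :=
  (hP.mul (isDiff_const f)).exists_eq_add_mul_dop

theorem act_mul {P Q : C.Op} (hP : IsDiff P) (hQ : IsDiff Q) (f : A) :
    act (P * Q) f = act P (act Q f) := by
  obtain ⟨E, hE, h⟩ := hQ.exists_mul_const f
  rw [act, mul_assoc, h, mul_add, map_add, ← mul_assoc, coeff_mul_dop,
    (hP.mul hE) (0 - 1) (by norm_num), add_zero]; rfl

theorem isDiff_dop_pow (n : ℕ) : IsDiff (C.dop ^ n) := by
  simpa using (isDiff_const (C := C) 1).dop_pow_mul n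

theorem act_dop_pow (n : ℕ) (f : A) : act (C.dop ^ n) f = (C.D ^ n) f := by
  induction n with
  | zero =>
    rw [pow_zero, ← map_one C.const, act_const, one_mul]; rfl
  | succ n ih =>
    rw [pow_succ', act_dop_mul (isDiff_dop_pow n), ih, pow_succ', Module.End.mul_apply]

theorem applyPlus_eq (P : C.Op) (f : A) : C.applyPlus P f = act (plus P) f := by
  obtain ⟨N, hN⟩ := exists_ordLE_nat P
  have hN' : OrdLE N (plus P) := fun j hj => by
    rw [coeff_plus, if_pos (by omega), hN j hj]
  rw [(isDiff_plus P).eq_sum hN', act_sum]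
  unfold applyPlus
  rw [finsum_eq_sum_of_support_subset (s := Finset.range (N + 1))]
  · refine Finset.sum_congr rfl fun i _ => ?_
    rw [act_const_mul, act_dop_pow, coeff_plus, if_pos (by omega)]; rfl
  · intro j hj
    rw [Finset.coe_range, Set.mem_Iio]
    by_contra h
    refine hj ?_
    have : P.1 j = 0 := hN j (by omega)
    simp [this]

/-- Coefficientwise derivative with respect to `t_k`. -/
def dtOp (k : ℕ+) : C.Op →+ C.Op where
  toFun P := SPDO.mapCoeff (C.dt k) P
  map_zero' := Op.ext fun _ => map_zero (C.dt k)
  map_add' _ _ := Op.ext fun _ => map_add (C.dt k) _ _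

theorem coeff_dtOp (k : ℕ+) (n : ℤ) (P : C.Op) : coeff n (dtOp k P) = C.dt k (coeff n P) := rfl

theorem OrdLE.dtOp {N : ℤ} {P : C.Op} (h : OrdLE N P) (k : ℕ+) : OrdLE N (dtOp k P) :=
  fun j hj => by rw [coeff_dtOp, h j hj, map_zero]

theorem dtOp_mul (k : ℕ+) (P Q : C.Op) : dtOp k (P * Q) = dtOp k P * Q + P * dtOp k Q := by
  ext n
  obtain ⟨N, hN⟩ := exists_ordLE P
  obtain ⟨N', hN'⟩ := exists_ordLE Q
  rw [map_add, coeff_dtOp, coeff_mul_eq_sum hN hN', coeff_mul_eq_sum (hN.dtOp k) hN',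
    coeff_mul_eq_sum hN (hN'.dtOp k), map_sum, ← Finset.sum_add_distrib]
  refine Finset.sum_congr rfl fun ij _ => ?_
  rw [coeff_dtOp, coeff_dtOp]
  unfold mulCoeff
  split_ifs
  · rw [map_zsmul, dt_mul, dt_D_pow, dt_twist, smul_add]
  · simp

theorem dtOp_const (k : ℕ+) (a : A) : dtOp k (C.const a) = C.const (C.dt k a) := by
  ext n
  rw [coeff_dtOp, coeff_const, coeff_const]
  split_ifs <;> simp

theorem dtOp_single_one (k : ℕ+) (i : ℤ) : dtOp k (C.single i 1) = 0 := by
  ext n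
  rw [coeff_dtOp, coeff_single]
  split_ifs <;> simp

theorem dtOp_dop (k : ℕ+) : dtOp k C.dop = 0 := dtOp_single_one k 1

theorem dtOp_plus (k : ℕ+) (P : C.Op) : SuperCalculus.dtOp k (plus P) = plus (SuperCalculus.dtOp k P) := by
  ext n
  rw [coeff_dtOp, coeff_plus, coeff_plus]
  split_ifs
  · rfl
  · simp

theorem dt_act (k : ℕ+) (P : C.Op) (f : A) :
    C.dt k (act P f) = act (SuperCalculus.dtOp k P) f + act P (C.dt k f) := by
  rw [act, ← coeff_dtOp, dtOp_mul, map_add, dtOp_const]; rfl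

/-! ### Homogeneous operators -/

/-- `P` is homogeneous of parity `d`, where `𝒟` is odd. -/
def HomOp (d : ZMod 2) (P : C.Op) : Prop := ∀ j : ℤ, coeff j P ∈ 𝒜 (j + d)

theorem HomOp.add {d : ZMod 2} {P Q : C.Op} (hP : HomOp d P) (hQ : HomOp d Q) : HomOp d (P + Q) :=
  fun j => by rw [map_add]; exact add_mem (hP j) (hQ j)

theorem homOp_sum {ι : Type*} (s : Finset ι) {d : ZMod 2} (F : ι → C.Op)
    (h : ∀ i ∈ s, HomOp d (F i)) : HomOp d (∑ i ∈ s, F i) := fun j => by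
  rw [map_sum]; exact sum_mem fun i hi => h i hi j

theorem HomOp.mul {d e : ZMod 2} {P Q : C.Op} (hP : HomOp d P) (hQ : HomOp e Q) :
    HomOp (d + e) (P * Q) := by
  intro n
  obtain ⟨N, hN⟩ := exists_ordLE P
  obtain ⟨N', hN'⟩ := exists_ordLE Q
  rw [coeff_mul_eq_sum hN hN']
  refine sum_mem fun ij _ => ?_
  rcases lt_or_ge (ij.1 + ij.2) n with h | h
  · rw [mulCoeff_of_lt _ _ _ _ _ h]; exact zero_mem _
  · obtain ⟨k, hk⟩ := Int.le.dest h
    rw [mulCoeff_of_add _ _ _ _ _ k hk]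
    refine zsmul_mem (mul_mem_graded' (hP _) (D_pow_mem C k (twist_mem C _ (hQ _))) ?_) _
    have h1 : ((n : ℤ) : ZMod 2) + k = ij.1 + ij.2 := by exact_mod_cast congrArg (Int.cast : ℤ → ZMod 2) hk
    have h2 : (n : ZMod 2) = ij.1 + ij.2 + k := by
      rw [← h1, add_assoc, zmod_two_add_self, add_zero]
    rw [h2]; abel

theorem homOp_single {p d : ZMod 2} (i : ℤ) {a : A} (ha : a ∈ 𝒜 p) (h : (i : ZMod 2) + d = p) :
    HomOp d (C.single i a) := by
  intro j
  rw [coeff_single]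
  split_ifs with hj
  · rw [hj, h]; exact ha
  · exact zero_mem _

theorem homOp_const {d : ZMod 2} {a : A} (ha : a ∈ 𝒜 d) : HomOp d (C.const a) :=
  homOp_single 0 ha (by simp)

theorem homOp_dop : HomOp 1 C.dop := homOp_single 1 one_mem_graded (by decide)

theorem homOp_dinv : HomOp 1 C.dinv := homOp_single (-1) one_mem_graded (by decide)

theorem HomOp.pow {P : C.Op} (hP : HomOp 1 P) (n : ℕ) : HomOp n (P ^ n) := by
  induction n with
  | zero => rw [pow_zero, Nat.cast_zero]; exact homOp_const one_mem_graded
  | succ n ih => rw [pow_succ, Nat.cast_succ]; exact ih.mul hP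

theorem HomOp.pow_two_mul {P : C.Op} (hP : HomOp 1 P) (n : ℕ) : HomOp 0 (P ^ (2 * n)) := by
  have h := hP.pow (2 * n)
  rwa [Nat.cast_mul, show ((2 : ℕ) : ZMod 2) = 0 from rfl, zero_mul] at h

theorem HomOp.act_mem {d q : ZMod 2} {P : C.Op} (hP : HomOp d P) {f : A} (hf : f ∈ 𝒜 q) :
    act P f ∈ 𝒜 (d + q) := by
  have := (hP.mul (homOp_const hf)) 0
  simpa [act] using this

/-! ### The adjoint action -/

/-- Integration by parts: left division by 𝒟, with the adjoint value as remainder. Moving one 𝒟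
across a costs a sign and a twist, and the accumulated signs are counted by the triangular number
j(j+1)/2. -/
theorem exists_const_mul_dop_pow (j : ℕ) (a : A) : ∃ E : C.Op, IsDiff E ∧ C.const a * C.dop ^ j =
    C.const (((-1 : ℤ) ^ (j * (j + 1) / 2)) • (C.D ^ j) (C.twist j a)) + C.dop * E := by
  induction j generalizing a with
  | zero => exact ⟨0, isDiff_zero, by simp⟩
  | succ j ih =>
    obtain ⟨E, hE, h⟩ := ih (C.D (parity 𝒜 a))
    refine ⟨C.const (parity 𝒜 a) * C.dop ^ j - E, ((isDiff_dop_pow j).const_mul _).sub hE, ?_⟩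
    have h1 : C.const a * C.dop = C.dop * C.const (parity 𝒜 a) - C.const (C.D (parity 𝒜 a)) := by
      rw [dop_mul_const, parity_parity]; abel
    rw [pow_succ', ← mul_assoc, h1, sub_mul, h, mul_sub, mul_assoc]
    have h2 : (j + 1) * (j + 1 + 1) / 2 = j * (j + 1) / 2 + (j + 1) := by
      rw [show (j + 1) * (j + 1 + 1) = j * (j + 1) + (j + 1) * 2 by ring,
        Nat.add_mul_div_right _ _ (by norm_num)]
    have h3 : C.twist j (C.D (parity 𝒜 a)) = (-1 : ℤ) ^ j • C.D (C.twist ((j + 1 : ℕ) : ℤ) a) := by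
      push_cast
      rw [twist_succ]
      unfold twist
      split_ifs with hj
      · rw [Int.even_coe_nat] at hj
        rw [hj.neg_one_pow, one_smul]
      · rw [Int.even_coe_nat, Nat.not_even_iff_odd] at hj
        rw [hj.neg_one_pow, D_parity, parity_parity, map_neg, parity_parity, neg_smul, one_smul]
    have h4 : ((-1 : ℤ) ^ ((j + 1) * (j + 1 + 1) / 2)) •
        (C.D ^ (j + 1)) (C.twist ((j + 1 : ℕ) : ℤ) a) =
        -(((-1 : ℤ) ^ (j * (j + 1) / 2)) • (C.D ^ j) (C.twist j (C.D (parity 𝒜 a)))) := by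
      rw [h3, h2, map_zsmul, smul_smul, pow_succ (C.D) j, Module.End.mul_apply, ← neg_smul]
      congr 1
      rw [pow_add, pow_succ (-1 : ℤ) j]; ring
    rw [h4, map_neg]; abel

variable [SuperCommutative 𝒜]

theorem twist_mul_eq {p : ZMod 2} {j : ℕ} {a : A} (h : (j : ZMod 2) = p) (ha : a ∈ 𝒜 p) (ψ : A) :
    C.twist j (ψ * a) = C.twist j a * ψ := by
  rw [twist_mul]
  unfold twist
  split_ifs with hj
  · rw [Int.even_coe_nat] at hj
    have hp : p = 0 := by rw [← h]; exact (ZMod.natCast_eq_zero_iff_even).2 hj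
    subst hp
    rw [comm_of_even ha]
  · rw [Int.even_coe_nat, Nat.not_even_iff_odd] at hj
    have hp : p = 1 := by rw [← h]; exact (ZMod.natCast_eq_one_iff_odd).2 hj
    subst hp
    rw [parity_of_mem_one ha, mul_neg, neg_mul, mul_odd ha]

/-- The adjoint value of ψ is the remainder of ψP₊ on left division by 𝒟. Evenness of P makes the
twist in `adjApplyPlus` agree with that of the product ψ p_j. Adjoint flows can then be handled
without a theory of adjoint operators. -/
theorem exists_const_mul_plus {P : C.Op} (hP : HomOp 0 P) (ψ : A) : ∃ E : C.Op, IsDiff E ∧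
    C.const ψ * plus P = C.const (C.adjApplyPlus P ψ) + C.dop * E := by
  obtain ⟨N, hN⟩ := exists_ordLE_nat P
  have hN' : OrdLE N (plus P) := fun j hj => by
    rw [coeff_plus, if_pos (by omega), hN j hj]
  choose E hE h using fun (j : ℕ) => exists_const_mul_dop_pow (C := C) j (ψ * coeff j P)
  refine ⟨∑ j ∈ Finset.range (N + 1), E j, isDiff_sum _ _ fun j _ => hE j, ?_⟩
  have h1 : C.adjApplyPlus P ψ = ∑ j ∈ Finset.range (N + 1), ((-1 : ℤ) ^ (j * (j + 1) / 2)) •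
      (C.D ^ j) (C.twist j (ψ * coeff j P)) := by
    unfold adjApplyPlus
    rw [finsum_eq_sum_of_support_subset (s := Finset.range (N + 1))]
    · refine Finset.sum_congr rfl fun j _ => ?_
      have h2 : coeff (j : ℤ) P ∈ 𝒜 (j : ZMod 2) := by simpa using hP j
      rw [twist_mul_eq rfl h2]; rfl
    · intro j hj
      rw [Finset.coe_range, Set.mem_Iio]
      by_contra h
      refine hj ?_
      have : P.1 j = 0 := hN j (by omega)
      simp [this]
  rw [h1, map_sum, Finset.mul_sum, ← Finset.sum_add_distrib]
  nth_rewrite 1 [(isDiff_plus P).eq_sum hN']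
  rw [Finset.mul_sum]
  refine Finset.sum_congr rfl fun j _ => ?_
  rw [← h, coeff_plus, if_pos (by omega), ← mul_assoc, map_mul]

/-- Uniqueness of that remainder: F - E equals 𝒟⁻¹(a - b), so it is of negative order as well as
differential. -/
theorem eq_of_const_eq_add_dop_mul {a b : A} {E F : C.Op} (hE : IsDiff E) (hF : IsDiff F)
    (h : C.const a + C.dop * E = C.const b + C.dop * F) : a = b := by
  have h1 : C.const (a - b) = C.dop * (F - E) := by
    rw [map_sub, mul_sub, sub_eq_sub_iff_add_eq_add, h]; abel
  have h2 : C.dinv * C.const (a - b) = F - E := by rw [h1, dinv_mul_dop_mul]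
  have h3 := congrArg (coeff (C := C) 0) (dop_mul_dinv_mul (C.const (a - b)))
  rw [h2, coeff_dop_mul, (hF.sub hE) (0 - 1) (by norm_num), coeff_zero_const] at h3
  have h4 : coeff 0 (F - E) = 0 := by
    rw [← h2]
    exact isNeg_dinv.mul_const _ 0 (by norm_num)
  rw [h4] at h3
  simp only [map_zero, add_zero] at h3
  exact (sub_eq_zero.1 h3.symm)

end SuperCalculus

/-! ### Antiderivatives and the nonlocal action of the Lax operator. -/

namespace SuperCalculus

variable {A : Type*} [Ring A] [Algebra ℚ A] {𝒜 : ZMod 2 → Submodule ℚ A} [GradedAlgebra 𝒜]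
  {C : SuperCalculus 𝒜}

theorem act_plus (P : C.Op) (f : A) : act (plus P) f = act P f := by
  have h := (isNeg_sub_plus P).act_eq f
  rw [act_sub, sub_eq_zero] at h
  exact h.symm

theorem act_mul_const (P : C.Op) (a f : A) : act (P * C.const a) f = act P (a * f) := by
  rw [act, act, map_mul C.const, mul_assoc]

theorem coeff_neg_one_dinv_mul_const (a : A) : coeff (-1) (C.dinv * C.const a) = parity 𝒜 a := by
  rw [dinv, const_eq_single, coeff_single_mul_single, mulCoeff_of_add _ _ _ _ _ 0 (by norm_num)]
  simp [superChoose_zero]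

/-- The trailing 𝒟⁻¹ in the prescribed residue only shifts exponents by one, turning the residue
into an order-zero coefficient. -/
theorem IsPotential.dt_eq_act {L : C.Op} {ψ f S : A} (h : C.IsPotential L ψ f S) (k : ℕ+) :
    C.dt k S = act (C.dinv * (C.const ψ * plus (L ^ (2 * k : ℕ)))) f := by
  rw [h.dt_eq k, pow_eq]
  change coeff (-1) (C.dinv * (C.const ψ * (plus (L ^ (2 * k : ℕ)) * C.single (-1) f))) = _
  rw [single_neg_one_eq, ← mul_assoc (plus _), ← mul_assoc (C.const ψ), ← mul_assoc C.dinv,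
    coeff_mul_dinv, act, mul_assoc C.dinv, mul_assoc (C.const ψ)]
  rfl

/-- For `D_θ S = ψ f`, the differential part of `B Φ 𝒟⁻¹ ψ` sends `f` to `B(Φ S) - B(Φ) S`. -/
theorem act_mul_dinv_mul {B : C.Op} (hB : IsDiff B) {Φ ψ f S : A} (hS : C.D S = ψ * f) :
    act (B * (C.const Φ * C.dinv * C.const ψ)) f = act B (Φ * S) - act B Φ * S := by
  obtain ⟨E, hE, h⟩ := hB.exists_mul_const Φ
  have h1 : B * (C.const Φ * C.dinv * C.const ψ) =
      C.const (act B Φ) * (C.dinv * C.const ψ) + E * C.const ψ := by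
    rw [← mul_assoc, ← mul_assoc, h, add_mul, mul_assoc E, dop_mul_dinv, mul_one, add_mul,
      mul_assoc]
  have h2 : E * C.dop = B * C.const Φ - C.const (act B Φ) := by rw [h]; abel
  rw [h1, act_add, ((isNeg_dinv.mul_const ψ).const_mul _).act_eq, zero_add, act_mul_const, ← hS,
    ← act_dop, ← act_mul hE isDiff_dop, h2, act_sub, act_mul_const, act_const]

/-- The Lax operator in terms of `f₀`, `Φ`, `Ψ`. -/
noncomputable def laxForm (C : SuperCalculus 𝒜) {m : ℕ} (f₀ : A) (Φ Ψ : Fin m → A) : C.Op :=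
  C.dop + C.const f₀ + ∑ j, C.const (Φ j.rev) * C.dinv * C.const (Ψ j)

theorem laxForm_eq {m : ℕ} (f₀ : A) (Φ Ψ : Fin m → A) : C.laxForm f₀ Φ Ψ =
    (SPDO.mono 1 1 + SPDO.mono f₀ 0 +
      ∑ j, C.mul (SPDO.mono (Φ j.rev) (-1)) (SPDO.mono (Ψ j) 0) : SPDO A) := by
  unfold laxForm
  simp only [← single_neg_one_eq]
  rfl

theorem isNeg_sum {ι : Type*} (s : Finset ι) (F : ι → C.Op) (h : ∀ i ∈ s, IsNeg (F i)) :
    IsNeg (∑ i ∈ s, F i) := fun j hj => by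
  rw [map_sum]; exact Finset.sum_eq_zero fun i hi => h i hi j hj

theorem plus_laxForm {m : ℕ} (f₀ : A) (Φ Ψ : Fin m → A) :
    plus (C.laxForm f₀ Φ Ψ) = C.dop + C.const f₀ :=
  plus_eq_of_eq_add rfl (isDiff_dop.add (isDiff_const _))
    (isNeg_sum _ _ fun _ _ => (isNeg_dinv.const_mul _).mul_const _)

theorem homOp_laxForm {m : ℕ} {p : Fin m → ZMod 2} {f₀ : A} {Φ Ψ : Fin m → A} (hf : f₀ ∈ 𝒜 1)
    (hΦ : ∀ j, Φ j ∈ 𝒜 (p j)) (hΨ : ∀ j, Ψ j ∈ 𝒜 (p j.rev)) : HomOp 1 (C.laxForm f₀ Φ Ψ) := by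
  refine (homOp_dop.add (homOp_const hf)).add (homOp_sum _ _ fun j _ => ?_)
  have h := ((homOp_const (C := C) (hΦ j.rev)).mul homOp_dinv).mul (homOp_const (hΨ j))
  have h1 : p j.rev + 1 + p j.rev = 1 := by
    rw [add_right_comm, zmod_two_add_self, zero_add]
  rwa [h1] at h

/-- `L(f)` obeys the flow of a super-eigenfunction if `f` does. -/
theorem dt_laxApply {m : ℕ} {k : ℕ+} {f₀ f : A} {Φ Ψ S : Fin m → A} {B : C.Op} (hB : IsDiff B)
    (hlax : dtOp k (C.laxForm f₀ Φ Ψ) = B * C.laxForm f₀ Φ Ψ - C.laxForm f₀ Φ Ψ * B)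
    (hΦ : ∀ j, C.dt k (Φ j) = act B (Φ j)) (hf : C.dt k f = act B f)
    (hD : ∀ j, C.D (S j) = Ψ j * f)
    (hS : ∀ j, C.dt k (S j) = act (C.dinv * (C.const (Ψ j) * B)) f) :
    C.dt k (act (C.laxForm f₀ Φ Ψ) f + ∑ j, Φ j.rev * S j) =
      act B (act (C.laxForm f₀ Φ Ψ) f + ∑ j, Φ j.rev * S j) := by
  set L := C.laxForm f₀ Φ Ψ with hL
  set Lp := C.dop + C.const f₀ with hLp
  have hLpd : IsDiff Lp := isDiff_dop.add (isDiff_const _)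
  have h0 : L = Lp + ∑ j, C.const (Φ j.rev) * C.dinv * C.const (Ψ j) := rfl
  have h1 : act L f = act Lp f := by rw [← act_plus, hL, plus_laxForm]
  -- `act` sees only the differential part, so ∂_k L₊ may be replaced by ∂_k L and the Lax equation
  -- applies.
  have h2 : act (dtOp k Lp) f = act (B * L) f - act (L * B) f := by
    rw [← act_sub, ← hlax, ← act_plus (dtOp k L), ← dtOp_plus, hL, plus_laxForm]
  have h3 : act (B * L) f = act B (act Lp f) +
      ∑ j, (act B (Φ j.rev * S j) - act B (Φ j.rev) * S j) := by
    rw [h0, mul_add, act_add, act_mul hB hLpd, Finset.mul_sum, act_sum]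
    congr 1
    exact Finset.sum_congr rfl fun j _ => act_mul_dinv_mul hB (hD j)
  -- A nonlocal summand of L B contributes Φ times the order-zero coefficient of 𝒟⁻¹ΨB f, which is
  -- the prescribed ∂_k S.
  have h4 : act (L * B) f = act Lp (act B f) + ∑ j, Φ j.rev * C.dt k (S j) := by
    rw [h0, add_mul, act_add, act_mul hLpd hB, Finset.sum_mul, act_sum]
    congr 1
    refine Finset.sum_congr rfl fun j _ => ?_
    rw [hS, mul_assoc, mul_assoc, act_const_mul]
  have h5 : ∀ j, C.dt k (Φ j.rev * S j) = act B (Φ j.rev) * S j + Φ j.rev * C.dt k (S j) :=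
    fun j => by rw [dt_mul, hΦ]
  rw [h1, map_add, dt_act, h2, h3, h4, hf, map_sum, act_add_right, act_sum_right]
  simp only [h5, Finset.sum_add_distrib, Finset.sum_sub_distrib]
  abel

/-! ### The Darboux–Bäcklund operator -/

section Darboux

variable [SuperCommutative 𝒜] {χ χi : A}

/-- The operator `χ 𝒟 χ⁻¹`. -/
noncomputable def gauge (C : SuperCalculus 𝒜) (χ χi : A) : C.Op := C.const χ * C.dop * C.const χi

/-- The operator `χ 𝒟⁻¹ χ⁻¹`. -/
noncomputable def gaugeInv (C : SuperCalculus 𝒜) (χ χi : A) : C.Op :=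
  C.const χ * C.dinv * C.const χi

theorem dbOp_eq (χ : A) : C.dbOp χ = C.gauge χ (Ring.inverse χ) := by
  rw [gauge, ← single_one_eq]; rfl

theorem dbOpInv_eq (χ : A) : C.dbOpInv χ = C.gaugeInv χ (Ring.inverse χ) := by
  rw [gaugeInv, ← single_neg_one_eq]; rfl

theorem act_gauge (f : A) : act (C.gauge χ χi) f = χ * C.D (χi * f) := by
  rw [gauge, act_mul_const, act_const_mul, act_dop]

/-- `χ` is bosonic with inverse `χi`. -/
structure EvenInv (𝒜 : ZMod 2 → Submodule ℚ A) (χ χi : A) : Prop where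
  mem : χ ∈ 𝒜 0
  inv_mem : χi ∈ 𝒜 0
  inv_mul : χi * χ = 1
  mul_inv : χ * χi = 1

theorem EvenInv.of_isUnit (h : χ ∈ 𝒜 0) (hu : IsUnit χ) : EvenInv 𝒜 χ (Ring.inverse χ) :=
  ⟨h, inverse_mem_zero h hu, Ring.inverse_mul_cancel χ hu, Ring.mul_inverse_cancel χ hu⟩

namespace EvenInv

variable (h : EvenInv 𝒜 χ χi)
include h

theorem inv_mul_cancel_left (y : A) : χi * (χ * y) = y := by rw [← mul_assoc, h.inv_mul, one_mul]

theorem mul_inv_cancel_left (y : A) : χ * (χi * y) = y := by rw [← mul_assoc, h.mul_inv, one_mul]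

theorem const_inv_mul (P : C.Op) : C.const χi * (C.const χ * P) = P := by
  rw [← mul_assoc, ← map_mul, h.inv_mul, map_one, one_mul]

theorem const_mul_inv (P : C.Op) : C.const χ * (C.const χi * P) = P := by
  rw [← mul_assoc, ← map_mul, h.mul_inv, map_one, one_mul]

theorem gauge_mul_gaugeInv : C.gauge χ χi * C.gaugeInv χ χi = 1 := by
  simp only [gauge, gaugeInv, mul_assoc, h.const_inv_mul, dop_mul_dinv_mul]
  rw [← map_mul, h.mul_inv, map_one]

theorem gaugeInv_mul_gauge : C.gaugeInv χ χi * C.gauge χ χi = 1 := by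
  simp only [gauge, gaugeInv, mul_assoc, h.const_inv_mul, dinv_mul_dop_mul]
  rw [← map_mul, h.mul_inv, map_one]

theorem D_inv : C.D χi = -(χi * C.D χ * χi) := by
  have h1 := congrArg C.D h.inv_mul
  rw [D_mul, D_one, parity_of_mem_zero h.inv_mem] at h1
  have h2 : C.D χi * χ * χi = -(χi * C.D χ * χi) := by
    rw [eq_neg_of_add_eq_zero_left h1, neg_mul]
  rwa [mul_assoc, h.mul_inv, mul_one] at h2

theorem dt_inv (k : ℕ+) : C.dt k χi = -(χi * C.dt k χ * χi) := by
  have h1 := congrArg (C.dt k) h.inv_mul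
  rw [dt_mul, dt_unit] at h1
  have h2 : C.dt k χi * χ * χi = -(χi * C.dt k χ * χi) := by
    rw [eq_neg_of_add_eq_zero_left h1, neg_mul]
  rwa [mul_assoc, h.mul_inv, mul_one] at h2

theorem D_mem_one : C.D χ ∈ 𝒜 1 := by simpa using C.D_mem h.mem

theorem logD_mem : χi * C.D χ ∈ 𝒜 1 := mul_mem_graded' h.inv_mem h.D_mem_one (by decide)

theorem mul_D_inv : χ * C.D χi = -(χi * C.D χ) := by
  rw [h.D_inv, mul_neg, ← comm_of_even h.inv_mem (χi * C.D χ), h.mul_inv_cancel_left]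

theorem gauge_eq : C.gauge χ χi = C.dop - C.const (χi * C.D χ) := by
  rw [gauge, mul_assoc, dop_mul_const, parity_of_mem_zero h.inv_mem, mul_add, h.const_mul_inv,
    ← map_mul, h.mul_D_inv, map_neg]
  abel

theorem act_gauge_eq (f : A) : act (C.gauge χ χi) f = C.D f - χi * C.D χ * f := by
  rw [h.gauge_eq, act_sub, act_dop, act_const]

theorem act_gauge_self : act (C.gauge χ χi) χ = 0 := by
  rw [act_gauge, h.inv_mul, D_one, mul_zero]

theorem isDiff_gauge : IsDiff (C.gauge χ χi) := by
  rw [h.gauge_eq]; exact isDiff_dop.sub (isDiff_const _)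

theorem homOp_gauge : HomOp 1 (C.gauge χ χi) := by
  rw [h.gauge_eq, sub_eq_add_neg, ← map_neg]
  exact homOp_dop.add (homOp_const (neg_mem h.logD_mem))

/-- Equality of the mixed derivatives of ln χ; the terms from differentiating χ⁻¹ agree because
χ⁻¹∂_k χ is bosonic and hence central. -/
theorem dt_logD (k : ℕ+) : C.dt k (χi * C.D χ) = C.D (χi * C.dt k χ) := by
  rw [dt_mul, D_mul, h.dt_inv, h.D_inv, parity_of_mem_zero h.inv_mem, dt_D]
  congr 1
  have h1 : χi * C.dt k χ ∈ 𝒜 0 := mul_mem_graded' h.inv_mem (C.dt_mem k h.mem) (by decide)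
  rw [neg_mul, neg_mul, mul_assoc (χi * C.D χ), mul_assoc χi (C.D χ), ← comm_of_even h1,
    mul_assoc χi (C.dt k χ) χi, ← comm_of_even h.inv_mem, mul_assoc, mul_assoc]

theorem dtOp_gauge (k : ℕ+) : dtOp k (C.gauge χ χi) = -C.const (C.D (χi * C.dt k χ)) := by
  rw [h.gauge_eq, map_sub, dtOp_dop, dtOp_const, h.dt_logD, zero_sub]

theorem dtOp_gaugeInv (k : ℕ+) : dtOp k (C.gaugeInv χ χi) =
    -(C.gaugeInv χ χi * dtOp k (C.gauge χ χi) * C.gaugeInv χ χi) := by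
  have h1 := congrArg (dtOp k) (h.gaugeInv_mul_gauge (C := C))
  rw [dtOp_mul, ← map_one C.const, dtOp_const, dt_unit, map_zero] at h1
  have h2 := congrArg (· * C.gaugeInv χ χi) (eq_neg_of_add_eq_zero_left h1)
  simpa only [mul_assoc, h.gauge_mul_gaugeInv, mul_one, neg_mul] using h2

theorem conj_pow (P : C.Op) (n : ℕ) : (C.gauge χ χi * P * C.gaugeInv χ χi) ^ n =
    C.gauge χ χi * P ^ n * C.gaugeInv χ χi := by
  induction n with
  | zero => rw [pow_zero, pow_zero, mul_one, h.gauge_mul_gaugeInv]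
  | succ n ih =>
    rw [pow_succ, ih, pow_succ]
    have h1 (Q : C.Op) : C.gaugeInv χ χi * (C.gauge χ χi * Q) = Q := by
      rw [← mul_assoc, h.gaugeInv_mul_gauge, one_mul]
    simp only [mul_assoc, h1]

theorem isNeg_conj {P : C.Op} (hP : IsNeg P) : IsNeg (C.gauge χ χi * P * C.gaugeInv χ χi) := by
  have h1 : OrdLE 1 (C.gauge χ χi) := by
    rw [h.gauge_eq, sub_eq_add_neg, ← map_neg]
    exact (ordLE_single _ _).add ((ordLE_const _).mono (by norm_num))
  have h2 : OrdLE (-1) (C.gaugeInv χ χi) := (isNeg_dinv.const_mul _).mul_const _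
  exact ((h1.mul hP).mul h2).mono (by norm_num)

/-- The decomposition of `T B T⁻¹` into a differential operator and a multiple of `𝒟⁻¹ χ⁻¹`. -/
theorem conj_eq {k : ℕ+} {B : C.Op} (hB : IsDiff B) (hχ : C.dt k χ = act B χ) :
    ∃ E : C.Op, IsDiff E ∧ B * C.const χ = C.const (act B χ) + E * C.dop ∧
      C.gauge χ χi * B * C.gaugeInv χ χi =
      C.const χ * (C.dop * (C.const χi * (E * C.const χi))) + C.const (C.dt k χ * χi) +
        C.const (χ * C.D (χi * C.dt k χ)) * (C.dinv * C.const χi) := by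
  obtain ⟨E, hE, hE'⟩ := hB.exists_mul_const χ
  refine ⟨E, hE, hE', ?_⟩
  have hf : χi * C.dt k χ ∈ 𝒜 0 := mul_mem_graded' h.inv_mem (C.dt_mem k h.mem) (by decide)
  have h1 : B * (C.const χ * (C.dinv * C.const χi)) =
      C.const (C.dt k χ) * (C.dinv * C.const χi) + E * C.const χi := by
    rw [← mul_assoc, hE', add_mul, mul_assoc E, dop_mul_dinv_mul, hχ]
  have h2 : C.dop * (C.const χi * (C.const (C.dt k χ) * (C.dinv * C.const χi))) =
      C.const (C.D (χi * C.dt k χ)) * (C.dinv * C.const χi) +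
        C.const (χi * C.dt k χ) * C.const χi := by
    rw [← mul_assoc (C.const χi), ← map_mul, ← mul_assoc, dop_mul_const, parity_of_mem_zero hf,
      add_mul, mul_assoc (C.const (χi * C.dt k χ)), dop_mul_dinv_mul]
  have h3 : C.const χ * (C.const (χi * C.dt k χ) * C.const χi) = C.const (C.dt k χ * χi) := by
    rw [← map_mul, ← map_mul, mul_assoc, h.mul_inv_cancel_left]
  simp only [gauge, gaugeInv, mul_assoc]
  rw [h1, mul_add, mul_add, mul_add, h2, mul_add, h3, map_mul C.const χ, mul_assoc]
  abel

theorem dtOp_gauge_mul_gaugeInv (k : ℕ+) : dtOp k (C.gauge χ χi) * C.gaugeInv χ χi =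
    -(C.const (χ * C.D (χi * C.dt k χ)) * (C.dinv * C.const χi)) := by
  rw [h.dtOp_gauge, gaugeInv, mul_assoc, neg_mul, ← mul_assoc, ← map_mul, comm_of_even h.mem]

/-- The differential part of `T P T⁻¹`. -/
theorem plus_conj {k : ℕ+} {P : C.Op} (hχ : C.dt k χ = act (plus P) χ) :
    plus (C.gauge χ χi * P * C.gaugeInv χ χi) =
      C.gauge χ χi * plus P * C.gaugeInv χ χi + dtOp k (C.gauge χ χi) * C.gaugeInv χ χi := by
  obtain ⟨E, hE, -, h1⟩ := h.conj_eq (isDiff_plus P) hχ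
  have h2 : C.gauge χ χi * P * C.gaugeInv χ χi = C.gauge χ χi * plus P * C.gaugeInv χ χi +
      C.gauge χ χi * (P - plus P) * C.gaugeInv χ χi := by
    rw [mul_sub, sub_mul]; abel
  -- Conjugation by T preserves negative order, so only P₊ matters. The term (∂_k T) T⁻¹ is minus
  -- the tail isolated in `conj_eq`.
  rw [h2, map_add, (h.isNeg_conj (isNeg_sub_plus P)).plus_eq, add_zero, h.dtOp_gauge_mul_gaugeInv]
  refine plus_eq_of_eq_add (R := C.const (χ * C.D (χi * C.dt k χ)) * (C.dinv * C.const χi))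
    (by abel) ?_ ((isNeg_dinv.mul_const _).const_mul _)
  rw [h1, add_neg_cancel_right]
  exact (((((hE.mul (isDiff_const _)).const_mul _).dop_mul).const_mul _).add (isDiff_const _))

end EvenInv

end Darboux

end SuperCalculus

/-- For comparing the old and new sums over pairs: at one index the old summand is killed by T while
the new one is an extra term. -/
theorem sum_eq_add_sum_of_ne {ι M : Type*} [Fintype ι] [DecidableEq ι] [AddCommMonoid M]
    {F G : ι → M} (i : ι) (hG : G i = 0) (h : ∀ j, j ≠ i → F j = G j) :
    ∑ j, F j = F i + ∑ j, G j := by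
  rw [← Finset.add_sum_erase _ F (Finset.mem_univ i), ← Finset.add_sum_erase _ G (Finset.mem_univ i),
    hG, zero_add]
  congr 1
  exact Finset.sum_congr rfl fun j hj => h j (Finset.ne_of_mem_erase hj)

/-! ### Invariance of the constrained form under a DB step. -/

namespace SuperCalculus

variable {A : Type*} [Ring A] [Algebra ℚ A] {𝒜 : ZMod 2 → Submodule ℚ A} [GradedAlgebra 𝒜]
  {C : SuperCalculus 𝒜} [SuperCommutative 𝒜] {χ χi : A}

namespace EvenInv

variable (h : EvenInv 𝒜 χ χi)
include h

theorem gauge_mul_const (y : A) : C.gauge χ χi * C.const y =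
    C.const (act (C.gauge χ χi) y) + C.const (parity 𝒜 y) * C.dop := by
  rw [h.act_gauge_eq, h.gauge_eq, sub_mul, dop_mul_const, ← map_mul, map_sub]
  abel

theorem act_gauge_mul {y S : A} : act (C.gauge χ χi) (y * S) =
    act (C.gauge χ χi) y * S + parity 𝒜 y * C.D S := by
  rw [← act_mul_const, h.gauge_mul_const, act_add, act_const, act_const_mul, act_dop]

/-- The new order zero coefficient of the Lax operator. -/
theorem local_comm {f₀ : A} (hf : f₀ ∈ 𝒜 1) :
    (C.dop + C.const (-f₀ - 2 * (χi * C.D χ))) * C.gauge χ χi =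
      C.gauge χ χi * (C.dop + C.const f₀) - C.const (C.D (χi * C.D χ) + C.D f₀) := by
  have hg := h.logD_mem (C := C)
  -- With g = D_θ ln χ, the coefficient -f₀ - 2g is the one that makes the terms in 𝒟 agree. As g² =
  -- 0, only the multiplication operator by D_θ g + D_θ f₀ remains.
  rw [h.gauge_eq]
  set g := χi * C.D χ
  have h1 : g * g = 0 := odd_mul_self hg
  have h2 : g * f₀ = -(f₀ * g) := SuperCommutative.odd_anticomm hg hf
  have h3 : C.const (-f₀ - 2 * g) = -C.const f₀ - 2 * C.const g := by
    rw [map_sub, map_neg, map_mul, map_ofNat]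
  have h4 : C.const g * C.const g = 0 := by rw [← map_mul, h1, map_zero]
  have h5 : C.const g * C.const f₀ = -(C.const f₀ * C.const g) := by
    rw [← map_mul, h2, map_neg, map_mul]
  have h6 : C.dop * C.const g = C.const (C.D g) - C.const g * C.dop := by
    rw [dop_mul_const, parity_of_mem_one hg, map_neg]; noncomm_ring
  have h7 : C.dop * C.const f₀ = C.const (C.D f₀) - C.const f₀ * C.dop := by
    rw [dop_mul_const, parity_of_mem_one hf, map_neg]; noncomm_ring
  simp only [h3, mul_add, mul_sub, add_mul, sub_mul, mul_assoc, neg_mul, h4, h5, h6, h7, map_add,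
    mul_zero]
  noncomm_ring

section Step

variable {m : ℕ} {a : Fin m} {Φ Ψ s Φ' Ψ' : Fin m → A} {f₀ : A}

/-- The left side is what the new pair contributes to L̃T, because 𝒟⁻¹χ⁻¹T = χ⁻¹. The right side
collects the defect of `local_comm` and the order-zero terms of all the other summands, so these
cancel. -/
theorem act_gauge_lax (hs : ∀ j, C.D (s j) = Ψ j * χ) :
    act (C.gauge χ χi) (C.D χ + f₀ * χ + ∑ j, Φ j.rev * s j) * χi =
      C.D (χi * C.D χ) + C.D f₀ +
        ∑ j, (act (C.gauge χ χi) (Φ j.rev) * s j * χi + parity 𝒜 (Φ j.rev) * Ψ j) := by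
  have hc (y : A) : χ * y * χi = y := by
    rw [comm_of_even h.mem, mul_assoc, h.mul_inv, mul_one]
  have h1 : χi * (f₀ * χ) = f₀ := by
    rw [← comm_of_even h.mem, h.inv_mul_cancel_left]
  rw [act_gauge, hc, mul_add, mul_add, h1, map_add, map_add, Finset.mul_sum, map_sum]
  congr 1
  refine Finset.sum_congr rfl fun j _ => ?_
  rw [← mul_assoc, D_mul, hs, parity_mul, parity_of_mem_zero h.inv_mem, act_gauge,
    mul_assoc χ, hc, ← mul_assoc, comm_of_even h.inv_mem (parity 𝒜 (Φ j.rev))]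
  congr 1
  rw [mul_assoc, mul_assoc, comm_of_even h.inv_mem, mul_assoc, h.mul_inv, mul_one]

/-- The DB transformed superfields. -/
structure IsStep (h : EvenInv 𝒜 χ χi) (C : SuperCalculus 𝒜) (a : Fin m) (Φ Ψ s : Fin m → A) (f₀ : A)
    (Φ' Ψ' : Fin m → A) : Prop where
  hχ : Φ a = χ
  hf : f₀ ∈ 𝒜 1
  hs : ∀ j, C.D (s j) = Ψ j * χ
  Φ_self : Φ' a = act (C.gauge χ χi) (C.D χ + f₀ * χ + ∑ j, Φ j.rev * s j)
  Φ_ne : ∀ i, i ≠ a → Φ' i = act (C.gauge χ χi) (Φ i)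
  Ψ_self : Ψ' a.rev = χi
  Ψ_ne : ∀ j, j ≠ a.rev → Ψ' j = -(χi * parity 𝒜 (s j))

/-- `L̃ T = T L`. -/
theorem laxForm_mul_gauge (H : IsStep h C a Φ Ψ s f₀ Φ' Ψ') :
    C.laxForm (-f₀ - 2 * (χi * C.D χ)) Φ' Ψ' * C.gauge χ χi =
      C.gauge χ χi * C.laxForm f₀ Φ Ψ := by
  obtain ⟨hχ, hf, hs, hΦ, hΦ', hΨ, hΨ'⟩ := H
  -- This identity turns the summand with Ψ̃ = χ⁻¹ into a multiplication operator.
  have h0 : C.const χi * C.gauge χ χi = C.dop * C.const χi := by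
    rw [gauge, mul_assoc, h.const_inv_mul]
  have h1 : ∀ j, C.const (χi * parity 𝒜 (s j)) * C.gauge χ χi =
      C.dop * C.const (s j * χi) - C.const (Ψ j) := by
    intro j
    have h2 : C.const (parity 𝒜 (s j)) * C.dop = C.dop * C.const (s j) - C.const (Ψ j * χ) := by
      rw [dop_mul_const, hs]; abel
    rw [comm_of_even h.inv_mem, map_mul, mul_assoc, h0, ← mul_assoc, h2, sub_mul, mul_assoc,
      ← map_mul, ← map_mul, mul_assoc (Ψ j), h.mul_inv, mul_one]
  have h2 : ∑ j, C.const (Φ' j.rev) * C.dinv * C.const (Ψ' j) * C.gauge χ χi =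
      C.const (Φ' a) * C.const χi + ∑ j, C.const (act (C.gauge χ χi) (Φ j.rev)) *
        (C.dinv * C.const (Ψ j) - C.const (s j * χi)) := by
    rw [sum_eq_add_sum_of_ne (G := fun j => C.const (act (C.gauge χ χi) (Φ j.rev)) *
        (C.dinv * C.const (Ψ j) - C.const (s j * χi))) a.rev]
    · rw [Fin.rev_rev, hΨ, mul_assoc, h0, mul_assoc, dinv_mul_dop_mul]
    -- The old summand containing χ disappears since T(χ) = 0.
    · rw [Fin.rev_rev, hχ, h.act_gauge_self, map_zero, zero_mul]
    · intro j hj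
      rw [hΨ' j hj, hΦ' _ (fun h' => hj (by rw [← h', Fin.rev_rev])), map_neg, mul_assoc, neg_mul,
        h1, mul_assoc, neg_sub, mul_sub, dinv_mul_dop_mul]
  have h3 : ∀ j, C.gauge χ χi * (C.const (Φ j.rev) * C.dinv * C.const (Ψ j)) =
      C.const (act (C.gauge χ χi) (Φ j.rev)) * (C.dinv * C.const (Ψ j)) +
        C.const (parity 𝒜 (Φ j.rev) * Ψ j) := by
    intro j
    rw [← mul_assoc, ← mul_assoc, h.gauge_mul_const, add_mul, add_mul, mul_assoc, mul_assoc
      (C.const (parity 𝒜 _)), dop_mul_dinv, mul_one, map_mul]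
  unfold laxForm
  rw [add_mul, h.local_comm hf, Finset.sum_mul, h2, mul_add, mul_add, mul_add,
    Finset.mul_sum]
  simp only [h3, mul_sub, Finset.sum_add_distrib, Finset.sum_sub_distrib]
  rw [← map_mul, hΦ, h.act_gauge_lax hs]
  simp only [← map_mul, map_add, map_sum, Finset.sum_add_distrib, mul_assoc]
  abel

theorem conj_laxForm (H : IsStep h C a Φ Ψ s f₀ Φ' Ψ') :
    C.gauge χ χi * C.laxForm f₀ Φ Ψ * C.gaugeInv χ χi =
      C.laxForm (-f₀ - 2 * (χi * C.D χ)) Φ' Ψ' := by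
  rw [← h.laxForm_mul_gauge H, mul_assoc, h.gauge_mul_gaugeInv, mul_one]

/-- `L̃(T(f)) = T(L(f))` for a suitable choice of the antiderivatives on the left. -/
theorem act_gauge_laxApply (H : IsStep h C a Φ Ψ s f₀ Φ' Ψ') {f : A} {S : Fin m → A}
    (hS : ∀ j, C.D (S j) = Ψ j * f) : ∃ S' : Fin m → A,
    (∀ j, C.D (S' j) = Ψ' j * act (C.gauge χ χi) f) ∧
    C.D (act (C.gauge χ χi) f) + (-f₀ - 2 * (χi * C.D χ)) * act (C.gauge χ χi) f +
        ∑ j, Φ' j.rev * S' j =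
      act (C.gauge χ χi) (C.D f + f₀ * f + ∑ j, Φ j.rev * S j) := by
  obtain ⟨hχ, hf, hs, hΦ, hΦ', hΨ, hΨ'⟩ := H
  -- For the new pair, χ⁻¹T(f) = D_θ(χ⁻¹f). For the others, in D_θ(S - sχ⁻¹f) the terms Ψf cancel
  -- and what is left is -parity(s) D_θ(χ⁻¹f), that is, Ψ̃ T(f).
  refine ⟨fun j => if j = a.rev then χi * f else S j - s j * (χi * f), fun j => ?_, ?_⟩
  · dsimp only
    split_ifs with hj
    · rw [hj, hΨ, act_gauge, h.inv_mul_cancel_left]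
    · rw [hΨ' j hj, act_gauge, map_sub, D_mul, hS, hs, mul_assoc, h.mul_inv_cancel_left,
        sub_add_cancel_left, neg_mul, comm_of_even h.inv_mem (parity 𝒜 (s j)),
        mul_assoc, h.inv_mul_cancel_left]
  · have h1 : act ((C.dop + C.const (-f₀ - 2 * (χi * C.D χ))) * C.gauge χ χi) f =
        C.D (act (C.gauge χ χi) f) + (-f₀ - 2 * (χi * C.D χ)) * act (C.gauge χ χi) f := by
      rw [act_mul (isDiff_dop.add (isDiff_const _)) h.isDiff_gauge, act_add, act_dop, act_const]
    have h2 : act (C.gauge χ χi * (C.dop + C.const f₀)) f =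
        act (C.gauge χ χi) (C.D f + f₀ * f) := by
      rw [act_mul h.isDiff_gauge (isDiff_dop.add (isDiff_const _)), act_add, act_dop, act_const]
    rw [← h1, h.local_comm hf, act_sub, h2, act_const,
      sum_eq_add_sum_of_ne (G := fun j => act (C.gauge χ χi) (Φ j.rev) * (S j - s j * (χi * f)))
        a.rev]
    · have h3 : Φ' a * (χi * f) = (C.D (χi * C.D χ) + C.D f₀) * f + ∑ j,
          (act (C.gauge χ χi) (Φ j.rev) * s j * χi * f + parity 𝒜 (Φ j.rev) * Ψ j * f) := by
        rw [← mul_assoc, hΦ, h.act_gauge_lax hs, add_mul, Finset.sum_mul]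
        simp only [add_mul]
      dsimp only
      rw [if_pos rfl, Fin.rev_rev, h3, act_add_right _ (C.D f + f₀ * f), act_sum_right]
      simp only [h.act_gauge_mul, hS, mul_sub, Finset.sum_add_distrib, Finset.sum_sub_distrib,
        mul_assoc]
      abel
    · rw [Fin.rev_rev, hχ, h.act_gauge_self, zero_mul]
    · intro j hj
      dsimp only
      rw [if_neg hj, hΦ' _ (fun h' => hj (by rw [← h', Fin.rev_rev]))]

end Step

/-! ### Flows after a DB step -/

/-- The flow of the transformed Lax operator. -/
theorem dtOp_conj {k : ℕ+} {B B' L : C.Op}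
    (hB' : B' = C.gauge χ χi * B * C.gaugeInv χ χi + dtOp k (C.gauge χ χi) * C.gaugeInv χ χi)
    (hL : dtOp k L = B * L - L * B) :
    dtOp k (C.gauge χ χi * L * C.gaugeInv χ χi) = B' * (C.gauge χ χi * L * C.gaugeInv χ χi) -
      C.gauge χ χi * L * C.gaugeInv χ χi * B' := by
  have h1 (Q : C.Op) : C.gaugeInv χ χi * (C.gauge χ χi * Q) = Q := by
    rw [← mul_assoc, h.gaugeInv_mul_gauge, one_mul]
  rw [hB', dtOp_mul, dtOp_mul, hL, h.dtOp_gaugeInv]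
  simp only [mul_sub, sub_mul, mul_add, add_mul, mul_assoc, h1, mul_neg]
  abel

/-- The flow of a transformed super-eigenfunction. -/
theorem dt_act_gauge {k : ℕ+} {B B' : C.Op} (hB : IsDiff B) (hBd : IsDiff B')
    (hB' : B' = C.gauge χ χi * B * C.gaugeInv χ χi + dtOp k (C.gauge χ χi) * C.gaugeInv χ χi)
    {f : A} (hf : C.dt k f = act B f) :
    C.dt k (act (C.gauge χ χi) f) = act B' (act (C.gauge χ χi) f) := by
  have h1 : B' * C.gauge χ χi = C.gauge χ χi * B + dtOp k (C.gauge χ χi) := by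
    rw [hB', add_mul, mul_assoc, h.gaugeInv_mul_gauge, mul_one, mul_assoc, h.gaugeInv_mul_gauge,
      mul_one]
  rw [← act_mul hBd h.isDiff_gauge, h1, act_add, act_mul h.isDiff_gauge hB, dt_act, hf, add_comm]

/-- The flow of a transformed adjoint super-eigenfunction. -/
theorem exists_parity_mul_inv {k : ℕ+} {B B' F : C.Op} (hB : IsDiff B)
    (hB' : B' = C.gauge χ χi * B * C.gaugeInv χ χi + dtOp k (C.gauge χ χi) * C.gaugeInv χ χi)
    (hχ : C.dt k χ = act B χ) {ψ S : A} (hF : IsDiff F)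
    (hψ : C.const ψ * B = C.const (-C.dt k ψ) + C.dop * F) (hS : C.D S = ψ * χ)
    (hSt : C.dt k S = act (C.dinv * (C.const ψ * B)) χ) :
    ∃ E, IsDiff E ∧ C.const (parity 𝒜 S * χi) * B' =
      C.const (-C.dt k (parity 𝒜 S * χi)) + C.dop * E := by
  obtain ⟨E, hE, hBχ, -⟩ := h.conj_eq hB hχ
  rw [← hχ] at hBχ
  obtain ⟨G, hG, hFχ⟩ := hF.exists_mul_const χ
  -- The evolution law of S says that it equals the quotient of ψB by 𝒟, evaluated on χ; the
  -- remainder lies behind 𝒟⁻¹ and does not contribute.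
  have hF' : act F χ = C.dt k S := by
    rw [hSt, hψ, mul_add, dinv_mul_dop_mul, act_add, (isNeg_dinv.mul_const _).act_eq, zero_add]
  rw [hF'] at hFχ
  set f := χi * C.dt k χ with hf_def
  have hf : f ∈ 𝒜 0 := mul_mem_graded' h.inv_mem (C.dt_mem k h.mem) (by decide)
  refine ⟨C.const S * (C.const χi * (E * C.const χi)) - G * C.const χi,
    ((((hE.mul (isDiff_const _)).const_mul _).const_mul _).sub (hG.mul (isDiff_const _))), ?_⟩
  have e1 : C.const (parity 𝒜 S) * C.dop = C.dop * C.const S - C.const (ψ * χ) := by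
    rw [dop_mul_const, hS]; abel
  have e2 : B * (C.const χ * (C.dinv * C.const χi)) =
      C.const (C.dt k χ) * (C.dinv * C.const χi) + E * C.const χi := by
    rw [← mul_assoc, hBχ, add_mul, mul_assoc E, dop_mul_dinv_mul]
  have e3 : C.const ψ * (B * (C.const χ * (C.dinv * C.const χi))) =
      C.const (-C.dt k ψ * χ) * (C.dinv * C.const χi) + (C.const (C.D (C.dt k S)) *
        (C.dinv * C.const χi) + C.const (parity 𝒜 (C.dt k S)) * C.const χi +
        C.dop * (G * C.const χi)) := by
    rw [← mul_assoc, hψ, add_mul, ← mul_assoc, ← map_mul, mul_assoc,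
      ← mul_assoc F, hFχ, add_mul, mul_assoc G, dop_mul_dinv_mul, mul_add, ← mul_assoc C.dop,
      dop_mul_const, add_mul, mul_assoc (C.const (parity 𝒜 _)), dop_mul_dinv_mul]
  have e4 : C.dop * (C.const (S * f) * (C.dinv * C.const χi)) =
      C.const (ψ * χ * f + parity 𝒜 S * C.D f) * (C.dinv * C.const χi) +
        C.const (parity 𝒜 S * f) * C.const χi := by
    rw [← mul_assoc, dop_mul_const, add_mul, mul_assoc (C.const (parity 𝒜 _)), dop_mul_dinv_mul,
      D_mul, hS, parity_mul, parity_of_mem_zero hf]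
  -- Compatibility of D_θ S = ψχ with the flow; this is what cancels every term ending in 𝒟⁻¹χ⁻¹.
  have e5 : C.D (C.dt k S) = C.dt k ψ * χ + ψ * χ * f := by
    rw [← dt_D, hS, dt_mul, hf_def, mul_assoc ψ, h.mul_inv_cancel_left]
  have e6 : C.dt k (parity 𝒜 S * χi) = parity 𝒜 (C.dt k S) * χi - parity 𝒜 S * f * χi := by
    rw [dt_mul, dt_parity, h.dt_inv, mul_neg, ← sub_eq_add_neg, hf_def, ← mul_assoc]
  have e7 : C.const (parity 𝒜 S * χi) * (C.gauge χ χi * B * C.gaugeInv χ χi) =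
      C.dop * (C.const (S * f) * (C.dinv * C.const χi)) +
        C.dop * (C.const S * (C.const χi * (E * C.const χi))) -
        C.const ψ * (B * (C.const χ * (C.dinv * C.const χi))) := by
    rw [gauge, gaugeInv, map_mul]
    simp only [mul_assoc]
    rw [h.const_inv_mul, ← mul_assoc, e1, sub_mul, map_mul C.const ψ, mul_assoc (C.const ψ),
      h.const_mul_inv, e2, hf_def]
    simp only [mul_add, mul_assoc, map_mul]
  have e8 : C.const (parity 𝒜 S * χi) * (dtOp k (C.gauge χ χi) * C.gaugeInv χ χi) =
      -(C.const (parity 𝒜 S * C.D f) * (C.dinv * C.const χi)) := by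
    rw [h.dtOp_gauge_mul_gaugeInv, mul_neg, ← mul_assoc, ← map_mul, mul_assoc (parity 𝒜 S),
      h.inv_mul_cancel_left]
  rw [hB', mul_add, e7, e8, e3, e4, e5, e6]
  simp only [map_add, map_neg, map_sub, neg_mul, add_mul, mul_sub, map_mul C.const (_ * _) χi,
    map_mul C.const (parity 𝒜 (C.dt k S)) χi]
  abel

/-- The residue of `T P T⁻¹`. -/
theorem coeff_conj {k : ℕ+} {P : C.Op} (hP : HomOp 0 P) (hχ : C.dt k χ = act (plus P) χ) :
    coeff (-1) (C.gauge χ χi * P * C.gaugeInv χ χi) = C.D (χi * C.dt k χ) - coeff (-1) P := by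
  obtain ⟨E, hE, -, h1⟩ := h.conj_eq (isDiff_plus P) hχ
  have h2 : C.gauge χ χi * P * C.gaugeInv χ χi = C.gauge χ χi * plus P * C.gaugeInv χ χi +
      C.gauge χ χi * (P - plus P) * C.gaugeInv χ χi := by
    rw [mul_sub, sub_mul]; abel
  -- The differential part contributes to the residue only through the tail in `conj_eq`.
  have h3 : coeff (-1) (C.gauge χ χi * plus P * C.gaugeInv χ χi) = C.D (χi * C.dt k χ) := by
    have hd : IsDiff (C.const χ * (C.dop * (C.const χi * (E * C.const χi))) +
        C.const (C.dt k χ * χi)) :=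
      (((((hE.mul (isDiff_const _)).const_mul _).dop_mul).const_mul _).add (isDiff_const _))
    rw [h1, map_add, hd _ (by norm_num), zero_add, coeff_const_mul', coeff_neg_one_dinv_mul_const,
      parity_of_mem_zero h.inv_mem, comm_of_even h.mem, mul_assoc, h.mul_inv, mul_one]
  set N := P - plus P
  have hN : IsNeg N := isNeg_sub_plus P
  have hN1 : coeff (-1) N = coeff (-1) P := by
    rw [map_sub, isDiff_plus P _ (by norm_num), sub_zero]
  have hP1 : coeff (-1) P ∈ 𝒜 1 := by simpa using hP (-1)
  have h4 : C.gauge χ χi * N - C.const (-coeff (-1) P) = C.gauge χ χi * N + C.const (coeff (-1) P) := by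
    rw [map_neg, sub_neg_eq_add]
  -- Only the leading coefficient of the negative part N matters: T N has order-zero coefficient
  -- parity(Res P) = -Res P, as the residue is fermionic, and the rest falls to order at most -2
  -- after T⁻¹.
  have h5 : IsNeg (C.gauge χ χi * N + C.const (coeff (-1) P)) := by
    intro j hj
    rw [h.gauge_eq, sub_mul, map_add, map_sub, coeff_const_mul', coeff_dop_mul, hN j hj, coeff_const]
    by_cases hj0 : j = 0
    · subst hj0
      rw [if_pos rfl, zero_sub, hN1, parity_of_mem_one hP1]
      simp
    · rw [hN _ (by omega), if_neg hj0]; simp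
  have h6 : C.gauge χ χi * N * C.gaugeInv χ χi =
      (C.gauge χ χi * N + C.const (coeff (-1) P)) * C.const χ * C.dinv * C.const χi -
        C.const (coeff (-1) P * χ) * (C.dinv * C.const χi) := by
    rw [gaugeInv, map_mul]; noncomm_ring
  have h7 : OrdLE (-2) ((C.gauge χ χi * N + C.const (coeff (-1) P)) * C.const χ * C.dinv *
      C.const χi) := by
    have := ((OrdLE.mul h5 (ordLE_const (C := C) χ)).mul isNeg_dinv).mul (ordLE_const (C := C) χi)
    exact this.mono (by norm_num)
  rw [h2, map_add, h3, h6, map_sub, h7 _ (by norm_num), coeff_const_mul',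
    coeff_neg_one_dinv_mul_const, parity_of_mem_zero h.inv_mem, mul_assoc, h.mul_inv, mul_one]
  abel

end EvenInv

end SuperCalculus

/-! ### One DB step on solutions and on tau functions. -/

namespace SuperCalculus

variable {A : Type*} [Ring A] [Algebra ℚ A] {𝒜 : ZMod 2 → Submodule ℚ A} [GradedAlgebra 𝒜]
  {C : SuperCalculus 𝒜} {m : ℕ}

theorem IsSKP.exists_laxForm {p : Fin m → ZMod 2} {X : SKPData A m} (hX : C.IsSKP p X) :
    ∃ f₀ ∈ 𝒜 1, X.L = C.laxForm f₀ X.Φ X.Ψ := by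
  obtain ⟨f₀, hf, h⟩ := hX.form
  exact ⟨f₀, hf, h.trans (laxForm_eq f₀ X.Φ X.Ψ).symm⟩

theorem laxApply_eq {X : SKPData A m} {f₀ : A} (hL : X.L = C.laxForm f₀ X.Φ X.Ψ) (f : A)
    (S : Fin m → A) : C.laxApply X f S = C.D f + f₀ * f + ∑ j, X.Φ j.rev * S j := by
  unfold laxApply
  have h : C.applyPlus X.L f = act (plus (C.laxForm f₀ X.Φ X.Ψ)) f := by
    rw [hL]; exact applyPlus_eq (C.laxForm f₀ X.Φ X.Ψ) f
  rw [h, plus_laxForm, act_add, act_dop, act_const]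

theorem IsSKP.dt_Φ {p : Fin m → ZMod 2} {X : SKPData A m} (hX : C.IsSKP p X) {L : C.Op}
    (hL : X.L = L) (k : ℕ+) (j : Fin m) :
    C.dt k (X.Φ j) = act (plus (L ^ (2 * k : ℕ))) (X.Φ j) := by
  have h := hX.flow_Φ k j
  rw [hL, pow_eq] at h
  rw [h]; exact applyPlus_eq (L ^ (2 * k : ℕ)) _

theorem IsSKP.dtOp_L {p : Fin m → ZMod 2} {X : SKPData A m} (hX : C.IsSKP p X) {L : C.Op}
    (hL : X.L = L) (k : ℕ+) :
    dtOp k L = plus (L ^ (2 * k : ℕ)) * L - L * plus (L ^ (2 * k : ℕ)) := by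
  have h := hX.lax k
  rw [hL, pow_eq] at h
  exact h

theorem IsSKP.homOp {p : Fin m → ZMod 2} {X : SKPData A m} (hX : C.IsSKP p X) {L : C.Op}
    (hL : X.L = L) : HomOp 1 L := by
  obtain ⟨f₀, hf, h⟩ := hX.exists_laxForm
  have h1 : L = C.laxForm f₀ X.Φ X.Ψ := hL.symm.trans h
  rw [h1]
  exact homOp_laxForm hf hX.Φ_mem hX.Ψ_mem

variable [SuperCommutative 𝒜]

/-- The adjoint flow in remainder form, suited to conjugation by T. -/
theorem IsSKP.exists_Ψ {p : Fin m → ZMod 2} {X : SKPData A m} (hX : C.IsSKP p X) {L : C.Op}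
    (hL : X.L = L) (k : ℕ+) (j : Fin m) : ∃ F, IsDiff F ∧
      C.const (X.Ψ j) * plus (L ^ (2 * k : ℕ)) = C.const (-C.dt k (X.Ψ j)) + C.dop * F := by
  obtain ⟨F, hF, h⟩ := exists_const_mul_plus ((hX.homOp hL).pow_two_mul k) (X.Ψ j)
  refine ⟨F, hF, ?_⟩
  have h1 := hX.flow_Ψ k j
  rw [hL, pow_eq] at h1
  rw [h1, neg_neg, h]

theorem IsDBStep.evenInv {p : Fin m → ZMod 2} {X Y : SKPData A m} {a : Fin m}
    (hX : C.IsSKP p X) (h : C.IsDBStep a X Y) : EvenInv 𝒜 (X.Φ a) (Ring.inverse (X.Φ a)) :=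
  .of_isUnit (mem_zero_of_isUnit (hX.Φ_mem a) h.1) h.1

theorem IsDBStep.exists_isStep {p : Fin m → ZMod 2} {X Y : SKPData A m} {a : Fin m}
    (hX : C.IsSKP p X) (h : C.IsDBStep a X Y) {f₀ : A} (hf : f₀ ∈ 𝒜 1)
    (hL : X.L = C.laxForm f₀ X.Φ X.Ψ) :
    ∃ S : Fin m → A, (∀ j, C.IsPotential X.L (X.Ψ j) (X.Φ a) (S j)) ∧
      EvenInv.IsStep (h.evenInv hX) C a X.Φ X.Ψ S f₀ Y.Φ Y.Ψ := by
  obtain ⟨-, -, S, hS, hΦ, hΦ', hΨ, hΨ'⟩ := h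
  refine ⟨S, hS, rfl, hf, fun j => (hS j).D_eq, ?_, fun i hi => ?_, hΨ, hΨ'⟩
  · rw [hΦ, act_gauge, ← laxApply_eq hL]; rfl
  · rw [hΦ' i hi, act_gauge]; rfl

theorem IsDBStep.L_eq {X Y : SKPData A m} {a : Fin m} (h : C.IsDBStep a X Y) {L : C.Op}
    (hL : X.L = L) : Y.L = C.gauge (X.Φ a) (Ring.inverse (X.Φ a)) * L *
      C.gaugeInv (X.Φ a) (Ring.inverse (X.Φ a)) := by
  have h1 := h.2.1
  rw [dbOp_eq, dbOpInv_eq, hL] at h1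
  exact h1

/-- A DB step maps solutions to solutions. -/
theorem IsSKP.dbStep {p : Fin m → ZMod 2} {X Y : SKPData A m} {a : Fin m}
    (hX : C.IsSKP p X) (hXY : C.IsDBStep a X Y) :
    C.IsSKP (fun j => if j = a then 0 else p j + 1) Y := by
  obtain ⟨f₀, hf, hL⟩ := hX.exists_laxForm
  obtain ⟨S, hS, H⟩ := hXY.exists_isStep hX hf hL
  have h := hXY.evenInv hX
  set χ := X.Φ a with hχ_def
  set χi := Ring.inverse χ
  set L := C.laxForm f₀ X.Φ X.Ψ with hL_def
  have hL' : Y.L = C.laxForm (-f₀ - 2 * (χi * C.D χ)) Y.Φ Y.Ψ := by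
    rw [hXY.L_eq hL]; exact h.conj_laxForm H
  have hLc : C.gauge χ χi * L * C.gaugeInv χ χi = C.laxForm (-f₀ - 2 * (χi * C.D χ)) Y.Φ Y.Ψ :=
    h.conj_laxForm H
  set L' := C.laxForm (-f₀ - 2 * (χi * C.D χ)) Y.Φ Y.Ψ with hL'_def
  have hf' : -f₀ - 2 * (χi * C.D χ) ∈ 𝒜 1 := by
    rw [two_mul]
    exact sub_mem (neg_mem hf) (add_mem h.logD_mem h.logD_mem)
  have hSmem : ∀ j, S j ∈ 𝒜 (p j.rev + 1) := fun j => by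
    simpa using (hS j).mem _ _ (hX.Ψ_mem j) h.mem
  -- T is odd and flips parities. In the slot of χ the superfield L(χ) is odd, so its image under T
  -- is even again.
  have hΦmem : ∀ j, Y.Φ j ∈ 𝒜 (if j = a then 0 else p j + 1) := by
    intro j
    split_ifs with hj
    · rw [hj, H.Φ_self]
      have h1 : C.D χ + f₀ * χ + ∑ j, X.Φ j.rev * S j ∈ 𝒜 1 := by
        refine add_mem (add_mem h.D_mem_one (mul_mem_graded' hf h.mem (by decide)))
          (sum_mem fun j _ => mul_mem_graded' (hX.Φ_mem _) (hSmem j) ?_)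
        rw [← add_assoc, zmod_two_add_self, zero_add]
      exact h.homOp_gauge.act_mem h1
    · rw [H.Φ_ne j hj, add_comm]
      exact h.homOp_gauge.act_mem (hX.Φ_mem j)
  have hΨmem : ∀ j, Y.Ψ j ∈ 𝒜 (if j.rev = a then 0 else p j.rev + 1) := by
    intro j
    by_cases hj : j = a.rev
    · rw [hj, Fin.rev_rev, if_pos rfl, H.Ψ_self]; exact h.inv_mem
    · rw [if_neg (fun h' => hj (by rw [← h', Fin.rev_rev])), H.Ψ_ne j hj]
      exact neg_mem (mul_mem_graded' h.inv_mem (parity_mem (hSmem j)) (zero_add _))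
  have hχ : ∀ k, C.dt k χ = act (plus (L ^ (2 * k : ℕ))) χ := fun k => hX.dt_Φ hL k a
  have hpow : ∀ k : ℕ, L' ^ k = C.gauge χ χi * L ^ k * C.gaugeInv χ χi := fun k => by
    rw [← hLc, h.conj_pow]
  have hB : ∀ k : ℕ+, plus (L' ^ (2 * k : ℕ)) =
      C.gauge χ χi * plus (L ^ (2 * k : ℕ)) * C.gaugeInv χ χi +
        dtOp k (C.gauge χ χi) * C.gaugeInv χ χi := fun k => by
    rw [hpow]; exact h.plus_conj (hχ k)
  refine ⟨hΦmem, hΨmem, ⟨_, hf', hL'.trans (laxForm_eq _ Y.Φ Y.Ψ)⟩, fun k => ?_, fun k j => ?_,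
    fun k j => ?_⟩
  · rw [hL', pow_eq]
    have := h.dtOp_conj (hB k) (hX.dtOp_L hL k)
    rw [hLc] at this
    exact this
  · rw [hL', pow_eq]
    refine Eq.trans ?_ (applyPlus_eq (L' ^ (2 * k : ℕ)) _).symm
    by_cases hj : j = a
    · rw [hj, H.Φ_self]
      refine h.dt_act_gauge (isDiff_plus _) (isDiff_plus _) (hB k) ?_
      have h1 : C.D χ + f₀ * χ = act L χ := by
        rw [← act_plus, hL_def, plus_laxForm, act_add, act_dop, act_const]
      rw [h1]
      exact dt_laxApply (isDiff_plus _) (hX.dtOp_L hL k) (hX.dt_Φ hL k) (hχ k) H.hs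
        fun j => (hL ▸ hS j).dt_eq_act k
    · rw [H.Φ_ne j hj]
      exact h.dt_act_gauge (isDiff_plus _) (isDiff_plus _) (hB k) (hX.dt_Φ hL k j)
  · rw [hL', pow_eq]
    have hP : HomOp 0 (L' ^ (2 * k : ℕ)) :=
      (homOp_laxForm (p := fun j => if j = a then 0 else p j + 1) hf' hΦmem hΨmem).pow_two_mul k
    have key : ∃ E, IsDiff E ∧ C.const (Y.Ψ j) * plus (L' ^ (2 * k : ℕ)) =
        C.const (-C.dt k (Y.Ψ j)) + C.dop * E := by
      by_cases hj : j = a.rev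
      -- χ⁻¹ is the degenerate transformed adjoint eigenfunction: ψ = 0 with the constant
      -- antiderivative S = 1.
      · have h1 := h.exists_parity_mul_inv (ψ := 0) (S := 1) (F := 0) (isDiff_plus _) (hB k) (hχ k)
          isDiff_zero (by simp) (by simp)
          (by rw [map_zero, zero_mul, mul_zero, ← map_zero C.const, act_const, zero_mul, dt_unit])
        rw [hj, H.Ψ_self]
        simpa using h1
      · obtain ⟨F, hF, hF'⟩ := hX.exists_Ψ hL k j
        obtain ⟨E, hE, h1⟩ := h.exists_parity_mul_inv (isDiff_plus _) (hB k) (hχ k) hF hF' (H.hs j)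
          ((hL ▸ hS j).dt_eq_act k)
        refine ⟨-E, hE.neg, ?_⟩
        rw [H.Ψ_ne j hj, comm_of_even h.inv_mem, map_neg, neg_mul, h1]
        simp only [map_neg, mul_neg]
        abel
    obtain ⟨E, hE, h1⟩ := key
    -- The same product now has two left divisions by 𝒟; equality of the remainders is the adjoint
    -- flow.
    obtain ⟨E', hE', h2⟩ := exists_const_mul_plus hP (Y.Ψ j)
    rw [h1] at h2
    rw [← eq_of_const_eq_add_dop_mul hE hE' h2, neg_neg]

/-- The super-tau function after a DB step. -/
theorem IsSuperTau.dbStep {p : Fin m → ZMod 2} {X Y : SKPData A m} {a : Fin m} {τ : A}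
    (hX : C.IsSKP p X) (hXY : C.IsDBStep a X Y) (hτ : C.IsSuperTau X.L τ) :
    C.IsSuperTau Y.L (X.Φ a * Ring.inverse τ) := by
  obtain ⟨f₀, hf, hL⟩ := hX.exists_laxForm
  have h := hXY.evenInv hX
  have hYL := hXY.L_eq hL
  set χ := X.Φ a
  set χi := Ring.inverse χ
  set L := C.laxForm f₀ X.Φ X.Ψ
  have ht : EvenInv 𝒜 τ (Ring.inverse τ) := .of_isUnit hτ.even hτ.unit
  set τi := Ring.inverse τ
  have hinv : Ring.inverse (χ * τi) = τ * χi := by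
    rw [Ring.inverse_mul (Or.inl hXY.1), Ring.inverse_inverse hτ.unit]
  refine ⟨mul_mem_graded' h.mem ht.inv_mem (by decide), ?_, fun k => ?_⟩
  · exact hXY.1.mul hτ.unit.ringInverse
  · have hχ : C.dt k χ = act (plus (L ^ (2 * k : ℕ))) χ := hX.dt_Φ hL k a
    have hres := hτ.res_eq k
    have hres' : coeff (-1) (L ^ (2 * k : ℕ)) = C.dt k (τi * C.D τ) := by
      rw [← hres, hL, pow_eq]; rfl
    -- D_θ ln(χ/τ) = D_θ ln χ - D_θ ln τ, which matches the two terms of `coeff_conj`.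
    have h1 : Ring.inverse (χ * τi) * C.D (χ * τi) = χi * C.D χ - τi * C.D τ := by
      rw [hinv, D_mul, parity_of_mem_zero h.mem, ht.D_inv, mul_add]
      have h2 : τ * χi * (C.D χ * τi) = χi * C.D χ := by
        rw [mul_assoc, ← mul_assoc χi, comm_of_even ht.mem, mul_assoc, ht.inv_mul, mul_one]
      have h3 : τ * χi * (χ * -(τi * C.D τ * τi)) = -(τi * C.D τ) := by
        rw [mul_assoc, h.inv_mul_cancel_left, mul_neg, comm_of_even ht.mem, mul_assoc, ht.inv_mul,
          mul_one]
      rw [h2, h3, sub_eq_add_neg]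
    rw [h1, map_sub, ← hres', h.dt_logD, hYL, pow_eq, h.conj_pow]
    exact h.coeff_conj ((hX.homOp hL).pow_two_mul k) hχ

end SuperCalculus

/-! ### Iterated DB operators and the seed superfields. -/

namespace SuperCalculus

variable {A : Type*} [Ring A] [Algebra ℚ A] {𝒜 : ZMod 2 → Submodule ℚ A} [GradedAlgebra 𝒜]
  {C : SuperCalculus 𝒜} {m : ℕ}

theorem dbApply_zero (χ : A) : C.dbApply χ 0 = 0 := by simp [dbApply]

theorem dbApply_add (χ f g : A) : C.dbApply χ (f + g) = C.dbApply χ f + C.dbApply χ g := by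
  simp [dbApply, mul_add]

theorem dbApply_neg (χ f : A) : C.dbApply χ (-f) = -C.dbApply χ f := by
  simp [dbApply]

theorem dbApply_sub (χ f g : A) : C.dbApply χ (f - g) = C.dbApply χ f - C.dbApply χ g := by
  simp [dbApply, mul_sub]

/-- Constants are kept on the right so that D_θ passes them without a sign, whatever their parity.
-/
theorem dbApply_mul_of_D_eq_zero (χ f : A) {c : A} (hc : C.D c = 0) :
    C.dbApply χ (f * c) = C.dbApply χ f * c := by
  unfold dbApply
  rw [← mul_assoc, D_mul, hc, mul_zero, add_zero, mul_assoc]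

theorem dbApply_self {χ : A} (h : IsUnit χ) : C.dbApply χ χ = 0 := by
  rw [dbApply, Ring.inverse_mul_cancel χ h, D_one, mul_zero]

/-- The span of `g 0, …, g (n - 1)` over the constants, acting from the right. -/
def constSpan (C : SuperCalculus 𝒜) (g : ℕ → A) (n : ℕ) : AddSubgroup A :=
  AddSubgroup.closure {y | ∃ i < n, ∃ c, C.D c = 0 ∧ y = g i * c}

theorem mem_constSpan {g : ℕ → A} {n i : ℕ} (hi : i < n) : g i ∈ C.constSpan g n :=
  AddSubgroup.subset_closure ⟨i, hi, 1, D_one C, by simp⟩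

theorem constSpan_mono (g : ℕ → A) {n n' : ℕ} (h : n ≤ n') : C.constSpan g n ≤ C.constSpan g n' :=
  AddSubgroup.closure_mono fun _ ⟨i, hi, c, hc, hy⟩ => ⟨i, hi.trans_le h, c, hc, hy⟩

theorem mul_mem_constSpan {g : ℕ → A} {n : ℕ} {y c : A} (hy : y ∈ C.constSpan g n)
    (hc : C.D c = 0) : y * c ∈ C.constSpan g n := by
  induction hy using AddSubgroup.closure_induction with
  | mem y hy =>
    obtain ⟨i, hi, c', hc', rfl⟩ := hy
    refine AddSubgroup.subset_closure ⟨i, hi, c' * c, ?_, mul_assoc _ _ _⟩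
    rw [D_mul, hc', hc, zero_mul, mul_zero, add_zero]
  | zero => rw [zero_mul]; exact zero_mem _
  | add x y _ _ hx hy => rw [add_mul]; exact add_mem hx hy
  | neg x _ hx => rw [neg_mul]; exact neg_mem hx

theorem dbApply_mem_constSpan (χ : A) {g : ℕ → A} {n : ℕ} {y : A} (hy : y ∈ C.constSpan g n) :
    C.dbApply χ y ∈ C.constSpan (fun i => C.dbApply χ (g i)) n := by
  induction hy using AddSubgroup.closure_induction with
  | mem y hy =>
    obtain ⟨i, hi, c, hc, rfl⟩ := hy
    exact AddSubgroup.subset_closure ⟨i, hi, c, hc, dbApply_mul_of_D_eq_zero _ _ hc⟩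
  | zero => rw [dbApply_zero]; exact zero_mem _
  | add x y _ _ hx hy => rw [dbApply_add]; exact add_mem hx hy
  | neg x _ hx => rw [dbApply_neg]; exact neg_mem hx

theorem constSpan_eq_zero {g : ℕ → A} {n : ℕ} (hg : ∀ i < n, g i = 0) {y : A}
    (hy : y ∈ C.constSpan g n) : y = 0 := by
  induction hy using AddSubgroup.closure_induction with
  | mem y hy =>
    obtain ⟨i, hi, c, -, rfl⟩ := hy
    rw [hg i hi, zero_mul]
  | zero => rfl
  | add x y _ _ hx hy => rw [hx, hy, add_zero]
  | neg x _ hx => rw [hx, neg_zero]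

variable [NeZero m]

/-- The composition of the first `N` DB operators. -/
noncomputable def dbIter (C : SuperCalculus 𝒜) (X : ℕ → SKPData A m) : ℕ → A → A
  | 0, f => f
  | N + 1, f => C.dbApply ((X N).Φ (Fin.ofNat m N)) (dbIter C X N f)

variable [SuperCommutative 𝒜]

theorem IsDBStep.exists_laxApply {p : Fin m → ZMod 2} {X Y : SKPData A m} {a : Fin m}
    (hX : C.IsSKP p X) (h : C.IsDBStep a X Y) {f : A} {S : Fin m → A}
    (hS : ∀ j, C.D (S j) = X.Ψ j * f) :
    ∃ S' : Fin m → A, (∀ j, C.D (S' j) = Y.Ψ j * C.dbApply (X.Φ a) f) ∧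
      C.laxApply Y (C.dbApply (X.Φ a) f) S' = C.dbApply (X.Φ a) (C.laxApply X f S) := by
  obtain ⟨f₀, hf, hL⟩ := hX.exists_laxForm
  obtain ⟨s, -, H⟩ := h.exists_isStep hX hf hL
  have hY : Y.L = C.laxForm (-f₀ - 2 * (Ring.inverse (X.Φ a) * C.D (X.Φ a))) Y.Φ Y.Ψ := by
    rw [h.L_eq hL]; exact (h.evenInv hX).conj_laxForm H
  obtain ⟨S', hS', h'⟩ := (h.evenInv hX).act_gauge_laxApply H hS
  rw [act_gauge, act_gauge] at h'
  refine ⟨S', fun j => by rw [hS', act_gauge]; rfl, ?_⟩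
  rw [laxApply_eq hL, laxApply_eq hY]
  exact h'

/-- Only some antiderivatives are produced, and only their D_θ-equation is recorded. Any other
choice differs by D_θ-constants, which is all that the comparison with the orbit requires. -/
theorem exists_laxApply_dbIter {M : ℕ} {X : ℕ → SKPData A m} (hX : C.IsDBOrbit M X)
    (hS : ∀ N ≤ M, ∃ p : Fin m → ZMod 2, C.IsSKP p (X N)) {f : A} {S : Fin m → A}
    (hfS : ∀ j, C.D (S j) = (X 0).Ψ j * f) {N : ℕ} (hN : N ≤ M) :
    ∃ S' : Fin m → A, (∀ j, C.D (S' j) = (X N).Ψ j * C.dbIter X N f) ∧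
      C.laxApply (X N) (C.dbIter X N f) S' = C.dbIter X N (C.laxApply (X 0) f S) := by
  induction N with
  | zero => exact ⟨S, hfS, rfl⟩
  | succ N ih =>
    obtain ⟨S', hS', h'⟩ := ih (by omega)
    obtain ⟨p, hp⟩ := hS N (by omega)
    obtain ⟨S'', hS'', h''⟩ := (hX N (by omega)).exists_laxApply hp hS'
    exact ⟨S'', hS'', by rw [h'] at h''; exact h''⟩

/-- The indices N, …, N + m - 1 represent every slot once around the cycle, so statements about all
slots can be phrased through seed indices. -/
theorem exists_ofNat_eq (N : ℕ) (b : Fin m) : ∃ n, N ≤ n ∧ n < N + m ∧ Fin.ofNat m n = b := by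
  have hm : 0 < m := Nat.pos_of_ne_zero (NeZero.ne m)
  have h1 : N % m < m := Nat.mod_lt _ hm
  refine ⟨N + (b + (m - N % m)) % m, by omega, ?_, ?_⟩
  · have := Nat.mod_lt (b + (m - N % m)) hm
    omega
  · ext
    simp only [Fin.ofNat]
    rw [Nat.add_mod_mod, Nat.add_comm, Nat.add_assoc, ← Nat.add_mod_mod]
    have h2 : (m - N % m + N) % m = 0 := by
      have h3 : m - N % m + N = m * (N / m + 1) := by
        have := Nat.div_add_mod N m
        rw [mul_add, mul_one]
        omega
      rw [h3, Nat.mul_mod_right]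
    rw [h2, add_zero, Nat.mod_eq_of_lt b.2]

theorem ofNat_ne {N n : ℕ} (h1 : N < n) (h2 : n < N + m) : Fin.ofNat m n ≠ Fin.ofNat m N := by
  intro h
  have h3 : n % m = N % m := congrArg Fin.val h
  have h4 := (Nat.modEq_iff_dvd' h1.le).1 h3.symm
  have := Nat.le_of_dvd (by omega) h4
  omega

/-- The first `N` DB operators annihilate `φ 0, …, φ (N - 1)`, and the `N`-th super-eigenfunctions
are the images of the `φ n`, up to combinations of the earlier ones. -/
theorem dbIter_seed {M : ℕ} {X : ℕ → SKPData A m} (hX : C.IsDBOrbit M X)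
    (hS : ∀ N ≤ M, ∃ p : Fin m → ZMod 2, C.IsSKP p (X N)) {φ : ℕ → A} (hφ : C.IsSeed M (X 0) φ)
    {N : ℕ} (hN : N ≤ M) : (∀ i < N, C.dbIter X N (φ i) = 0) ∧
      ∀ n, N ≤ n → n < N + m → (n < M ∨ n < m) →
        (X N).Φ (Fin.ofNat m n) - C.dbIter X N (φ n) ∈
          C.constSpan (fun i => C.dbIter X N (φ i)) n := by
  induction N with
  | zero =>
    refine ⟨fun i hi => by omega, fun n _ hn _ => ?_⟩
    have h1 : φ n = (X 0).Φ (Fin.ofNat m n) := by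
      rw [← hφ.1]
      congr 1
      exact (Nat.mod_eq_of_lt (by omega)).symm
    change _ - φ n ∈ _
    rw [h1, sub_self]; exact zero_mem _
  | succ N ih =>
    obtain ⟨h0, hrec⟩ := ih (by omega)
    have hm : 0 < m := Nat.pos_of_ne_zero (NeZero.ne m)
    -- At n = N the correction lies in a span whose generators have all been annihilated.
    have hχ : (X N).Φ (Fin.ofNat m N) = C.dbIter X N (φ N) :=
      sub_eq_zero.1 (constSpan_eq_zero h0 (hrec N le_rfl (by omega) (Or.inl (by omega))))
    have hstep := hX N (by omega)
    have hself : C.dbApply ((X N).Φ (Fin.ofNat m N)) ((X N).Φ (Fin.ofNat m N)) = 0 :=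
      dbApply_self hstep.1
    obtain ⟨-, -, S, hpot, hΦ, hΦ', -⟩ := hstep
    set χ := (X N).Φ (Fin.ofNat m N) with hχ_def
    have hT : ∀ f, C.dbIter X (N + 1) f = C.dbApply χ (C.dbIter X N f) := fun f => rfl
    have hlt : ∀ n, N < n → n < N + m → (n < M ∨ n < m) →
        C.dbApply χ ((X N).Φ (Fin.ofNat m n)) - C.dbIter X (N + 1) (φ n) ∈
          C.constSpan (fun i => C.dbIter X (N + 1) (φ i)) n := by
      intro n hn1 hn2 hn3
      rw [hT, ← dbApply_sub]
      exact dbApply_mem_constSpan χ (hrec n hn1.le hn2 hn3)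
    refine ⟨fun i hi => ?_, fun n hn1 hn2 hn3 => ?_⟩
    · rw [hT]
      rcases Nat.lt_succ_iff_lt_or_eq.1 hi with h | rfl
      · rw [h0 i h, dbApply_zero]
      · rw [← hχ, hself]
    · by_cases hn : n < N + m
      · rw [hΦ' _ (ofNat_ne (by omega) hn)]
        exact hlt n (by omega) hn hn3
      -- The index has gone once around the cycle: the slot just used receives T(L(χ)), to be
      -- compared with the next seed φ_{(N+m)/2}.
      · obtain rfl : n = N + m := by omega
        have hM : N + m < M := by omega
        have ha : Fin.ofNat m (N + m) = Fin.ofNat m N := by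
          ext; simp [Fin.ofNat]
        obtain ⟨S₀, hS₀, hφ'⟩ := hφ.2 N hM
        obtain ⟨S', hS', hl⟩ := exists_laxApply_dbIter hX hS (fun j => (hS₀ j).D_eq) (N := N)
          (by omega)
        rw [← hφ', ← hχ] at hl
        -- The antiderivatives used in the step and those transported from the seed differ by
        -- D_θ-constants S - S'.
        have hdiff : C.laxApply (X N) χ S =
            C.dbIter X N (φ (N + m)) + ∑ j, (X N).Φ j.rev * (S j - S' j) := by
          rw [← hl]
          unfold laxApply
          simp only [mul_sub, Finset.sum_sub_distrib]
          abel
        rw [ha, hΦ, hdiff, dbApply_add, hT, add_sub_cancel_left]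
        have hsum : C.dbApply χ (∑ j, (X N).Φ j.rev * (S j - S' j)) =
            ∑ j, C.dbApply χ ((X N).Φ j.rev) * (S j - S' j) := by
          have hD : ∀ j, C.D (S j - S' j) = 0 := fun j => by
            rw [map_sub, (hpot j).D_eq, hS', ← hχ, sub_self]
          simp only [← dbApply_mul_of_D_eq_zero χ _ (hD _)]
          simp only [dbApply, Finset.mul_sum, map_sum]
        rw [hsum]
        refine sum_mem fun j _ => mul_mem_constSpan ?_ ?_
        -- Each slot corresponds to some n in the window: n = N gives χ, which T kills, and for n >
        -- N the image is that of φ_{n/2} up to earlier ones. The bound n < N + m < M makes the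
        -- induction hypothesis applicable.
        · obtain ⟨n, h1, h2, h3⟩ := exists_ofNat_eq N j.rev
          rw [← h3]
          rcases h1.eq_or_lt with rfl | h1
          · rw [hself]; exact zero_mem _
          · have h4 := constSpan_mono _ h2.le (hlt n h1 h2 (Or.inl (by omega)))
            exact (add_mem_cancel_right (neg_mem (mem_constSpan h2))).1
              (by rw [← sub_eq_add_neg]; exact h4)
        · rw [map_sub, (hpot j).D_eq, hS', ← hχ, sub_self]

theorem dbIter_seed_self {M : ℕ} {X : ℕ → SKPData A m} (hX : C.IsDBOrbit M X)
    (hS : ∀ N ≤ M, ∃ p : Fin m → ZMod 2, C.IsSKP p (X N)) {φ : ℕ → A} (hφ : C.IsSeed M (X 0) φ)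
    {N : ℕ} (hN : N < M) : C.dbIter X N (φ N) = (X N).Φ (Fin.ofNat m N) := by
  obtain ⟨h0, hrec⟩ := dbIter_seed hX hS hφ hN.le
  have hm : 0 < m := Nat.pos_of_ne_zero (NeZero.ne m)
  exact (sub_eq_zero.1 (constSpan_eq_zero h0 (hrec N le_rfl (by omega) (Or.inl hN)))).symm

/-- The composition of the first `N` DB operators is a monic differential operator. -/
theorem exists_dbIter_eq {M : ℕ} {X : ℕ → SKPData A m} (hX : C.IsDBOrbit M X)
    (hS : ∀ N ≤ M, ∃ p : Fin m → ZMod 2, C.IsSKP p (X N)) {N : ℕ} (hN : N ≤ M) :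
    ∃ w : ℕ → A, (∀ j : ℕ, w j ∈ 𝒜 (N + j)) ∧ w N = 1 ∧ (∀ j, N < j → w j = 0) ∧
      ∀ f, C.dbIter X N f = ∑ j ∈ Finset.range (N + 1), w j * (C.D ^ j) f := by
  induction N with
  | zero =>
    refine ⟨fun j => if j = 0 then 1 else 0, fun j => ?_, if_pos rfl, fun j hj => if_neg (by omega),
      fun f => by simp [dbIter]⟩
    dsimp only
    split_ifs with hj
    · rw [hj]; simpa using one_mem_graded
    · exact zero_mem _
  | succ N ih =>
    obtain ⟨w, hw, hw1, hw0, h⟩ := ih (by omega)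
    obtain ⟨p, hp⟩ := hS N (by omega)
    have hE := (hX N (by omega)).evenInv hp
    set χ := (X N).Φ (Fin.ofNat m N) with hχ
    set g := Ring.inverse χ * C.D χ with hg
    have hgm : g ∈ 𝒜 1 := hE.logD_mem
    have hshift : ∀ j : ℕ, ((N + 1 : ℕ) : ZMod 2) + j = N + j + 1 := fun j => by push_cast; ring
    -- These are the coefficients of (𝒟 - g) ∑ w_j 𝒟^j, with g = D_θ ln χ.
    refine ⟨fun j => C.D (w j) - g * w j + (if j = 0 then 0 else parity 𝒜 (w (j - 1))), ?_, ?_, ?_,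
      ?_⟩
    · intro j
      rw [hshift]
      refine add_mem (sub_mem (C.D_mem (hw j)) ?_) ?_
      · rw [add_comm _ (1 : ZMod 2)]; exact mul_mem_graded hgm (hw j)
      · split_ifs with hj
        · exact zero_mem _
        · have := parity_mem (hw (j - 1))
          convert this using 2
          obtain ⟨i, rfl⟩ := Nat.exists_eq_succ_of_ne_zero hj
          rw [Nat.succ_sub_one, Nat.cast_succ, add_assoc, add_assoc, zmod_two_add_self, add_zero]
    · simp [hw0 (N + 1) (by omega), hw1]
    · intro j hj
      have : ¬ j = 0 := by omega
      simp [hw0 j (by omega), hw0 (j - 1) (by omega)]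
    · intro f
      change C.dbApply χ _ = _
      rw [dbApply, ← act_gauge, hE.act_gauge_eq, h, ← hg, map_sum, Finset.mul_sum]
      simp only [add_mul, sub_mul, Finset.sum_add_distrib, Finset.sum_sub_distrib]
      rw [Finset.sum_range_succ (fun j => C.D (w j) * (C.D ^ j) f) (N + 1),
        Finset.sum_range_succ (fun j => g * w j * (C.D ^ j) f) (N + 1),
        Finset.sum_range_succ' (fun j => (if j = 0 then 0 else parity 𝒜 (w (j - 1))) *
          (C.D ^ j) f) (N + 1), hw0 (N + 1) (by omega)]
      have h1 : ∀ j : ℕ, C.D (w j * (C.D ^ j) f) = C.D (w j) * (C.D ^ j) f +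
          parity 𝒜 (w j) * (C.D ^ (j + 1)) f := fun j => by
        rw [D_mul, pow_succ', Module.End.mul_apply]
      simp only [h1, Finset.sum_add_distrib, mul_assoc]
      simp
      abel

end SuperCalculus

/-! ### Bordered determinants -/

section Bordered

open Matrix

variable {R : Type*} [CommRing R]

/-- The determinant of a bordered matrix, in which a combination of the rows is `(0, …, 0, x)`. -/
theorem det_of_last_row {n : ℕ} (M : Matrix (Fin (n + 1)) (Fin (n + 1)) R) (c : Fin n → R) (x : R)
    (h : ∀ j : Fin n, M (Fin.last n) j.castSucc + ∑ i, c i * M i.castSucc j.castSucc = 0)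
    (hx : M (Fin.last n) (Fin.last n) + ∑ i, c i * M i.castSucc (Fin.last n) = x) :
    M.det = x * (M.submatrix Fin.castSucc Fin.castSucc).det := by
  set r : Fin (n + 1) → R := fun j => if j = Fin.last n then x else 0
  have h1 : M (Fin.last n) + ∑ i : Fin n, c i • M i.castSucc = r := by
    funext j
    simp only [Pi.add_apply, Finset.sum_apply, Pi.smul_apply, smul_eq_mul, r]
    refine Fin.lastCases ?_ (fun j => ?_) j
    · rw [if_pos rfl, hx]
    · rw [if_neg (Fin.castSucc_lt_last j).ne, h]
  have h2 : M.det = (M.updateRow (Fin.last n) r).det := by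
    have key : ∀ s : Finset (Fin n),
        (M.updateRow (Fin.last n) (M (Fin.last n) + ∑ i ∈ s, c i • M i.castSucc)).det = M.det := by
      intro s
      induction s using Finset.induction_on with
      | empty => simp
      | insert i s hi ih =>
        rw [Finset.sum_insert hi, add_left_comm, det_updateRow_add, det_updateRow_smul, ih,
          det_zero_of_row_eq (i := i.castSucc) (j := Fin.last n) (Fin.castSucc_lt_last i).ne]
        · simp
        · rw [updateRow_self, updateRow_ne (Fin.castSucc_lt_last i).ne]
    rw [← key Finset.univ, h1]
  rw [h2, det_succ_row _ (Fin.last n), Finset.sum_eq_single_of_mem (Fin.last n) (Finset.mem_univ _)]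
  · rw [updateRow_self]
    have h3 : (-1 : R) ^ ((Fin.last n : ℕ) + (Fin.last n : ℕ)) = 1 := Even.neg_one_pow ⟨_, rfl⟩
    rw [h3, one_mul]
    congr 1
    · simp [r]
    · congr 1
      ext i j
      rw [submatrix_apply, submatrix_apply, Fin.succAbove_last,
        updateRow_ne (Fin.castSucc_lt_last i).ne]
  · intro j _ hj
    rw [updateRow_self]
    simp [r, hj]

/-- The determinant of `1 + G`, where `G` behaves as the product of an odd column and an odd row. -/
theorem det_one_add_mul_one_sub_trace {n : ℕ} (G : Matrix (Fin n) (Fin n) R)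
    (h : ∀ i j k l, G i j * G k l = -(G i l * G k j)) (hsq : ∀ i, G i i * G i i = 0) :
    (1 + G).det * (1 - G.trace) = 1 := by
  induction n with
  | zero => simp [Matrix.trace]
  | succ n ih =>
    set G' := G.submatrix Fin.castSucc Fin.castSucc with hG'
    have hd := ih G' (fun i j k l => h _ _ _ _) (fun i => hsq _)
    set d := (1 + G').det
    set t := G'.trace with ht
    set g := G (Fin.last n) (Fin.last n)
    have htr : G.trace = t + g := by
      rw [Matrix.trace, Fin.sum_univ_castSucc]; rfl
    have hsum : ∀ j, ∑ i : Fin n, G (Fin.last n) i.castSucc * G i.castSucc j =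
        -(t * G (Fin.last n) j) := by
      intro j
      rw [ht, Matrix.trace, Finset.sum_mul, ← Finset.sum_neg_distrib]
      refine Finset.sum_congr rfl fun i _ => ?_
      rw [h, mul_comm (G _ j)]; rfl
    have hsub : (1 + G).submatrix Fin.castSucc Fin.castSucc = 1 + G' := by
      ext i j
      simp [hG', Matrix.one_apply]
    -- The sign rule gives r G' = -t r for the last row r of G without its corner, so r(1 + G')⁻¹ =
    -- d r with d = (1 - t)⁻¹. Subtracting d r times the upper rows leaves the corner 1 + g + dtg =
    -- 1 + gd.
    have hdet := det_of_last_row (1 + G) (fun i => -(d * G (Fin.last n) i.castSucc)) (1 + g * d)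
      (fun j => ?_) ?_
    · rw [hdet, hsub, htr]
      linear_combination (1 + g * d + g * d) * hd - d ^ 2 * hsq (Fin.last n) - g * d * hd
    · have h1 : ∀ i : Fin n, -(d * G (Fin.last n) i.castSucc) * (1 + G) i.castSucc j.castSucc =
          -d * (if i = j then G (Fin.last n) i.castSucc else 0) +
            -d * (G (Fin.last n) i.castSucc * G i.castSucc j.castSucc) := by
        intro i
        rw [Matrix.add_apply, Matrix.one_apply]
        simp only [Fin.castSucc_inj]
        split_ifs <;> ring
      simp only [h1, Finset.sum_add_distrib, ← Finset.mul_sum, hsum, Finset.sum_ite_eq',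
        Finset.mem_univ, if_true]
      rw [Matrix.add_apply, Matrix.one_apply_ne (Fin.castSucc_lt_last j).ne']
      linear_combination -G (Fin.last n) j.castSucc * hd
    · have h1 : ∀ i : Fin n, -(d * G (Fin.last n) i.castSucc) * (1 + G) i.castSucc (Fin.last n) =
            -d * (G (Fin.last n) i.castSucc * G i.castSucc (Fin.last n)) := by
        intro i
        rw [Matrix.add_apply, Matrix.one_apply_ne (Fin.castSucc_lt_last i).ne]
        ring
      simp only [h1, ← Finset.mul_sum, hsum]
      rw [Matrix.add_apply, Matrix.one_apply_eq]
      linear_combination -g * hd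

end Bordered

/-! ### Matrices with bosonic entries -/

section EvenMatrix

open Matrix

variable {A : Type*} [Ring A] [Algebra ℚ A] {𝒜 : ZMod 2 → Submodule ℚ A} [GradedAlgebra 𝒜]

theorem coe_evenPart {a : A} (ha : a ∈ 𝒜 0) : (evenPart 𝒜 a : A) = a :=
  DirectSum.decompose_of_mem_same 𝒜 ha

variable [SuperCommutative 𝒜] {ι κ μ : Type*} [Fintype κ]

theorem evenPart_map_mul {M : Matrix ι κ A} {N : Matrix κ μ A} (hM : ∀ i j, M i j ∈ 𝒜 0)
    (hN : ∀ i j, N i j ∈ 𝒜 0) :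
    (M * N).map (evenPart 𝒜) = M.map (evenPart 𝒜) * N.map (evenPart 𝒜) := by
  ext i j
  have h1 : (M * N) i j ∈ 𝒜 0 :=
    sum_mem fun k _ => mul_mem_graded' (hM i k) (hN k j) (zero_add 0)
  rw [map_apply, coe_evenPart h1, mul_apply, mul_apply, AddSubmonoidClass.coe_finsetSum]
  refine Finset.sum_congr rfl fun k _ => ?_
  rw [Subring.coe_mul, map_apply, map_apply, coe_evenPart (hM i k), coe_evenPart (hN k j)]

theorem evenDet_mul {n : ℕ} {M N : Matrix (Fin n) (Fin n) A} (hM : ∀ i j, M i j ∈ 𝒜 0)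
    (hN : ∀ i j, N i j ∈ 𝒜 0) : evenDet 𝒜 (M * N) = evenDet 𝒜 M * evenDet 𝒜 N := by
  unfold evenDet
  rw [evenPart_map_mul hM hN, det_mul]

theorem evenInv_mem {n : ℕ} (S : Matrix (Fin n) (Fin n) A) (i j : Fin n) : evenInv 𝒜 S i j ∈ 𝒜 0 :=
  (((S.map (evenPart 𝒜))⁻¹) i j).2

theorem map_val_evenPart {n : ℕ} {S : Matrix (Fin n) (Fin n) A} (hS : ∀ i j, S i j ∈ 𝒜 0) :
    (S.map (evenPart 𝒜)).map (evenSubring 𝒜).subtype = S := by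
  ext i j; exact coe_evenPart (hS i j)

theorem evenInv_mul {n : ℕ} {S : Matrix (Fin n) (Fin n) A} (hS : ∀ i j, S i j ∈ 𝒜 0)
    (hu : IsUnit (evenDet 𝒜 S)) : evenInv 𝒜 S * S = 1 := by
  have h := congrArg (fun M => M.map (evenSubring 𝒜).subtype) (nonsing_inv_mul _ hu)
  simp only [Matrix.map_mul, map_val_evenPart hS] at h
  exact h.trans (Matrix.map_one _ (map_zero _) (map_one _))

theorem mul_evenInv {n : ℕ} {S : Matrix (Fin n) (Fin n) A} (hS : ∀ i j, S i j ∈ 𝒜 0)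
    (hu : IsUnit (evenDet 𝒜 S)) : S * evenInv 𝒜 S = 1 := by
  have h := congrArg (fun M => M.map (evenSubring 𝒜).subtype) (mul_nonsing_inv _ hu)
  simp only [Matrix.map_mul, map_val_evenPart hS] at h
  exact h.trans (Matrix.map_one _ (map_zero _) (map_one _))

theorem evenDet_of_last_row {n : ℕ} {M : Matrix (Fin (n + 1)) (Fin (n + 1)) A}
    (hM : ∀ i j, M i j ∈ 𝒜 0) {c : Fin n → A} (hc : ∀ i, c i ∈ 𝒜 0) {x : A} (hx : x ∈ 𝒜 0)
    (h : ∀ j : Fin n, M (Fin.last n) j.castSucc + ∑ i, c i * M i.castSucc j.castSucc = 0)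
    (h' : M (Fin.last n) (Fin.last n) + ∑ i, c i * M i.castSucc (Fin.last n) = x) :
    evenDet 𝒜 M = evenPart 𝒜 x * evenDet 𝒜 (M.submatrix Fin.castSucc Fin.castSucc) := by
  have key : ∀ j, (((M.map (evenPart 𝒜)) (Fin.last n) j + ∑ i : Fin n, evenPart 𝒜 (c i) *
      (M.map (evenPart 𝒜)) i.castSucc j : evenSubring 𝒜) : A) =
      M (Fin.last n) j + ∑ i, c i * M i.castSucc j := by
    intro j
    rw [Subring.coe_add, AddSubmonoidClass.coe_finsetSum, map_apply, coe_evenPart (hM _ _)]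
    congr 1
    refine Finset.sum_congr rfl fun i _ => ?_
    rw [Subring.coe_mul, map_apply, coe_evenPart (hc i), coe_evenPart (hM _ _)]
  refine det_of_last_row _ (fun i => evenPart 𝒜 (c i)) _ (fun j => ?_) ?_
  · exact Subtype.ext ((key _).trans (h j))
  · exact Subtype.ext ((key _).trans (h'.trans (coe_evenPart hx).symm))

/-- The odd counterpart of the matrix determinant lemma: anticommutation makes the trace of v wᵀ
equal to -w·v and turns the usual determinant into its inverse. -/
theorem evenDet_one_add_vecMulVec {n : ℕ} {v w : Fin n → A} (hv : ∀ i, v i ∈ 𝒜 1)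
    (hw : ∀ i, w i ∈ 𝒜 1) :
    (evenDet 𝒜 (1 + vecMulVec v w) : A) * (1 + w ⬝ᵥ v) = 1 := by
  have hG : ∀ i j, vecMulVec v w i j ∈ 𝒜 0 := fun i j =>
    mul_mem_graded' (hv i) (hw j) (by decide)
  set G := (vecMulVec v w).map (evenPart 𝒜) with hG_def
  have hGc : ∀ i j, (G i j : A) = v i * w j := fun i j => coe_evenPart (hG i j)
  have h1 : ∀ i j k l, G i j * G k l = -(G i l * G k j) := by
    intro i j k l
    apply Subtype.ext
    rw [Subring.coe_neg, Subring.coe_mul, Subring.coe_mul, hGc, hGc, hGc, hGc, mul_assoc,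
      ← comm_of_even (mul_mem_graded' (hv k) (hw l) (by decide : (1 : ZMod 2) + 1 = 0)) (w j),
      mul_assoc, mul_assoc, ← comm_of_even (mul_mem_graded' (hv k) (hw j)
        (by decide : (1 : ZMod 2) + 1 = 0)) (w l), mul_assoc,
      SuperCommutative.odd_anticomm (hw l) (hw j)]
    simp
  have h2 : ∀ i, G i i * G i i = 0 := by
    intro i
    apply Subtype.ext
    rw [Subring.coe_mul, hGc, Subring.coe_zero, mul_assoc, ← mul_assoc (w i),
      SuperCommutative.odd_anticomm (hw i) (hv i), neg_mul, mul_neg, ← mul_assoc, ← mul_assoc,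
      odd_mul_self (hv i)]
    simp
  have h3 := congrArg Subtype.val (det_one_add_mul_one_sub_trace G h1 h2)
  have h4 : evenDet 𝒜 (1 + vecMulVec v w) = (1 + G).det := by
    unfold evenDet
    congr 1
    ext i j
    have h5 : (1 + vecMulVec v w) i j ∈ 𝒜 0 := by
      rw [Matrix.add_apply, one_apply]
      refine add_mem ?_ (hG i j)
      split_ifs
      · exact one_mem_graded
      · exact zero_mem _
    rw [map_apply, coe_evenPart h5, Matrix.add_apply, Matrix.add_apply, Subring.coe_add, hGc, one_apply,
      one_apply, vecMulVec_apply]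
    split_ifs <;> rfl
  have h5 : ((1 - G.trace : evenSubring 𝒜) : A) = 1 + w ⬝ᵥ v := by
    rw [AddSubgroupClass.coe_sub, Subring.coe_one, sub_eq_add_neg, Matrix.trace,
      AddSubmonoidClass.coe_finsetSum, ← Finset.sum_neg_distrib]
    congr 1
    refine Finset.sum_congr rfl fun i _ => ?_
    rw [diag_apply, hGc, SuperCommutative.odd_anticomm (hw i) (hv i)]
  rw [h4, ← h5, ← Subring.coe_mul]
  exact h3

end EvenMatrix

/-! ### Growth of a Berezinian by one row and column. -/

section Berezinian

open Matrix

variable {A : Type*} [Ring A] [Algebra ℚ A] {𝒜 : ZMod 2 → Submodule ℚ A} [GradedAlgebra 𝒜]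
  [SuperCommutative 𝒜]

theorem evenDet_of_vecMul {n : ℕ} {M : Matrix (Fin (n + 1)) (Fin (n + 1)) A}
    (hM : ∀ i j, M i j ∈ 𝒜 0) {w : Fin (n + 1) → A} (hw : ∀ i, w i ∈ 𝒜 0) (hw1 : w (Fin.last n) = 1)
    {x : A} (hx : x ∈ 𝒜 0) (h : w ᵥ* M = Pi.single (Fin.last n) x) :
    evenDet 𝒜 M = evenPart 𝒜 x * evenDet 𝒜 (M.submatrix Fin.castSucc Fin.castSucc) := by
  have key : ∀ j, M (Fin.last n) j + ∑ i, w (Fin.castSucc i) * M i.castSucc j =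
      (w ᵥ* M) j := by
    intro j
    rw [vecMul, dotProduct, Fin.sum_univ_castSucc, hw1, one_mul, add_comm]
  refine evenDet_of_last_row (c := fun i => w i.castSucc) hM (fun i => hw _) hx (fun j => ?_) ?_
  · rw [key, h, Pi.single_eq_of_ne (Fin.castSucc_lt_last j).ne]
  · rw [key, h, Pi.single_eq_same]

theorem mul_mem_of_odd {ι κ μ : Type*} [Fintype κ] {M : Matrix ι κ A} {N : Matrix κ μ A}
    {p q : ZMod 2} (hM : ∀ i j, M i j ∈ 𝒜 p) (hN : ∀ i j, N i j ∈ 𝒜 q) (i : ι) (j : μ) :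
    (M * N) i j ∈ 𝒜 (p + q) :=
  sum_mem fun k _ => mul_mem_graded (hM i k) (hN k j)

theorem dotProduct_mem {κ : Type*} [Fintype κ] {v w : κ → A} {p q r : ZMod 2}
    (hv : ∀ i, v i ∈ 𝒜 p) (hw : ∀ i, w i ∈ 𝒜 q) (h : p + q = r) : v ⬝ᵥ w ∈ 𝒜 r :=
  sum_mem fun k _ => mul_mem_graded' (hv k) (hw k) h

/-- Adding a bosonic row and column to a Berezinian. -/
theorem ber_succ_left {k l : ℕ} {P : Matrix (Fin (k + 1)) (Fin (k + 1)) A}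
    {Q : Matrix (Fin (k + 1)) (Fin l) A} {R : Matrix (Fin l) (Fin (k + 1)) A}
    {S : Matrix (Fin l) (Fin l) A} (hP : ∀ i j, P i j ∈ 𝒜 0) (hQ : ∀ i j, Q i j ∈ 𝒜 1)
    (hR : ∀ i j, R i j ∈ 𝒜 1) (hS : ∀ i j, S i j ∈ 𝒜 0) (hu : IsUnit (evenDet 𝒜 S))
    {w : Fin (k + 1) → A} {w' : Fin l → A} (hw : ∀ i, w i ∈ 𝒜 0) (hw1 : w (Fin.last k) = 1)
    {x : A} (hx : x ∈ 𝒜 0) (h : w ᵥ* P + w' ᵥ* R = Pi.single (Fin.last k) x)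
    (h' : w ᵥ* Q + w' ᵥ* S = 0) :
    ber 𝒜 P Q R S = evenPart 𝒜 x * ber 𝒜 (P.submatrix Fin.castSucc Fin.castSucc)
      (Q.submatrix Fin.castSucc id) (R.submatrix id Fin.castSucc) S := by
  have hZ : ∀ i j, (P - Q * evenInv 𝒜 S * R) i j ∈ 𝒜 0 := fun i j =>
    sub_mem (hP i j) (mul_mem_of_odd (p := 1) (q := 1)
      (mul_mem_of_odd (p := 1) (q := 0) hQ (evenInv_mem S)) hR i j)
  -- From w'S = -wQ one gets w'R = -wQS⁻¹R, so the Schur complement inherits the row relation with w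
  -- alone.
  have h1 : w ᵥ* (P - Q * evenInv 𝒜 S * R) = Pi.single (Fin.last k) x := by
    rw [vecMul_sub, Matrix.mul_assoc, ← vecMul_vecMul, eq_neg_of_add_eq_zero_left h', neg_vecMul,
      vecMul_vecMul, ← Matrix.mul_assoc, mul_evenInv hS hu, Matrix.one_mul, sub_neg_eq_add, h]
  unfold ber
  rw [evenDet_of_vecMul hZ hw hw1 hx h1, mul_assoc]
  rfl

/-- Adding a fermionic row and column to a Berezinian. -/
theorem ber_succ_right {k l : ℕ} {P : Matrix (Fin k) (Fin k) A}
    {Q : Matrix (Fin k) (Fin (l + 1)) A} {R : Matrix (Fin (l + 1)) (Fin k) A}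
    {S : Matrix (Fin (l + 1)) (Fin (l + 1)) A} (hP : ∀ i j, P i j ∈ 𝒜 0) (hQ : ∀ i j, Q i j ∈ 𝒜 1)
    (hR : ∀ i j, R i j ∈ 𝒜 1) (hS : ∀ i j, S i j ∈ 𝒜 0)
    (hu : IsUnit (evenDet 𝒜 (S.submatrix Fin.castSucc Fin.castSucc)))
    {w : Fin k → A} {w' : Fin (l + 1) → A} (hw : ∀ i, w i ∈ 𝒜 1) (hw1 : w' (Fin.last l) = 1)
    {x xi : A} (hx : SuperCalculus.EvenInv 𝒜 x xi) (h : w ᵥ* P + w' ᵥ* R = 0)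
    (h' : w ᵥ* Q + w' ᵥ* S = Pi.single (Fin.last l) x) :
    IsUnit (evenDet 𝒜 S) ∧ ber 𝒜 P Q R S * evenPart 𝒜 x = ber 𝒜 P (Q.submatrix id Fin.castSucc)
      (R.submatrix Fin.castSucc id) (S.submatrix Fin.castSucc Fin.castSucc) := by
  set S₀ := S.submatrix Fin.castSucc Fin.castSucc with hS₀
  set Q₀ := Q.submatrix id Fin.castSucc with hQ₀
  set R₀ := R.submatrix Fin.castSucc id with hR₀
  set T := evenInv 𝒜 S₀
  have hTS : T * S₀ = 1 := evenInv_mul (fun _ _ => hS _ _) hu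
  have hST : S₀ * T = 1 := mul_evenInv (fun _ _ => hS _ _) hu
  set wo : Fin l → A := fun i => w' i.castSucc
  set sN : Fin l → A := fun i => S i.castSucc (Fin.last l)
  set sL : Fin l → A := fun i => S (Fin.last l) i.castSucc with hsL_def
  set rL : Fin k → A := fun i => R (Fin.last l) i
  set qN : Fin k → A := fun i => Q i (Fin.last l)
  set c : Fin l → A := T *ᵥ sN
  set Y : Matrix (Fin l) (Fin k) A := T * R₀
  set Z : Matrix (Fin k) (Fin k) A := P - Q₀ * Y with hZ_def
  set v : Fin k → A := qN - Q₀ *ᵥ c with hv_def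
  set σ : A := x - w ⬝ᵥ v with hσ_def
  have hcm : ∀ i, c i ∈ 𝒜 0 := fun i => dotProduct_mem (evenInv_mem S₀ i) (fun _ => hS _ _) (add_zero 0)
  have hvm : ∀ i, v i ∈ 𝒜 1 := fun i =>
    sub_mem (hQ _ _) (dotProduct_mem (fun j => hQ i _) hcm (add_zero 1))
  have hYm : ∀ i j, Y i j ∈ 𝒜 1 :=
    mul_mem_of_odd (p := 0) (q := 1) (evenInv_mem S₀) fun _ _ => hR _ _
  have hZm : ∀ i j, Z i j ∈ 𝒜 0 := fun i j =>
    sub_mem (hP i j) (mul_mem_of_odd (p := 1) (q := 1) (fun _ _ => hQ _ _) hYm i j)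
  have hσm : σ ∈ 𝒜 0 := sub_mem hx.mem (dotProduct_mem hw hvm (by decide))
  -- the last rows in terms of the others
  have hsL : sL = -(w ᵥ* Q₀) - wo ᵥ* S₀ := by
    funext j
    have := congrFun h' j.castSucc
    rw [Pi.single_eq_of_ne (Fin.castSucc_lt_last j).ne, Pi.add_apply, vecMul, vecMul, dotProduct,
      dotProduct, Fin.sum_univ_castSucc (fun i => w' i * _), hw1, one_mul, ← add_assoc] at this
    refine (eq_neg_of_add_eq_zero_right this).trans ?_
    rw [neg_add, ← sub_eq_add_neg]; rfl
  have hrL : rL = -(w ᵥ* P) - wo ᵥ* R₀ := by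
    funext j
    have := congrFun h j
    rw [Pi.zero_apply, Pi.add_apply, vecMul, vecMul, dotProduct,
      dotProduct, Fin.sum_univ_castSucc (fun i => w' i * _), hw1, one_mul, ← add_assoc] at this
    refine (eq_neg_of_add_eq_zero_right this).trans ?_
    rw [neg_add, ← sub_eq_add_neg]; rfl
  have hsLL : S (Fin.last l) (Fin.last l) = x - w ⬝ᵥ qN - wo ⬝ᵥ sN := by
    have := congrFun h' (Fin.last l)
    rw [Pi.single_eq_same, Pi.add_apply, vecMul, vecMul, dotProduct, dotProduct,
      Fin.sum_univ_castSucc (fun i => w' i * _), hw1, one_mul] at this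
    rw [← this]
    simp only [dotProduct, qN, wo, sN]
    abel
  have hSc : S₀ *ᵥ c = sN := by rw [mulVec_mulVec, hST, one_mulVec]
  have hSY : S₀ * Y = R₀ := by rw [← Matrix.mul_assoc, hST, Matrix.one_mul]
  -- σ is the Schur complement of S₀ in S, so det S = σ det S₀ below.
  have hσ : S (Fin.last l) (Fin.last l) - sL ⬝ᵥ c = σ := by
    have h1 : (w ᵥ* Q₀) ⬝ᵥ c = w ⬝ᵥ (Q₀ *ᵥ c) := (dotProduct_mulVec _ _ _).symm
    have h2 : (wo ᵥ* S₀) ⬝ᵥ c = wo ⬝ᵥ sN := by rw [← dotProduct_mulVec, hSc]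
    rw [hsL, hsLL, sub_dotProduct, neg_dotProduct, h1, h2, hσ_def, hv_def, dotProduct_sub]
    abel
  have hsLY : sL ᵥ* Y = rL + w ᵥ* Z := by
    rw [hsL, hrL, sub_vecMul, neg_vecMul, vecMul_vecMul, vecMul_vecMul, hSY, hZ_def, vecMul_sub]
    abel
  -- the determinant of the enlarged block
  have hdetS : evenDet 𝒜 S = evenPart 𝒜 σ * evenDet 𝒜 S₀ := by
    refine evenDet_of_last_row (c := fun i => -((sL ᵥ* T) i)) hS (fun i => neg_mem
      (dotProduct_mem (fun _ => hS _ _) (fun j => evenInv_mem S₀ j i) (add_zero 0))) hσm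
      (fun j => ?_) ?_
    · have h1 : ((sL ᵥ* T) ᵥ* S₀) j = sL j := by rw [vecMul_vecMul, hTS, vecMul_one]
      simp only [neg_mul, Finset.sum_neg_distrib]
      rw [← sub_eq_add_neg, sub_eq_zero]
      exact h1.symm
    · have h1 : (sL ᵥ* T) ⬝ᵥ sN = sL ⬝ᵥ c := (dotProduct_mulVec _ _ _).symm
      simp only [neg_mul, Finset.sum_neg_distrib]
      rw [← sub_eq_add_neg, ← hσ, ← h1]
      rfl
  -- `σ` is invertible
  obtain ⟨σi, hσim, hσi⟩ : ∃ σi ∈ 𝒜 0, σi * σ = 1 := by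
    -- Here σ = x(1 - x⁻¹ w·v) with w and v odd, and the determinant supplies an inverse of the
    -- second factor.
    set d := evenDet 𝒜 (1 + vecMulVec v fun i => -(xi * w i))
    have h1 : (d : A) * (1 + (fun i => -(xi * w i)) ⬝ᵥ v) = 1 :=
      evenDet_one_add_vecMulVec hvm fun i =>
        neg_mem (mul_mem_graded' hx.inv_mem (hw i) (zero_add 1))
    refine ⟨d * xi, mul_mem_graded' d.2 hx.inv_mem (zero_add 0), ?_⟩
    rw [← h1, mul_assoc, hσ_def, mul_sub, hx.inv_mul, sub_eq_add_neg]
    congr 2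
    simp only [dotProduct, Finset.mul_sum, ← Finset.sum_neg_distrib, neg_mul, mul_assoc]
  have hσi' : σ * σi = 1 := by rw [comm_of_even hσm, hσi]
  have hσu : evenPart 𝒜 σ * evenPart 𝒜 σi = 1 := Subtype.ext (by
    rw [Subring.coe_mul, coe_evenPart hσm, coe_evenPart hσim, hσi']; rfl)
  have hSu : IsUnit (evenDet 𝒜 S) := by
    rw [hdetS]; exact (IsUnit.of_mul_eq_one _ hσu).mul hu
  refine ⟨hSu, ?_⟩
  -- the enlarged Schur complement
  set yL : Fin k → A := fun j => -(σi * (w ᵥ* Z) j) with hyL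
  set Y' : Matrix (Fin (l + 1)) (Fin k) A :=
    fun i j => Fin.lastCases (motive := fun _ => A) (yL j) (fun i => Y i j - c i * yL j) i
    with hY'_def
  have hY'L : ∀ j, Y' (Fin.last l) j = yL j := fun j => by simp [hY'_def]
  have hY'C : ∀ i j, Y' (Fin.castSucc i) j = Y i j - c i * yL j := fun i j => by simp [hY'_def]
  -- Block elimination: Y' is the solution S⁻¹R expressed through the smaller solution Y and its new
  -- last row.
  have hSY' : S * Y' = R := by
    ext i j
    rw [Matrix.mul_apply, Fin.sum_univ_castSucc, hY'L]
    simp only [hY'C, mul_sub, Finset.sum_sub_distrib]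
    refine Fin.lastCases ?_ (fun i => ?_) i
    · have h1 : ∑ i, S (Fin.last l) (Fin.castSucc i) * Y i j = rL j + (w ᵥ* Z) j :=
        congrFun hsLY j
      have h2 : ∑ i, S (Fin.last l) (Fin.castSucc i) * (c i * yL j) = (sL ⬝ᵥ c) * yL j := by
        simp only [dotProduct, Finset.sum_mul, mul_assoc, hsL_def]
      have h3 : S (Fin.last l) (Fin.last l) * yL j = (sL ⬝ᵥ c) * yL j - (w ᵥ* Z) j := by
        rw [eq_add_of_sub_eq hσ, add_mul, hyL, mul_neg, ← mul_assoc σ, hσi', one_mul]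
        abel
      rw [h1, h2, h3]
      change _ = rL j
      abel
    · have h1 : ∑ i', S (Fin.castSucc i) (Fin.castSucc i') * Y i' j = R (Fin.castSucc i) j :=
        congrFun (congrFun hSY i) j
      have h2 : ∑ i', S (Fin.castSucc i) (Fin.castSucc i') * (c i' * yL j) =
          S (Fin.castSucc i) (Fin.last l) * yL j := by
        simp only [← mul_assoc, ← Finset.sum_mul]
        congr 1
        exact congrFun hSc i
      rw [h1, h2, sub_add_cancel]
  have hinvR : evenInv 𝒜 S * R = Y' := by
    rw [← hSY', ← Matrix.mul_assoc, evenInv_mul hS hSu, Matrix.one_mul]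
  -- The larger Schur complement is the smaller one multiplied by an odd rank-one perturbation of
  -- the identity.
  have hZ' : P - Q * evenInv 𝒜 S * R = (1 + vecMulVec v fun i => σi * w i) * Z := by
    rw [Matrix.mul_assoc, hinvR, Matrix.add_mul, Matrix.one_mul]
    ext i j
    rw [Matrix.sub_apply, Matrix.mul_apply, Fin.sum_univ_castSucc, hY'L]
    simp only [hY'C, mul_sub, Finset.sum_sub_distrib]
    have h1 : ∑ i', Q i (Fin.castSucc i') * (c i' * yL j) = (Q₀ *ᵥ c) i * yL j := by
      simp only [← mul_assoc, ← Finset.sum_mul]; rfl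
    have h2 : ((vecMulVec v fun i => σi * w i) * Z) i j = -(v i * yL j) := by
      rw [Matrix.mul_apply, hyL]
      simp only [vecMulVec_apply, mul_neg, neg_neg, mul_assoc, ← Finset.mul_sum]
      rfl
    have h3 : Z i j = P i j - ∑ i', Q i (Fin.castSucc i') * Y i' j := rfl
    have h4 : v i = Q i (Fin.last l) - (Q₀ *ᵥ c) i := rfl
    rw [h1, Matrix.add_apply, h2, h3, h4, sub_mul]
    abel
  set d := evenDet 𝒜 (1 + vecMulVec v fun i => σi * w i) with hd_def
  -- The determinant of the perturbation is the inverse of 1 + σ⁻¹ w·v = σ⁻¹x. It therefore replaces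
  -- the factor σ in det S by x.
  have hd : d * evenPart 𝒜 x = evenPart 𝒜 σ := by
    have h1 : (d : A) * (1 + (fun i => σi * w i) ⬝ᵥ v) = 1 :=
      evenDet_one_add_vecMulVec hvm fun i => mul_mem_graded' hσim (hw i) (zero_add 1)
    have h2 : 1 + (fun i => σi * w i) ⬝ᵥ v = σi * x := by
      have h3 : (fun i => σi * w i) ⬝ᵥ v = σi * (w ⬝ᵥ v) := by
        simp only [dotProduct, Finset.mul_sum, mul_assoc]
      rw [h3, ← hσi, ← mul_add, hσ_def, sub_add_cancel]
    apply Subtype.ext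
    rw [Subring.coe_mul, coe_evenPart hx.mem, coe_evenPart hσm]
    calc (d : A) * x = σ * σi * (d * x) := by rw [hσi', one_mul]
      _ = σ * (d * (σi * x)) := by
        rw [mul_assoc, ← mul_assoc σi, comm_of_even hσim, mul_assoc]
      _ = σ := by rw [← h2, h1, mul_one]
  have hdm : ∀ i j, (1 + vecMulVec v fun i => σi * w i) i j ∈ 𝒜 0 := by
    intro i j
    rw [Matrix.add_apply, one_apply]
    refine add_mem ?_ (mul_mem_graded' (hvm i) (mul_mem_graded hσim (hw j)) (by decide))
    split_ifs
    · exact one_mem_graded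
    · exact zero_mem _
  have hber : ber 𝒜 P Q₀ R₀ S₀ = evenDet 𝒜 Z * Ring.inverse (evenDet 𝒜 S₀) := by
    rw [ber, Matrix.mul_assoc]
  have h5 : evenPart 𝒜 σ * Ring.inverse (evenPart 𝒜 σ) = 1 :=
    Ring.mul_inverse_cancel _ (IsUnit.of_mul_eq_one _ hσu)
  rw [hber, ber, hZ', evenDet_mul hdm hZm, hdetS, Ring.mul_inverse_rev]
  calc d * evenDet 𝒜 Z * (Ring.inverse (evenDet 𝒜 S₀) * Ring.inverse (evenPart 𝒜 σ)) * evenPart 𝒜 x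
      = evenDet 𝒜 Z * Ring.inverse (evenDet 𝒜 S₀) *
          (d * evenPart 𝒜 x * Ring.inverse (evenPart 𝒜 σ)) := by ring
    _ = evenDet 𝒜 Z * Ring.inverse (evenDet 𝒜 S₀) := by rw [hd, h5, mul_one]

end Berezinian

theorem sum_range_two_mul_add_one {M : Type*} [AddCommMonoid M] (g : ℕ → M) (n : ℕ) :
    ∑ j ∈ Finset.range (2 * n + 1), g j =
      ∑ α : Fin (n + 1), g (2 * α) + ∑ α : Fin n, g (2 * α + 1) := by
  rw [Fin.sum_univ_eq_sum_range (fun α => g (2 * α)), Fin.sum_univ_eq_sum_range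
    (fun α => g (2 * α + 1))]
  induction n with
  | zero => simp
  | succ n ih =>
    have key : ∀ a c x y : M, a + c + x + y = (a + y) + (c + x) := fun a c x y => by abel
    rw [show 2 * (n + 1) + 1 = 2 * n + 1 + 1 + 1 by ring, Finset.sum_range_succ,
      Finset.sum_range_succ, ih, Finset.sum_range_succ _ (n + 1),
      Finset.sum_range_succ (fun α => g (2 * α + 1)) n]
    exact key _ _ _ _

theorem sum_range_two_mul_add_two {M : Type*} [AddCommMonoid M] (g : ℕ → M) (n : ℕ) :
    ∑ j ∈ Finset.range (2 * n + 1 + 1), g j =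
      ∑ α : Fin (n + 1), g (2 * α) + ∑ α : Fin (n + 1), g (2 * α + 1) := by
  rw [Finset.sum_range_succ, sum_range_two_mul_add_one, Fin.sum_univ_castSucc
    (fun α : Fin (n + 1) => g (2 * α + 1)), add_assoc]
  rfl

/-! ### The Berezinian recursion along the orbit. -/

namespace SuperCalculus

variable {A : Type*} [Ring A] [Algebra ℚ A] {𝒜 : ZMod 2 → Submodule ℚ A} [GradedAlgebra 𝒜]
  {C : SuperCalculus 𝒜} {m : ℕ}

theorem dx_pow_apply (α : ℕ) (f : A) : (C.dx ^ α) f = (C.D ^ (2 * α)) f := by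
  rw [pow_mul, pow_two]; rfl

theorem dx_pow_D_apply (α : ℕ) (f : A) : (C.dx ^ α) (C.D f) = (C.D ^ (2 * α + 1)) f := by
  rw [dx_pow_apply, pow_succ, Module.End.mul_apply]

theorem cast_two_mul (i : ℕ) : ((2 * i : ℕ) : ZMod 2) = 0 := by
  rw [Nat.cast_mul, show ((2 : ℕ) : ZMod 2) = 0 from rfl, zero_mul]

theorem dx_pow_mem (α : ℕ) {p : ZMod 2} {f : A} (hf : f ∈ 𝒜 p) : (C.dx ^ α) f ∈ 𝒜 p := by
  have h := C.D_pow_mem (2 * α) hf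
  rwa [cast_two_mul, add_zero, ← dx_pow_apply] at h

variable [NeZero m] [SuperCommutative 𝒜]

/-- L is odd, and a shift of the index by m changes its parity exactly because m is odd. -/
theorem IsSeed.mem {M : ℕ} {X : SKPData A m} {φ : ℕ → A}
    (hX : C.IsSKP (fun j => ((j : ℕ) : ZMod 2)) X) (hm : Odd m) (hφ : C.IsSeed M X φ) :
    ∀ i < M, φ i ∈ 𝒜 i := by
  obtain ⟨f₀, hf, hL⟩ := hX.exists_laxForm
  have hm1 : (m : ZMod 2) = 1 := (ZMod.natCast_eq_one_iff_odd).2 hm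
  intro i
  induction i using Nat.strong_induction_on with
  | _ i ih =>
    intro hi
    by_cases him : i < m
    · rw [show φ i = X.Φ ⟨i, him⟩ from hφ.1 ⟨i, him⟩]
      exact hX.Φ_mem ⟨i, him⟩
    · obtain ⟨k, rfl⟩ := Nat.exists_eq_add_of_le' (not_lt.1 him)
      have hpos : 0 < m := hm.pos
      have hk := ih k (by omega) (by omega)
      obtain ⟨S, hS, h⟩ := hφ.2 k hi
      rw [h, laxApply_eq hL, Nat.cast_add, hm1]
      refine add_mem (add_mem (C.D_mem hk) (mul_mem_graded' hf hk (add_comm _ _)))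
        (sum_mem fun j _ => mul_mem_graded' (hX.Φ_mem _)
          ((hS j).mem _ _ (hX.Ψ_mem j) hk) ?_)
      rw [← add_assoc, ← add_assoc, zmod_two_add_self, zero_add]

section Wronskian

variable {M : ℕ} {X : ℕ → SKPData A m} (hX : C.IsDBOrbit M X)
  (hS : ∀ N ≤ M, ∃ p : Fin m → ZMod 2, C.IsSKP p (X N)) {φ : ℕ → A} (hφ : C.IsSeed M (X 0) φ)
  (hmem : ∀ i < M, φ i ∈ 𝒜 i)
include hX hS hφ hmem

/-- The rows of the supermatrix are the derivatives D_θ^{2α} and D_θ^{2α+1} of the seeds. The even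
and odd coefficients of V, of order 2n, give the relation needed for `ber_succ_left`: V kills every
column except that of φ_n, which it sends to χ. -/
theorem berW_succ_left {n : ℕ} (hn : 2 * n < M) (hu : IsUnit (C.lowerDet n φ)) :
    C.berW (n + 1) n φ = evenPart 𝒜 ((X (2 * n)).Φ (Fin.ofNat m (2 * n))) * C.berW n n φ := by
  obtain ⟨w, hw, hw1, -, hV⟩ := exists_dbIter_eq hX hS hn.le
  obtain ⟨p, hp⟩ := hS (2 * n) hn.le
  have h0 := (dbIter_seed hX hS hφ hn.le).1
  have h1 := dbIter_seed_self hX hS hφ hn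
  have he : ∀ i, 2 * i < M → φ (2 * i) ∈ 𝒜 0 := fun i hi => by
    simpa only [cast_two_mul] using hmem _ hi
  have ho : ∀ i, 2 * i + 1 < M → φ (2 * i + 1) ∈ 𝒜 1 := fun i hi => by
    simpa only [Nat.cast_add, cast_two_mul, Nat.cast_one, zero_add] using hmem _ hi
  have hV' : ∀ f, ∑ α : Fin (n + 1), w (2 * α) * (C.dx ^ (α : ℕ)) f +
      ∑ α : Fin n, w (2 * α + 1) * (C.dx ^ (α : ℕ)) (C.D f) = C.dbIter X (2 * n) f := fun f => by
    rw [hV, sum_range_two_mul_add_one]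
    simp only [dx_pow_D_apply]
    simp only [dx_pow_apply]
  refine ber_succ_left (w := fun α => w (2 * α)) (w' := fun α => w (2 * α + 1))
    (fun α β => dx_pow_mem _ (he _ (by omega))) (fun α β => dx_pow_mem _ (ho _ (by omega)))
    (fun α β => dx_pow_mem _ (C.D_mem (he _ (by omega))))
    (fun α β => dx_pow_mem _ (C.D_mem (p := 1) (ho _ (by omega)))) hu (fun α => ?_) hw1
    (hX _ hn |>.evenInv hp).mem ?_ ?_
  · simpa only [cast_two_mul, add_zero] using hw (2 * α)
  · funext β
    refine (hV' (φ (2 * β))).trans ?_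
    refine Fin.lastCases ?_ (fun β => ?_) β
    · rw [Pi.single_eq_same]; exact h1
    · rw [Pi.single_eq_of_ne (Fin.castSucc_lt_last β).ne]
      exact h0 _ (by simp)
  · funext β
    exact (hV' (φ (2 * β + 1))).trans (h0 _ (by omega))

/-- Now V has odd order 2n + 1, so its leading coefficient 1 sits on the last fermionic row and its
even coefficients are fermionic, as `ber_succ_right` demands. Invertibility of the enlarged lower
block comes out rather than being assumed. -/
theorem berW_succ_right {n : ℕ} (hn : 2 * n + 1 < M) (hu : IsUnit (C.lowerDet n φ)) :
    IsUnit (C.lowerDet (n + 1) φ) ∧ C.berW (n + 1) (n + 1) φ *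
      evenPart 𝒜 ((X (2 * n + 1)).Φ (Fin.ofNat m (2 * n + 1))) = C.berW (n + 1) n φ := by
  obtain ⟨w, hw, hw1, -, hV⟩ := exists_dbIter_eq hX hS hn.le
  obtain ⟨p, hp⟩ := hS (2 * n + 1) hn.le
  have h0 := (dbIter_seed hX hS hφ hn.le).1
  have h1 := dbIter_seed_self hX hS hφ hn
  have he : ∀ i, 2 * i < M → φ (2 * i) ∈ 𝒜 0 := fun i hi => by
    simpa only [cast_two_mul] using hmem _ hi
  have ho : ∀ i, 2 * i + 1 < M → φ (2 * i + 1) ∈ 𝒜 1 := fun i hi => by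
    simpa only [Nat.cast_add, cast_two_mul, Nat.cast_one, zero_add] using hmem _ hi
  have hV' : ∀ f, ∑ α : Fin (n + 1), w (2 * α) * (C.dx ^ (α : ℕ)) f +
      ∑ α : Fin (n + 1), w (2 * α + 1) * (C.dx ^ (α : ℕ)) (C.D f) =
        C.dbIter X (2 * n + 1) f := fun f => by
    rw [hV, sum_range_two_mul_add_two]
    simp only [dx_pow_D_apply]
    simp only [dx_pow_apply]
  refine ber_succ_right (P := C.wronskian (n + 1) fun β : Fin (n + 1) => φ (2 * β))
    (Q := C.wronskian (n + 1) fun β : Fin (n + 1) => φ (2 * β + 1))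
    (R := C.wronskian (n + 1) fun β : Fin (n + 1) => C.D (φ (2 * β)))
    (S := C.wronskian (n + 1) fun β : Fin (n + 1) => C.D (φ (2 * β + 1))) (w := fun α => w (2 * α)) (w' := fun α => w (2 * α + 1))
    (fun α β => dx_pow_mem _ (he _ (by omega))) (fun α β => dx_pow_mem _ (ho _ (by omega)))
    (fun α β => dx_pow_mem _ (C.D_mem (he _ (by omega))))
    (fun α β => dx_pow_mem _ (C.D_mem (p := 1) (ho _ (by omega)))) hu (fun α => ?_) hw1
    (hX _ hn |>.evenInv hp) ?_ ?_
  · simpa only [Nat.cast_add, cast_two_mul, Nat.cast_one, zero_add, add_zero] using hw (2 * α)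
  · funext β
    exact (hV' (φ (2 * β))).trans (h0 _ (by omega))
  · funext β
    refine (hV' (φ (2 * β + 1))).trans ?_
    refine Fin.lastCases ?_ (fun β => ?_) β
    · rw [Pi.single_eq_same]; exact h1
    · rw [Pi.single_eq_of_ne (Fin.castSucc_lt_last β).ne]
      exact h0 _ (by simp)

end Wronskian

theorem isSKP_orbit {M : ℕ} {X : ℕ → SKPData A m} (hX : C.IsDBOrbit M X) {p : Fin m → ZMod 2}
    (hX₀ : C.IsSKP p (X 0)) {τ₀ : A} (hτ₀ : C.IsSuperTau (X 0).L τ₀) :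
    ∀ N ≤ M, (∃ p : Fin m → ZMod 2, C.IsSKP p (X N)) ∧
      C.IsSuperTau (X N).L (tauOrbit X τ₀ N) := by
  intro N hN
  induction N with
  | zero => exact ⟨⟨p, hX₀⟩, hτ₀⟩
  | succ N ih =>
    obtain ⟨⟨p, hp⟩, hτ⟩ := ih (by omega)
    exact ⟨⟨_, hp.dbStep (hX N (by omega))⟩, hτ.dbStep hp (hX N (by omega))⟩

theorem isUnit_evenPart {χ χi : A} (h : EvenInv 𝒜 χ χi) : IsUnit (evenPart 𝒜 χ) :=
  IsUnit.of_mul_eq_one (evenPart 𝒜 χi) (Subtype.ext (by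
    rw [Subring.coe_mul, coe_evenPart h.mem, coe_evenPart h.inv_mem, h.mul_inv]; rfl))

theorem isUnit_coe {b : evenSubring 𝒜} (h : IsUnit b) : IsUnit (b : A) :=
  h.map (evenSubring 𝒜).subtype

end SuperCalculus

/-! ### Assembly of the tau-function formulas. -/

theorem mainTheorem4 {A : Type*} [Ring A] [Algebra ℚ A] (𝒜 : ZMod 2 → Submodule ℚ A)
    [GradedAlgebra 𝒜] [SuperCommutative 𝒜] (C : SuperCalculus 𝒜)
    (m : ℕ) [NeZero m] (hm : Odd m) (M : ℕ) (X : ℕ → SKPData A m)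
    (hX₀ : C.IsSKP (fun j => ((j : ℕ) : ZMod 2)) (X 0))
    (hX : C.IsDBOrbit M X)
    (τ₀ : A) (hτ₀ : C.IsSuperTau (X 0).L τ₀)
    (φ : ℕ → A) (hφ : C.IsSeed M (X 0) φ) :
    (∀ N ≤ M, (∃ p : Fin m → ZMod 2, C.IsSKP p (X N)) ∧
      C.IsSuperTau (X N).L (tauOrbit X τ₀ N)) ∧
    (∀ n : ℕ, 2 * n + 1 ≤ M →
      IsUnit (C.lowerDet n φ) ∧ IsUnit (C.berW (n + 1) n φ) ∧
      tauOrbit X τ₀ (2 * n + 1) = (C.berW (n + 1) n φ : A) * Ring.inverse τ₀) ∧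
    (∀ n : ℕ, 2 * n ≤ M →
      IsUnit (C.lowerDet n φ) ∧ IsUnit (C.berW n n φ) ∧
      tauOrbit X τ₀ (2 * n) = Ring.inverse (C.berW n n φ : A) * τ₀) := by
  have horb := SuperCalculus.isSKP_orbit hX hX₀ hτ₀
  have hS : ∀ N ≤ M, ∃ p : Fin m → ZMod 2, C.IsSKP p (X N) := fun N hN => (horb N hN).1
  have hmem := hφ.mem hX₀ hm
  have hχ : ∀ N < M, SuperCalculus.EvenInv 𝒜 ((X N).Φ (Fin.ofNat m N))
      (Ring.inverse ((X N).Φ (Fin.ofNat m N))) := fun N hN => by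
    obtain ⟨p, hp⟩ := hS N hN.le
    exact (hX N hN).evenInv hp
  -- A bosonic step takes the formula at 2n to the one at 2n + 1; the fermionic step to 2n + 2 is
  -- made in the induction for `heven`, starting from the empty Berezinian 1.
  have hodd : ∀ n, 2 * n < M → (IsUnit (C.lowerDet n φ) ∧ IsUnit (C.berW n n φ) ∧
      tauOrbit X τ₀ (2 * n) = Ring.inverse (C.berW n n φ : A) * τ₀) →
      IsUnit (C.lowerDet n φ) ∧ IsUnit (C.berW (n + 1) n φ) ∧
      tauOrbit X τ₀ (2 * n + 1) = (C.berW (n + 1) n φ : A) * Ring.inverse τ₀ := by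
    rintro n hn ⟨h1, h2, h3⟩
    have hE := hχ _ hn
    have hb := SuperCalculus.berW_succ_left hX hS hφ hmem hn h1
    refine ⟨h1, ?_, ?_⟩
    · rw [hb]; exact (SuperCalculus.isUnit_evenPart hE).mul h2
    · change (X (2 * n)).Φ (Fin.ofNat m (2 * n)) * Ring.inverse (tauOrbit X τ₀ (2 * n)) = _
      rw [h3, hb, Subring.coe_mul, coe_evenPart hE.mem, Ring.inverse_mul (Or.inr hτ₀.unit),
        Ring.inverse_inverse (SuperCalculus.isUnit_coe h2), comm_of_even (inverse_mem_zero hτ₀.even hτ₀.unit),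
        mul_assoc]
  have heven : ∀ n, 2 * n ≤ M → IsUnit (C.lowerDet n φ) ∧ IsUnit (C.berW n n φ) ∧
      tauOrbit X τ₀ (2 * n) = Ring.inverse (C.berW n n φ : A) * τ₀ := by
    intro n
    induction n with
    | zero =>
      intro _
      have h1 : C.lowerDet 0 φ = 1 := Matrix.det_fin_zero
      have h2 : C.berW 0 0 φ = 1 := by
        unfold SuperCalculus.berW ber evenDet
        rw [Matrix.det_fin_zero, Matrix.det_fin_zero, Ring.inverse_one, mul_one]
      rw [h1, h2, Subring.coe_one, Ring.inverse_one, one_mul]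
      exact ⟨isUnit_one, isUnit_one, rfl⟩
    | succ n ih =>
      intro hn
      obtain ⟨h1, h2, h3⟩ := hodd n (by omega) (ih (by omega))
      have hE := hχ (2 * n + 1) (by omega)
      obtain ⟨hu, hb⟩ := SuperCalculus.berW_succ_right hX hS hφ hmem (n := n) (by omega) h1
      -- The new Berezinian is a factor of the invertible previous one in the commutative ring of
      -- bosonic elements.
      have hbu : IsUnit (C.berW (n + 1) (n + 1) φ) := isUnit_of_mul_isUnit_left (hb ▸ h2)
      refine ⟨hu, hbu, ?_⟩
      change (X (2 * n + 1)).Φ (Fin.ofNat m (2 * n + 1)) *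
        Ring.inverse (tauOrbit X τ₀ (2 * n + 1)) = _
      rw [h3, ← hb, Subring.coe_mul, coe_evenPart hE.mem,
        Ring.inverse_mul (Or.inr hτ₀.unit.ringInverse), Ring.inverse_inverse hτ₀.unit,
        Ring.inverse_mul (Or.inl (SuperCalculus.isUnit_coe hbu)), comm_of_even hτ₀.even, mul_assoc,
        ← mul_assoc, hE.mul_inv, one_mul]
  exact ⟨horb, fun n hn => hodd n (by omega) (heven n (by omega)), heven⟩
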